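/- Simplicial complexes are finite abstract simplicial complexes: a finite vertex set with a family of subsets (the simplexes) that is closed under taking faces and contains every singleton of a vertex; the empty simplex belongs to every complex. All complexes have their vertices in one fixed infinite set. Write $\Delta^n$ for the complex of all faces of an $n$-simplex, $\partial\Delta^n$ for the complex of its proper faces, $\star$ for the join, and $\mathrm{lk}(A,K)=\{B\in K : A\cap B=\emptyset,\ A\cup B\in K\}$ for the link of a simplex $A$ in $K$. For a nonempty simplex $A$ of $K$ and a point $a$ that is not a vertex of $K$, the stellar subdivision $(A,a)$ changes $K$ by removing the star $A\star\mathrm{lk}(A,K)$ and replacing it by $a\star\partial A\star\mathrm{lk}(A,K)$. Complexes are stellar equivalent, $K\sim L$, if they are related by a finite sequence of stellar subdivisions, inverses of stellar subdivisions, and simplicial isomorphisms. A stellar $n$-ball ($n\ge 0$) is a complex stellar equivalent to $\Delta^n$; a stellar $n$-sphere ($n\ge -1$) is a complex stellar equivalent to $\partial\Delta^{n+1}$; so the complex $\{\emptyset\}$ is a $(-1)$-sphere and there is no $(-1)$-ball. A stellar $n$-manifold is a complex $M$ such that for every vertex $v$ of $M$ the link $\mathrm{lk}(v,M)$ is a stellar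 $(n-1)$-ball or a stellar $(n-1)$-sphere. Its boundary $\partial M$ consists of the nonempty simplexes of $M$ whose link in $M$ is a stellar ball. **Theorem 3.9** (Alexander). Let $n$ be a natural number, let $M$ be a stellar $n$-manifold and let $J$ be a stellar $n$-ball. Suppose that $M\cap J$ and $\partial M\cap\partial J$ have the same nonempty simplexes and that $M\cap J$ is a stellar $(n-1)$-ball (so that $n\ge 1$). Then $M\cup J\sim M$. -/

import Mathlib

/-!
Finite abstract simplicial complexes are elements `K` of Mathlib's `PreAbstractSimplicialComplex α`
with finitely many faces. The type `α` is a reservoir of possible vertices, and not every element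
of `α` has to be a vertex of `K`. Only nonempty simplexes are recorded: the empty simplex is a
simplex of every complex and is left implicit, so that `⊥` is the complex `{∅}`. The intersection
and the union of two complexes are `M ⊓ J` and `M ⊔ J`.
-/

namespace Stellar

variable {α : Type*} [DecidableEq α]

/-- The vertices of a complex. -/
def vertices (K : PreAbstractSimplicialComplex α) : Set α := {v | {v} ∈ K.faces}

/-- The complex that consists of the simplex with vertex set `s` and all its faces. -/
def simplex (s : Finset α) : PreAbstractSimplicialComplex α where
  faces := {t | t.Nonempty ∧ t ⊆ s}
  isRelLowerSet_faces := fun _ ht => ⟨ht.1, fun _ hu hne => ⟨hne, hu.trans ht.2⟩⟩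

/-- The complex of all proper faces of the simplex with vertex set `s`. -/
def simplexBoundary (s : Finset α) : PreAbstractSimplicialComplex α where
  faces := {t | t.Nonempty ∧ t ⊂ s}
  isRelLowerSet_faces := fun _ ht =>
    ⟨ht.1, fun _ hu hne => ⟨hne, lt_of_le_of_lt hu ht.2⟩⟩

/-- The join `K ⋆ L`, whose simplexes are the unions of a (possibly empty) simplex of `K` and a
(possibly empty) simplex of `L`. It is only used for complexes without common vertices. -/
def join (K L : PreAbstractSimplicialComplex α) : PreAbstractSimplicialComplex α where
  faces := {s | s.Nonempty ∧
    ∃ A B : Finset α, (A = ∅ ∨ A ∈ K.faces) ∧ (B = ∅ ∨ B ∈ L.faces) ∧ s = A ∪ B}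
  isRelLowerSet_faces := by
    have key : ∀ (K : PreAbstractSimplicialComplex α) (A t : Finset α), (A = ∅ ∨ A ∈ K.faces) →
        (t ∩ A = ∅ ∨ t ∩ A ∈ K.faces) := by
      intro K A t h
      rcases h with rfl | h
      · simp
      · rcases (t ∩ A).eq_empty_or_nonempty with h0 | h0
        · exact Or.inl h0
        · exact Or.inr ((K.isRelLowerSet_faces h).2 Finset.inter_subset_right h0)
    rintro s ⟨hs, A, B, hA, hB, rfl⟩
    refine ⟨hs, fun t ht hne => ⟨hne, t ∩ A, t ∩ B, key K A t hA, key L B t hB, ?_⟩⟩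
    rw [← Finset.inter_union_distrib_left]
    exact (Finset.inter_eq_left.2 ht).symm

/-- The link of the simplex `A` in `K`. -/
def link (A : Finset α) (K : PreAbstractSimplicialComplex α) : PreAbstractSimplicialComplex α where
  faces := {B | B ∈ K.faces ∧ Disjoint A B ∧ A ∪ B ∈ K.faces}
  isRelLowerSet_faces := by
    rintro B ⟨hB, hd, hAB⟩
    refine ⟨(K.isRelLowerSet_faces hB).1, fun t ht hne =>
      ⟨(K.isRelLowerSet_faces hB).2 ht hne, hd.mono_right ht,
        (K.isRelLowerSet_faces hAB).2 (Finset.union_subset_union_right ht) ?_⟩⟩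
    exact hne.mono Finset.subset_union_right

/-- The closed star `A ⋆ lk (A, K)` of the simplex `A` in `K`. -/
def star (A : Finset α) (K : PreAbstractSimplicialComplex α) : PreAbstractSimplicialComplex α :=
  join (simplex A) (link A K)

/-- `K'` is obtained from `K` by a stellar subdivision `(A, a)`: here `A` is a simplex of `K` and
`a` is a new vertex, and the star of `A` is removed and replaced by `a ⋆ ∂A ⋆ lk (A, K)`.
(The simplexes of `∂A ⋆ lk (A, K)` are removed and put back.) -/
def IsStellarSubdivision (K K' : PreAbstractSimplicialComplex α) : Prop :=
  ∃ A ∈ K.faces, ∃ a : α, a ∉ vertices K ∧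
    K'.faces = (K.faces \ (star A K).faces) ∪
      (join (simplex {a}) (join (simplexBoundary A) (link A K))).faces

/-- `K` and `L` are simplicially isomorphic: a bijection between their vertices induces a
bijection between their simplexes. The values of `f` off the vertices of `K` are irrelevant. -/
def IsSimplicialIso (K L : PreAbstractSimplicialComplex α) : Prop :=
  ∃ f : α → α, Set.BijOn f (vertices K) (vertices L) ∧
    Set.BijOn (fun s : Finset α => s.image f) K.faces L.faces

/-- Stellar equivalence `K ∼ L`: the complexes are related by a finite sequence of stellar
subdivisions, stellar welds (the inverses of stellar subdivisions) and simplicial isomorphisms. -/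
def StellarEquiv (K L : PreAbstractSimplicialComplex α) : Prop :=
  Relation.EqvGen (fun K₁ K₂ => IsStellarSubdivision K₁ K₂ ∨ IsSimplicialIso K₁ K₂) K L

/-- A stellar `n`-ball is a complex that is stellar equivalent to an `n`-simplex, `n ≥ 0`.
(The complex `⊥` is the `(-1)`-sphere, and there is no `(-1)`-ball.) -/
def IsStellarBall (n : ℤ) (K : PreAbstractSimplicialComplex α) : Prop :=
  ∃ s : Finset α, s.Nonempty ∧ (s.card : ℤ) = n + 1 ∧ StellarEquiv K (simplex s)

/-- A stellar `n`-sphere is a complex that is stellar equivalent to the boundary of an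
`(n + 1)`-simplex, `n ≥ -1`. -/
def IsStellarSphere (n : ℤ) (K : PreAbstractSimplicialComplex α) : Prop :=
  ∃ s : Finset α, s.Nonempty ∧ (s.card : ℤ) = n + 2 ∧ StellarEquiv K (simplexBoundary s)

/-- A stellar `n`-manifold is a finite complex in which the link of every vertex is a stellar
`(n - 1)`-ball or a stellar `(n - 1)`-sphere. -/
def IsStellarManifold (n : ℤ) (M : PreAbstractSimplicialComplex α) : Prop :=
  M.faces.Finite ∧
    ∀ v ∈ vertices M, IsStellarBall (n - 1) (link {v} M) ∨ IsStellarSphere (n - 1) (link {v} M)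

/-- The simplexes of the boundary `∂M` of a stellar manifold `M`: those simplexes of `M` whose
link in `M` is a stellar ball. -/
def boundaryFaces (M : PreAbstractSimplicialComplex α) : Set (Finset α) :=
  {A | A ∈ M.faces ∧ ∃ k : ℤ, IsStellarBall k (link A M)}

end Stellar

/-!
A simplicial complex is treated as the family of *all* its simplexes, the empty one included, and
stellar equivalence is refined to equivalence relative to a subcomplex `F` (`RelEquiv F`): only
subdivisions at simplexes off `F`, with new vertices off `F`, and their inverses are used. Such a
chain of moves can be carried out in any complex glued on along `F` (`RelEquiv.union`), and a chain
relative to `L` can be rearranged to be relative to a larger `F` if both of its ends meet `F` only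
in `L` (`RelEquiv.extend`). Isomorphisms are superfluous, since the subdivision at a vertex
renames it (`relEquiv_image`).

The boundary is detected by parity: `bd K` consists of the simplexes that lie in an even number of
simplexes of `K`. This commutes with subdivisions (`bd_sd`) and with links (`bd_lk`), and in
manifolds it singles out the simplexes whose link is a ball.

Four facts carry the argument.

* A ball `Q` is equivalent, relative to `bd Q`, to the cone over `bd Q` (`Ball.relEquiv_cone_bd`).
  For the induction along a chain of moves from the simplex to `Q` the statement is needed for
  the joins `A ⋆ Q` (`Ball.conical`): undoing a subdivision replaces the star of a simplex, which
  is again a join of a simplex with a ball or sphere of smaller dimension.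
* A cone over a ball `K` of codimension one in the boundary of a manifold `M` can be attached to
  `M` without changing its class (`Ball.attachable`). If `K` is itself a cone, two subdivisions of
  a suitable `M` add the new cone; the general case follows along the chain of moves from the first
  fact, since every simplex of `K` off `bd K` has the same link in `K` and in `bd M`
  (`Sphere.eq_of_subset`).
* Deleting the open star of a simplex from a sphere leaves a ball (`Sphere.ball_del`).
* The complement of a ball in a sphere of the same dimension is a ball with the same boundary
  (`Ball.ball_closedCompl`, `Ball.bd_closedCompl`).

Now let `K = M ∩ J`, and let `K'` be the complement of `K` in the sphere `bd J`. Relative to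
`M ∪ bd J`, the ball `J` becomes the cone `v ⋆ bd J = v ⋆ K ∪ v ⋆ K'`, and relative to
`M ∪ v ⋆ K`, the ball `K'` becomes the cone `w ⋆ bd K`. Hence `M ∪ J` is equivalent to
`(M ∪ v ⋆ K) ∪ w ⋆ (v ⋆ bd K)`, which arises from `M` by attaching two cones over balls in the
boundary.
-/

set_option linter.unusedSectionVars false

namespace Stellar

/-! ### Stellar subdivision of families of finite sets -/

section

variable {α : Type*} [DecidableEq α]

/-- A finite simplicial complex, as the family of all its simplexes. The empty simplex is a member,
so that links, joins and cones need no case distinctions. -/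
structure IsCx (K : Set (Finset α)) : Prop where
  empty_mem : ∅ ∈ K
  down : ∀ ⦃T U : Finset α⦄, T ∈ K → U ⊆ T → U ∈ K
  fin : K.Finite

/-- The stellar subdivision `(A, a)` of `K`. A set that contains `a` is a simplex of it if it does
not contain `A` and its other vertices span a simplex of `K` together with `A`. The definition is
meaningful when `A` is a nonempty simplex of `K` and `a` is not a vertex of `K`. -/
def sd (A : Finset α) (a : α) (K : Set (Finset α)) : Set (Finset α) :=
  {T | ¬ A ⊆ T ∧ ((a ∈ T ∧ T.erase a ∪ A ∈ K) ∨ (a ∉ T ∧ T ∈ K))}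

/-- The point `a` is not a vertex of `K`. -/
def Fresh (a : α) (K : Set (Finset α)) : Prop := ∀ T ∈ K, a ∉ T

theorem mem_sd {A : Finset α} {a : α} {K : Set (Finset α)} {T : Finset α} :
    T ∈ sd A a K ↔ ¬ A ⊆ T ∧ ((a ∈ T ∧ T.erase a ∪ A ∈ K) ∨ (a ∉ T ∧ T ∈ K)) := Iff.rfl

theorem IsCx.sd {K : Set (Finset α)} (hK : IsCx K) {A : Finset α} (hA : A.Nonempty) (a : α) :
    IsCx (sd A a K) := by
  refine ⟨?_, ?_, ?_⟩
  · refine ⟨fun h => ?_, Or.inr ⟨by simp, hK.empty_mem⟩⟩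
    exact hA.ne_empty (Finset.subset_empty.1 h)
  · rintro T U ⟨h1, h2⟩ hU
    refine ⟨fun h => h1 (h.trans hU), ?_⟩
    by_cases ha : a ∈ U
    · rcases h2 with ⟨h3, h4⟩ | ⟨h3, h4⟩
      · exact Or.inl ⟨ha, hK.down h4 (by gcongr)⟩
      · exact absurd (hU ha) h3
    · refine Or.inr ⟨ha, ?_⟩
      rcases h2 with ⟨h3, h4⟩ | ⟨h3, h4⟩
      · refine hK.down h4 ?_
        intro x hx
        have : x ≠ a := by rintro rfl; exact ha hx
        simp [this, hU hx]
      · exact hK.down h4 hU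
  · refine (hK.fin.union (hK.fin.image (insert a))).subset ?_
    rintro T ⟨h1, ⟨h3, h4⟩ | ⟨h3, h4⟩⟩
    · refine Or.inr ⟨T.erase a, hK.down h4 Finset.subset_union_left, Finset.insert_erase h3⟩
    · exact Or.inl h4

theorem insert_cases (a : α) (T : Finset α) : (∃ S, a ∉ S ∧ T = insert a S) ∨ a ∉ T := by
  by_cases h : a ∈ T
  · exact Or.inl ⟨T.erase a, by simp, (Finset.insert_erase h).symm⟩
  · exact Or.inr h

theorem ext_insert {X Y : Set (Finset α)} (a : α) (h1 : ∀ S, a ∉ S → (S ∈ X ↔ S ∈ Y))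
    (h2 : ∀ S, a ∉ S → (insert a S ∈ X ↔ insert a S ∈ Y)) : X = Y := by
  ext T
  rcases insert_cases a T with ⟨S, hS, rfl⟩ | h
  · exact h2 S hS
  · exact h1 T h

/-- Two families agree if they agree on the sets obtained from a set without `a` and `b` by
inserting any of the two points. Identities between iterated subdivisions are checked this way. -/
theorem ext_insert₂ {X Y : Set (Finset α)} (a b : α)
    (h1 : ∀ S, a ∉ S → b ∉ S → (S ∈ X ↔ S ∈ Y))
    (h2 : ∀ S, a ∉ S → b ∉ S → (insert a S ∈ X ↔ insert a S ∈ Y))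
    (h3 : ∀ S, a ∉ S → b ∉ S → (insert b S ∈ X ↔ insert b S ∈ Y))
    (h4 : ∀ S, a ∉ S → b ∉ S → (insert a (insert b S) ∈ X ↔ insert a (insert b S) ∈ Y)) :
    X = Y := by
  refine ext_insert a (fun S ha => ?_) (fun S ha => ?_)
  · rcases insert_cases b S with ⟨S, hS, rfl⟩ | h
    · exact h3 S (fun h => ha (Finset.mem_insert_of_mem h)) hS
    · exact h1 S ha h
  · rcases insert_cases b S with ⟨S, hS, rfl⟩ | h
    · exact h4 S (fun h => ha (Finset.mem_insert_of_mem h)) hS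
    · exact h2 S ha h

/-- If `C ⊆ B`, the subdivision at `C` cuts `B` into simplexes that all contain the simplex
`c ⋆ (B \ C)`; subdividing at `B` first and at `C` next is the same as subdividing at `C` first and
at that simplex next. -/
theorem sd_comm_of_subset {K : Set (Finset α)} {B C : Finset α} {b c : α}
    (hCB : C ⊆ B) (hc : c ∉ B) (hb : b ∉ B) (hcb : c ≠ b) :
    sd C c (sd B b K) = sd (insert c (B \ C)) b (sd C c K) := by
  have hcC : c ∉ C := fun h => hc (hCB h)
  have hbC : b ∉ C := fun h => hb (hCB h)
  have hbc := hcb.symm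
  have e1 : ∀ S, B \ C ⊆ S ↔ B ⊆ S ∪ C := fun S => by
    rw [Finset.union_comm]; exact sdiff_le_iff
  have e2 : ∀ S, C ⊆ S ∪ (B \ C) ↔ C ⊆ S := fun S => by
    constructor
    · intro h x hx
      have := h hx
      simp_all
    · exact fun h => h.trans Finset.subset_union_left
  have e3 : ∀ S, S ∪ (B \ C ∪ C) = S ∪ B := fun S => by
    rw [Finset.sdiff_union_of_subset hCB]
  have e4 : ∀ S, S ∪ (C ∪ B) = S ∪ B := fun S => by
    rw [Finset.union_eq_right.2 hCB]
  have e5 : ∀ S, B ⊆ S → C ⊆ S := fun S h => hCB.trans h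
  apply ext_insert₂ c b <;> intro S h1 h2
  all_goals simp [mem_sd, *, Finset.subset_insert_iff_of_notMem, Finset.insert_subset_iff,
    Finset.erase_insert_of_ne, Finset.insert_union]
  all_goals grind only

/-- Subdivisions at two simplexes commute if the simplexes are disjoint or span no simplex. -/
theorem sd_comm {K : Set (Finset α)} (hK : IsCx K) {B C : Finset α} {b c : α}
    (hc : c ∉ B) (hb : b ∉ C) (hc' : c ∉ C) (hb' : b ∉ B) (hcb : c ≠ b)
    (h : B ∪ C ∈ K → Disjoint B C) :
    sd C c (sd B b K) = sd B b (sd C c K) := by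
  have hbc := hcb.symm
  have key : ∀ {B C : Finset α}, (B ∪ C ∈ K → Disjoint B C) → ∀ X : Finset α, X ∪ C ∈ K →
      (B ⊆ X ∪ C ↔ B ⊆ X) := by
    intro B C h X hX
    refine ⟨fun hB => ?_, fun hB => hB.trans Finset.subset_union_left⟩
    have := h (hK.down hX (Finset.union_subset hB Finset.subset_union_right))
    exact this.left_le_of_le_sup_right hB
  have k1 := key h
  have k2 := key (B := C) (C := B) (by rw [Finset.union_comm, disjoint_comm]; exact h)
  have e1 : ∀ S, S ∪ (C ∪ B) = S ∪ (B ∪ C) := fun S => by rw [Finset.union_comm C]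
  clear key h
  apply ext_insert₂ c b <;> intro S h1 h2
  all_goals simp [mem_sd, hc, hb, hc', hb', hcb, hbc, h1, h2, Finset.subset_insert_iff_of_notMem,
    Finset.erase_insert_of_ne, Finset.insert_union]
  · tauto
  · have := k1 S; tauto
  · have := k2 S; tauto
  · have k1 := k1 S
    have k2 := k2 S
    rw [e1]
    by_cases h : S ∪ (B ∪ C) ∈ K
    · have := k1 (hK.down h (by rw [← e1, ← Finset.union_assoc]; exact Finset.subset_union_left))
      have := k2 (hK.down h (by rw [← Finset.union_assoc]; exact Finset.subset_union_left))
      tauto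
    · tauto

set_option maxHeartbeats 1000000 in
/-- Two overlapping simplexes `P ∪ Q` and `Q ∪ R` that span a simplex: the two orders of
subdivision differ, but agree after one more subdivision each. -/
theorem sd_flip {K : Set (Finset α)} {P Q R : Finset α} {b c e : α}
    (hPQ : Disjoint P Q) (hPR : Disjoint P R) (hQR : Disjoint Q R)
    (hb : b ∉ P ∪ Q ∪ R) (hc : c ∉ P ∪ Q ∪ R) (he : e ∉ P ∪ Q ∪ R)
    (hcb : c ≠ b) (hce : c ≠ e) (hbe : b ≠ e) :
    sd (insert c R) e (sd (Q ∪ R) b (sd (P ∪ Q) c K)) =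
      sd (insert b P) e (sd (P ∪ Q) c (sd (Q ∪ R) b K)) := by
  simp only [Finset.mem_union, not_or] at hb hc he
  obtain ⟨⟨hbP, hbQ⟩, hbR⟩ := hb
  obtain ⟨⟨hcP, hcQ⟩, hcR⟩ := hc
  obtain ⟨⟨heP, heQ⟩, heR⟩ := he
  have hbc := hcb.symm
  have hec := hce.symm
  have heb := hbe.symm
  have e1 : ∀ S, P ⊆ S ∪ (Q ∪ R) ↔ P ⊆ S := fun S =>
    ⟨fun h => (Finset.disjoint_union_right.2 ⟨hPQ, hPR⟩).left_le_of_le_sup_right h,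
      fun h => h.trans Finset.subset_union_left⟩
  have e2 : ∀ S, R ⊆ S ∪ (P ∪ Q) ↔ R ⊆ S := fun S =>
    ⟨fun h => (Finset.disjoint_union_right.2 ⟨hPR.symm, hQR.symm⟩).left_le_of_le_sup_right h,
      fun h => h.trans Finset.subset_union_left⟩
  have e3 : ∀ S, Q ⊆ S ∪ R ↔ Q ⊆ S := fun S =>
    ⟨fun h => hQR.left_le_of_le_sup_right h, fun h => h.trans Finset.subset_union_left⟩
  have e4 : ∀ S, P ⊆ S ∪ R ↔ P ⊆ S := fun S =>
    ⟨fun h => hPR.left_le_of_le_sup_right h, fun h => h.trans Finset.subset_union_left⟩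
  have e3' : ∀ S, Q ⊆ S ∪ P ↔ Q ⊆ S := fun S =>
    ⟨fun h => hPQ.symm.left_le_of_le_sup_right h, fun h => h.trans Finset.subset_union_left⟩
  have e4' : ∀ S, R ⊆ S ∪ P ↔ R ⊆ S := fun S =>
    ⟨fun h => hPR.symm.left_le_of_le_sup_right h, fun h => h.trans Finset.subset_union_left⟩
  have u1 : ∀ S, S ∪ (Q ∪ (R ∪ (P ∪ Q))) = S ∪ (P ∪ (Q ∪ R)) := fun S => by
    ext x; simp only [Finset.mem_union]; tauto
  have u2 : ∀ S, S ∪ (R ∪ (Q ∪ (R ∪ (P ∪ Q)))) = S ∪ (P ∪ (Q ∪ R)) := fun S => by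
    ext x; simp only [Finset.mem_union]; tauto
  have u3 : ∀ S, S ∪ (R ∪ (P ∪ Q)) = S ∪ (P ∪ (Q ∪ R)) := fun S => by
    ext x; simp only [Finset.mem_union]; tauto
  have u4 : ∀ S, S ∪ (P ∪ (P ∪ (Q ∪ R))) = S ∪ (P ∪ (Q ∪ R)) := fun S => by
    ext x; simp only [Finset.mem_union]; tauto
  have u5 : ∀ S, S ∪ (R ∪ (Q ∪ R)) = S ∪ (Q ∪ R) := fun S => by
    ext x; simp only [Finset.mem_union]; tauto
  have u6 : ∀ S, S ∪ (P ∪ (P ∪ Q)) = S ∪ (P ∪ Q) := fun S => by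
    ext x; simp only [Finset.mem_union]; tauto
  have s1 : ∀ S Y, R ⊆ S ∪ (R ∪ Y) := fun S Y => by
    intro x hx; simp [hx]
  have s2 : ∀ S Y, P ⊆ S ∪ (P ∪ Y) := fun S Y => by
    intro x hx; simp [hx]
  have s3 : ∀ S Y Z, Q ⊆ S ∪ (Y ∪ (Q ∪ Z)) := fun S Y Z => by
    intro x hx; simp [hx]
  have s4 : ∀ S Y, Q ⊆ S ∪ (Y ∪ Q) := fun S Y => by
    intro x hx; simp [hx]
  have s5 : ∀ S Y, Q ⊆ S ∪ (Q ∪ Y) := fun S Y => by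
    intro x hx; simp [hx]
  have s6 : ∀ S Y, R ⊆ S ∪ (Y ∪ R) := fun S Y => by
    intro x hx; simp [hx]
  have s7 : ∀ S Y Z, R ⊆ S ∪ (Y ∪ (Z ∪ R)) := fun S Y Z => by
    intro x hx; simp [hx]
  clear hPQ hPR hQR
  apply ext_insert₂ c b <;> intro S h1 h2
  all_goals rcases insert_cases e S with ⟨S, h3, rfl⟩ | h3
  all_goals try simp only [Finset.mem_insert, not_or] at h1 h2
  all_goals simp [mem_sd, *, Finset.subset_insert_iff_of_notMem,
    Finset.insert_subset_iff, Finset.erase_insert_of_ne, Finset.insert_union,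
    Finset.union_subset_iff]
  all_goals grind only
end

/-! ### Stellar equivalence relative to a subfamily -/

section

variable {α : Type*} [DecidableEq α]

/-- One stellar subdivision of `K` off `F`: neither the subdivided simplex belongs to `F` nor is
the new vertex a vertex of `F`. -/
def RelStep (F K K' : Set (Finset α)) : Prop :=
  IsCx K ∧ ∃ A ∈ K, A.Nonempty ∧ A ∉ F ∧ ∃ a, Fresh a K ∧ Fresh a F ∧ K' = sd A a K

/-- Stellar equivalence relative to `F`, generated by the stellar subdivisions off `F`. Simplicial
isomorphisms are not included among the generators; for `F = ∅` they are consequences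
(`relEquiv_image`). -/
def RelEquiv (F : Set (Finset α)) : Set (Finset α) → Set (Finset α) → Prop :=
  Relation.EqvGen (RelStep F)

variable {F G K K' L : Set (Finset α)} {A B C T : Finset α} {a b c v : α}

theorem RelEquiv.refl (F K : Set (Finset α)) : RelEquiv F K K := Relation.EqvGen.refl K

theorem RelEquiv.symm (h : RelEquiv F K K') : RelEquiv F K' K := Relation.EqvGen.symm _ _ h

theorem RelEquiv.trans {K'' : Set (Finset α)} (h : RelEquiv F K K') (h' : RelEquiv F K' K'') :
    RelEquiv F K K'' := Relation.EqvGen.trans _ _ _ h h'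

theorem RelEquiv.step (hK : IsCx K) (hA : A ∈ K) (hAn : A.Nonempty) (hAF : A ∉ F)
    (haK : Fresh a K) (haF : Fresh a F) : RelEquiv F K (sd A a K) :=
  Relation.EqvGen.rel _ _ ⟨hK, A, hA, hAn, hAF, a, haK, haF, rfl⟩

/-- Induction over a chain of moves, for a property that passes through moves in both directions.
-/
theorem RelEquiv.invariant {P : Set (Finset α) → Prop}
    (hP : ∀ K A a, IsCx K → A ∈ K → A.Nonempty → A ∉ F → Fresh a K → Fresh a F →
      (P K ↔ P (sd A a K)))
    (h : RelEquiv F K K') : P K ↔ P K' := by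
  induction h with
  | rel K K' h =>
    obtain ⟨hK, A, hA, hAn, hAF, a, haK, haF, rfl⟩ := h
    exact hP K A a hK hA hAn hAF haK haF
  | refl => rfl
  | symm _ _ _ ih => exact ih.symm
  | trans _ _ _ _ _ ih1 ih2 => exact ih1.trans ih2

theorem RelEquiv.mono (hFG : F ⊆ G) (h : RelEquiv G K K') : RelEquiv F K K' := by
  refine Relation.EqvGen.mono ?_ _ _ h
  rintro K K' ⟨hK, A, hA, hAn, hAF, a, haK, haF, rfl⟩
  exact ⟨hK, A, hA, hAn, fun h => hAF (hFG h), a, haK, fun T hT => haF T (hFG hT), rfl⟩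

theorem RelEquiv.isCx_iff (h : RelEquiv F K K') : IsCx K ↔ IsCx K' :=
  h.invariant fun _ _ a hK _ hAn _ _ _ => ⟨fun h => h.sd hAn a, fun _ => hK⟩

/-- The moves do not affect the simplexes of `F`. -/
theorem RelEquiv.mem_iff (hF : ∀ ⦃T U : Finset α⦄, T ∈ F → U ⊆ T → U ∈ F)
    (h : RelEquiv F K K') (hT : T ∈ F) : T ∈ K ↔ T ∈ K' := by
  refine h.invariant (P := fun K => T ∈ K) fun K A a hK hA hAn hAF haK haF => ?_
  have h1 : a ∉ T := haF T hT
  have h2 : ¬ A ⊆ T := fun h => hAF (hF hT h)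
  simp [mem_sd, h1, h2]

theorem Fresh.sd (hb : Fresh b K) (hab : b ≠ a) : Fresh b (sd A a K) := by
  rintro T ⟨-, ⟨h1, h2⟩ | ⟨h1, h2⟩⟩ hbT
  · exact hb _ h2 (by simp [hab, hbT])
  · exact hb _ h2 hbT

theorem Fresh.mono (hFG : F ⊆ G) (h : Fresh a G) : Fresh a F := fun T hT => h T (hFG hT)

theorem fresh_union : Fresh a (F ∪ G) ↔ Fresh a F ∧ Fresh a G := by
  simp only [Fresh, Set.mem_union, or_imp, forall_and]

theorem fresh_insert : Fresh a (insert A F) ↔ a ∉ A ∧ Fresh a F := by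
  simp only [Fresh, Set.mem_insert_iff, or_imp, forall_and, forall_eq]

theorem exists_fresh [Infinite α] (hK : K.Finite) (V : Finset α) : ∃ a, a ∉ V ∧ Fresh a K := by
  obtain ⟨a, ha⟩ := Infinite.exists_notMem_finset (V ∪ hK.toFinset.sup id)
  rw [Finset.mem_union, not_or] at ha
  refine ⟨a, ha.1, fun T hT haT => ha.2 ?_⟩
  exact Finset.le_sup (f := id) (hK.mem_toFinset.2 hT) haT

theorem fresh_iff (hK : IsCx K) : Fresh a K ↔ {a} ∉ K := by
  refine ⟨fun h h' => h _ h' (by simp), fun h T hT ha => h (hK.down hT (by simpa using ha))⟩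

theorem IsCx.union (hK : IsCx K) (hL : IsCx L) : IsCx (K ∪ L) :=
  ⟨Or.inl hK.empty_mem, fun _ _ h hU => h.imp (fun h => hK.down h hU) fun h => hL.down h hU,
    hK.fin.union hL.fin⟩

theorem IsCx.nonempty_of_notMem (hK : IsCx K) (hA : A ∉ K) : A.Nonempty := by
  rw [Finset.nonempty_iff_ne_empty]
  rintro rfl
  exact hA hK.empty_mem

theorem sd_union (hG : ∀ ⦃T U : Finset α⦄, T ∈ G → U ⊆ T → U ∈ G) (hA : A ∉ G)
    (ha : Fresh a G) : sd A a (K ∪ G) = sd A a K ∪ G := by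
  have h1 : ∀ T ∈ G, ¬ A ⊆ T := fun T hT h => hA (hG hT h)
  ext T
  have h2 : T.erase a ∪ A ∉ G := fun h => h1 _ h Finset.subset_union_right
  simp only [mem_sd, Set.mem_union]
  have h3 := h1 T
  have h4 := ha T
  tauto

/-- Moves relative to `F` can be carried out with any part `G` of `F` glued on. -/
theorem RelEquiv.union (hG : IsCx G) (hGF : G ⊆ F) (h : RelEquiv F K K') :
    RelEquiv F (K ∪ G) (K' ∪ G) := by
  induction h with
  | rel K K' h =>
    obtain ⟨hK, A, hA, hAn, hAF, a, haK, haF, rfl⟩ := h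
    rw [← sd_union hG.down (fun h => hAF (hGF h)) (haF.mono hGF)]
    exact .step (hK.union hG) (Or.inl hA) hAn hAF (fresh_union.2 ⟨haK, haF.mono hGF⟩) haF
  | refl => exact .refl _ _
  | symm _ _ _ ih => exact ih.symm
  | trans _ _ _ _ _ ih1 ih2 => exact ih1.trans ih2

/-- Subdivision at a vertex `c` with new vertex `b` renames `c` as `b`. -/
theorem sd_singleton_sd (hc : Fresh c K) (hc' : Fresh b K) (hcA : c ∉ A) (hbA : b ∉ A)
    (hcb : c ≠ b) :
    sd {c} b (sd A c K) = sd A b K := by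
  have hbc := hcb.symm
  have h1 : ∀ S, insert c S ∉ K := fun S h => hc _ h (by simp)
  have h2 : ∀ S, c ∉ A → insert c (S ∪ A) ∉ K := fun S _ h => hc _ h (by simp)
  have h3 : ∀ S, insert b S ∉ K := fun S h => hc' _ h (by simp)
  apply ext_insert₂ c b <;> intro S hS hS'
  all_goals simp [mem_sd, *, Finset.subset_insert_iff_of_notMem,
    Finset.erase_insert_of_ne, Finset.insert_union]

theorem relEquiv_sd_sd_vertex (hK : IsCx K) (hA : A ∈ K) (hAn : A.Nonempty) (hb : Fresh b K)
    (hc : Fresh c K) (hbF : Fresh b F) (hcF : {c} ∉ F) :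
    RelEquiv F (sd A c K) (sd A b K) := by
  by_cases hcb : c = b
  · subst hcb; exact .refl _ _
  rw [← sd_singleton_sd hc hb (hc A hA) (hb A hA) hcb]
  refine .step (hK.sd hAn c) ?_ (by simp) hcF (hb.sd (Ne.symm hcb)) hbF
  rw [mem_sd]
  refine ⟨?_, Or.inl ⟨by simp, by simpa using hA⟩⟩
  intro h
  rw [hAn.subset_singleton_iff] at h
  exact hc A hA (by simp [h])

/-- Whether or not `K` is subdivided at `B` before it is subdivided at `C`, the results are
equivalent relative to any `F` that avoids the simplexes involved. -/
theorem relEquiv_sd_sd [Infinite α] (hK : IsCx K) (hF : F.Finite) (hB : B ∈ K) (hC : C ∈ K)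
    (hCn : C.Nonempty) (hBC : ¬ B ⊆ C) (hb : Fresh b K) (hc : Fresh c K) (hcb : c ≠ b)
    (hBF : B ∉ F) (hbF : Fresh b F) (h1 : insert c (B \ C) ∉ F) (h2 : insert b (C \ B) ∉ F) :
    RelEquiv F (sd C c K) (sd C c (sd B b K)) := by
  have hBn : B.Nonempty := by
    rw [Finset.nonempty_iff_ne_empty]; rintro rfl; simp at hBC
  have hK1 := hK.sd hCn c
  have hK2 := hK.sd hBn b
  have hbB := hb B hB
  have hbC := hb C hC
  have hcB := hc B hB
  have hcC := hc C hC
  by_cases hCB : C ⊆ B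
  · rw [sd_comm_of_subset hCB hcB hbB hcb]
    refine .step hK1 ?_ (by simp) h1 (hb.sd hcb.symm) hbF
    rw [mem_sd]
    refine ⟨?_, Or.inl ⟨by simp, ?_⟩⟩
    · rw [Finset.subset_insert_iff_of_notMem hcC]
      intro h
      obtain ⟨x, hx⟩ := hCn
      exact (Finset.mem_sdiff.1 (h hx)).2 hx
    · rw [Finset.erase_insert (by simp [hcB]), Finset.sdiff_union_of_subset hCB]
      exact hB
  have hBm : B ∈ sd C c K := ⟨hCB, Or.inr ⟨hcB, hB⟩⟩
  have s1 : RelEquiv F (sd C c K) (sd B b (sd C c K)) :=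
    .step hK1 hBm hBn hBF (hb.sd hcb.symm) hbF
  by_cases hd : B ∪ C ∈ K → Disjoint B C
  · rw [sd_comm hK hcB hbC hcC hbB hcb hd]
    exact s1
  push Not at hd
  obtain ⟨hd1, hd2⟩ := hd
  rw [Finset.not_disjoint_iff] at hd2
  obtain ⟨q, hqB, hqC⟩ := hd2
  obtain ⟨e, he1, he2⟩ := exists_fresh (hK.fin.union hF) {b, c}
  rw [fresh_union] at he2
  simp only [Finset.mem_insert, Finset.mem_singleton, not_or] at he1
  have hCm : C ∈ sd B b K := ⟨hBC, Or.inr ⟨hbC, hC⟩⟩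
  have s2 : RelEquiv F (sd B b (sd C c K)) (sd (insert c (B \ C)) e (sd B b (sd C c K))) := by
    refine .step (hK1.sd hBn b) ?_ (by simp) h1 ((he2.1.sd he1.2).sd he1.1) he2.2
    refine ⟨?_, Or.inr ⟨by simp [hcb.symm, hbB], ?_, Or.inl ⟨by simp, ?_⟩⟩⟩
    · intro h
      have := h hqB
      rw [Finset.mem_insert] at this
      rcases this with rfl | h
      · exact hcB hqB
      · exact (Finset.mem_sdiff.1 h).2 hqC
    · rw [Finset.subset_insert_iff_of_notMem hcC]
      intro h
      exact (Finset.mem_sdiff.1 (h hqC)).2 hqC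
    · rw [Finset.erase_insert (by simp [hcB]), Finset.sdiff_union_self_eq_union]
      exact hd1
  have s3 : RelEquiv F (sd C c (sd B b K)) (sd (insert b (C \ B)) e (sd C c (sd B b K))) := by
    refine .step (hK2.sd hCn c) ?_ (by simp) h2 ((he2.1.sd he1.1).sd he1.2) he2.2
    refine ⟨?_, Or.inr ⟨by simp [hcb, hcC], ?_, Or.inl ⟨by simp, ?_⟩⟩⟩
    · intro h
      have := h hqC
      rw [Finset.mem_insert] at this
      rcases this with rfl | h
      · exact hbC hqC
      · exact (Finset.mem_sdiff.1 h).2 hqB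
    · rw [Finset.subset_insert_iff_of_notMem hbB]
      intro h
      exact (Finset.mem_sdiff.1 (h hqB)).2 hqB
    · rw [Finset.erase_insert (by simp [hbC]), Finset.sdiff_union_self_eq_union, Finset.union_comm]
      exact hd1
  -- Otherwise `B` and `C` overlap in a simplex that contains both; `s2` and `s3` are the extra
  -- subdivisions that make the two orders agree.
  have hflip := sd_flip (K := K) (P := C \ B) (Q := B ∩ C) (R := B \ C) (b := b) (c := c) (e := e)
    (by rw [Finset.disjoint_left]; intro x; simp; tauto)
    (by rw [Finset.disjoint_left]; intro x; simp; tauto)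
    (by rw [Finset.disjoint_left]; intro x; simp; tauto)
    (by simp [hbB, hbC]) (by simp [hcB, hcC]) (by simp [he2.1 B hB, he2.1 C hC]) hcb
    (Ne.symm he1.2) (Ne.symm he1.1)
  have e1 : C \ B ∪ B ∩ C = C := by ext x; simp; tauto
  have e2 : B ∩ C ∪ B \ C = B := by ext x; simp; tauto
  rw [e1, e2] at hflip
  rw [← hflip] at s3
  exact (s1.trans s2).trans s3.symm

theorem IsCx.insert (hL : IsCx L) (h : ∀ U, U ⊂ C → U ∈ L) : IsCx (insert C L) := by
  refine ⟨Or.inr hL.empty_mem, ?_, hL.fin.insert C⟩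
  rintro T U (rfl | hT) hU
  · rcases hU.eq_or_ssubset with rfl | hU
    · exact Or.inl rfl
    · exact Or.inr (h U hU)
  · exact Or.inr (hL.down hT hU)

/-- `K₁` results from `K` by removing the simplex `C`: by a subdivision at `C` if `C` is a simplex
of `K`, and by doing nothing otherwise. The new vertex is arbitrary; see `Cleared.unique`. -/
def Cleared (L : Set (Finset α)) (C : Finset α) (K K₁ : Set (Finset α)) : Prop :=
  (C ∉ K ∧ K₁ = K) ∨ (C ∈ K ∧ ∃ c, Fresh c K ∧ Fresh c L ∧ K₁ = sd C c K)

theorem Cleared.unique (hK : IsCx K) (hCn : C.Nonempty) {K₁ K₂ : Set (Finset α)}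
    (h₁ : Cleared L C K K₁) (h₂ : Cleared L C K K₂) : RelEquiv (insert C L) K₁ K₂ := by
  rcases h₁ with ⟨h1, rfl⟩ | ⟨h1, c, hc, hcL, rfl⟩ <;>
    rcases h₂ with ⟨h2, rfl⟩ | ⟨h2, d, hd, hdL, rfl⟩
  · exact .refl _ _
  · exact absurd h2 h1
  · exact absurd h1 h2
  · refine relEquiv_sd_sd_vertex hK h1 hCn hd hc (fresh_insert.2 ⟨hd _ h1, hdL⟩) ?_
    rintro (h | h)
    · exact hc C h1 (by simp [← h])
    · exact hcL _ h (by simp)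

theorem Cleared.exists [Infinite α] (hK : IsCx K) (hL : IsCx L) (V : Finset α) (C : Finset α) :
    (C ∉ K ∧ Cleared L C K K) ∨
      (C ∈ K ∧ ∃ c, c ∉ V ∧ Fresh c K ∧ Fresh c L ∧ Cleared L C K (sd C c K)) := by
  by_cases h : C ∈ K
  · obtain ⟨c, hc, hcK⟩ := exists_fresh (hK.fin.union hL.fin) V
    rw [fresh_union] at hcK
    exact Or.inr ⟨h, c, hc, hcK.1, hcK.2, Or.inr ⟨h, c, hcK.1, hcK.2, rfl⟩⟩
  · exact Or.inl ⟨h, Or.inl ⟨h, rfl⟩⟩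

/-- A move relative to `L` between two complexes induces an equivalence relative to `insert C L`
between the complexes that result from removing `C`. -/
theorem relEquiv_cleared_step [Infinite α] (hL : IsCx L) (hC : C ∉ L) (hpf : ∀ U, U ⊂ C → U ∈ L)
    (hK : IsCx K) (hB : B ∈ K) (hBn : B.Nonempty) (hBL : B ∉ L) (hb : Fresh b K) (hbL : Fresh b L) :
    ∃ K₁ K₂, Cleared L C K K₁ ∧ Cleared L C (sd B b K) K₂ ∧ RelEquiv (insert C L) K₁ K₂ := by
  have hCn : C.Nonempty := hL.nonempty_of_notMem hC
  have hK2 := hK.sd hBn b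
  rcases Cleared.exists hK hL {b} C with ⟨hCK, h1⟩ | ⟨hCK, c, hcb, hcK, hcL, h1⟩
  · have hbC : b ∈ C → C = {b} := by
      intro h
      by_contra h'
      refine hbL _ (hpf {b} ?_) (by simp)
      exact Finset.ssubset_iff_subset_ne.2 ⟨by simpa using h, Ne.symm h'⟩
    rcases Cleared.exists hK2 (hK.union hL) ∅ C with ⟨hCK2, h2⟩ | ⟨hCK2, c, -, hcK2, hcL, h2⟩
    · refine ⟨K, sd B b K, h1, Or.inl ⟨hCK2, rfl⟩, .step hK hB hBn ?_ hb ?_⟩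
      · rintro (rfl | h)
        · exact hCK hB
        · exact hBL h
      · rw [fresh_insert]
        refine ⟨fun h => hCK2 ?_, hbL⟩
        rw [hbC h]
        refine ⟨fun h => ?_, Or.inl ⟨by simp, by simpa using hB⟩⟩
        rw [hBn.subset_singleton_iff] at h
        exact hb B hB (by simp [h])
    · rw [fresh_union] at hcL
      have hbC' : b ∈ C := by
        by_contra h
        exact hCK (hCK2.2.resolve_left (fun h' => h h'.1)).2
      have hCe := hbC hbC'
      have hcC : c ∉ C := hcK2 C hCK2
      have hcb : c ≠ b := fun h => hcC (h ▸ hbC')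
      refine ⟨K, sd C c (sd B b K), h1, Or.inr ⟨hCK2, c, hcK2, hcL.2, rfl⟩, ?_⟩
      rw [hCe, sd_singleton_sd hb hcL.1 (hb B hB) (hcL.1 B hB) hcb.symm, ← hCe]
      refine .step hK hB hBn ?_ hcL.1 (fresh_insert.2 ⟨hcC, hcL.2⟩)
      rintro (rfl | h)
      · exact hCK hB
      · exact hBL h
  · rw [Finset.mem_singleton] at hcb
    by_cases hBC : B = C
    · subst hBC
      exact ⟨sd B b K, sd B b K, Or.inr ⟨hCK, b, hb, hbL, rfl⟩,
        Or.inl ⟨fun h => h.1 subset_rfl, rfl⟩, .refl _ _⟩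
    · have hBC' : ¬ B ⊆ C := fun h => hBL (hpf B (Finset.ssubset_iff_subset_ne.2 ⟨h, hBC⟩))
      have hCm : C ∈ sd B b K := ⟨hBC', Or.inr ⟨hb C hCK, hCK⟩⟩
      refine ⟨sd C c K, sd C c (sd B b K), h1, Or.inr ⟨hCm, c, hcK.sd hcb, hcL, rfl⟩, ?_⟩
      refine relEquiv_sd_sd hK (hL.fin.insert C) hB hCK hCn hBC' hb hcK hcb ?_
        (fresh_insert.2 ⟨hb C hCK, hbL⟩) ?_ ?_
      · rintro (h | h)
        · exact hBC h
        · exact hBL h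
      · rintro (h | h)
        · exact hcK C hCK (by rw [← h]; simp)
        · exact hcL _ h (by simp)
      · rintro (h | h)
        · exact hb C hCK (by rw [← h]; simp)
        · exact hbL _ h (by simp)

/-- A chain of moves relative to `L` between complexes without the simplex `C` can be replaced by
one that avoids `C`: every complex in the chain is replaced by one from which `C` is removed. -/
theorem relEquiv_insert_of_notMem [Infinite α] (hL : IsCx L) (hC : C ∉ L)
    (hpf : ∀ U, U ⊂ C → U ∈ L) (hK : IsCx K) (h : RelEquiv L K K') (hCK : C ∉ K) (hCK' : C ∉ K') :
    RelEquiv (insert C L) K K' := by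
  have hCn : C.Nonempty := hL.nonempty_of_notMem hC
  suffices H : ∀ K₁ K₂, Cleared L C K K₁ → Cleared L C K' K₂ → RelEquiv (insert C L) K₁ K₂ from
    H K K' (Or.inl ⟨hCK, rfl⟩) (Or.inl ⟨hCK', rfl⟩)
  clear hCK hCK'
  induction h with
  | rel K K' h =>
    obtain ⟨hK, B, hB, hBn, hBL, b, hbK, hbL, rfl⟩ := h
    intro K₁ K₂ h1 h2
    obtain ⟨K₁', K₂', h1', h2', h⟩ := relEquiv_cleared_step hL hC hpf hK hB hBn hBL hbK hbL
    exact ((h1.unique hK hCn h1').trans h).trans (h2'.unique (hK.sd hBn b) hCn h2)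
  | refl => exact fun K₁ K₂ h1 h2 => h1.unique hK hCn h2
  | symm K K' h ih =>
    exact fun K₁ K₂ h1 h2 => (ih ((RelEquiv.isCx_iff h).2 hK) K₂ K₁ h2 h1).symm
  | trans K K' K'' h h' ih1 ih2 =>
    intro K₁ K₂ h1 h2
    have hK' := (RelEquiv.isCx_iff h).1 hK
    obtain ⟨K₃, h3⟩ : ∃ K₃, Cleared L C K' K₃ := by
      rcases Cleared.exists hK' hL ∅ C with ⟨-, h3⟩ | ⟨-, c, -, -, -, h3⟩
      · exact ⟨_, h3⟩
      · exact ⟨_, h3⟩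
    exact (ih1 hK K₁ K₃ h1 h3).trans (ih2 hK' K₃ K₂ h3 h2)

/-- An equivalence relative to `L` holds relative to a larger complex `F`, provided that both ends
meet `F` only in `L`. This makes it possible to glue: the chain of moves may be assumed to avoid
the simplexes and vertices of whatever is attached along `L`. -/
theorem RelEquiv.extend [Infinite α] (hF : IsCx F) (hK : IsCx K) (hK' : ∀ T ∈ F, T ∈ K' → T ∈ L)
    (hKL : ∀ T ∈ F, T ∈ K → T ∈ L) (hL : IsCx L) (hLF : L ⊆ F) (h : RelEquiv L K K') :
    RelEquiv F K K' := by
  obtain ⟨n, hn⟩ : ∃ n, (F \ L).ncard = n := ⟨_, rfl⟩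
  induction n generalizing L with
  | zero =>
    rw [Set.ncard_eq_zero (hF.fin.subset Set.sdiff_subset), Set.sdiff_eq_empty] at hn
    rwa [hn.antisymm hLF]
  | succ n ih =>
    have hne : (F \ L).Nonempty := by
      rw [← Set.ncard_pos (hF.fin.subset Set.sdiff_subset)]; omega
    obtain ⟨C, hC, hmin⟩ := Set.exists_min_image (F \ L) Finset.card
      (hF.fin.subset Set.sdiff_subset) hne
    have hpf : ∀ U, U ⊂ C → U ∈ L := by
      intro U hU
      by_contra hUL
      have := hmin U ⟨hF.down hC.1 hU.1, hUL⟩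
      exact absurd (Finset.card_lt_card hU) (by omega)
    have hi : F \ insert C L = (F \ L) \ {C} := by
      ext T; simp only [Set.mem_sdiff, Set.mem_insert_iff, Set.mem_singleton_iff]; tauto
    refine ih (L := insert C L) (fun T hT h => Or.inr (hK' T hT h))
      (fun T hT h => Or.inr (hKL T hT h)) (hL.insert hpf) ?_
      (relEquiv_insert_of_notMem hL hC.2 hpf hK h (fun h => hC.2 (hKL C hC.1 h))
        fun h => hC.2 (hK' C hC.1 h)) ?_
    · exact Set.insert_subset hC.1 hLF
    · rw [hi, Set.ncard_sdiff_singleton_of_mem hC, hn]; rfl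

/-- Relative equivalence is preserved by a subdivision at a common simplex. -/
theorem RelEquiv.sd [Infinite α] (hL : IsCx L) (hK : IsCx K) (hA : A ∈ L) (hAn : A.Nonempty)
    (hAK : A ∈ K) (h : RelEquiv L K K') (haL : Fresh a L) (haK : Fresh a K) (haK' : Fresh a K') :
    RelEquiv (sd A a L) (sd A a K) (sd A a K') := by
  have hpf : ∀ U, U ⊂ {a} → U ∈ L := by
    intro U hU
    rw [Finset.ssubset_singleton_iff] at hU
    rw [hU]; exact hL.empty_mem
  have haK1 : {a} ∉ K := (fresh_iff hK).1 haK
  replace h : RelEquiv (insert {a} L) K K' := relEquiv_insert_of_notMem hL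
    ((fresh_iff hL).1 haL) hpf hK h haK1 ((fresh_iff (h.isCx_iff.1 hK)).1 haK')
  have hLa : IsCx (insert {a} L) := hL.insert hpf
  clear haK haK'
  induction h with
  | rel K K' h =>
    obtain ⟨hK, B, hB, hBn, hBL, b, hbK, hbL, rfl⟩ := h
    have haK : Fresh a K := (fresh_iff hK).2 haK1
    rw [fresh_insert, Finset.mem_singleton] at hbL
    have hBL' : B ∉ L := fun h => hBL (Or.inr h)
    refine relEquiv_sd_sd hK (hL.sd hAn a).fin hB hAK hAn (fun h => hBL' (hL.down hA h)) hbK haK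
      (Ne.symm hbL.1) ?_ (hbL.2.sd hbL.1) ?_ ?_
    · rintro ⟨-, ⟨h1, -⟩ | ⟨-, h1⟩⟩
      · exact haK B hB h1
      · exact hBL' h1
    · rintro ⟨-, ⟨-, h1⟩ | ⟨h1, -⟩⟩
      · refine hBL' (hL.down h1 ?_)
        rw [Finset.erase_insert (by simp [haK B hB])]
        intro x hx
        by_cases h : x ∈ A <;> simp [hx, h]
      · simp at h1
    · rintro ⟨-, ⟨h1, -⟩ | ⟨-, h1⟩⟩
      · rw [Finset.mem_insert, Finset.mem_sdiff] at h1
        rcases h1 with h1 | h1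
        · exact hbL.1 h1.symm
        · exact haK A hAK h1.1
      · exact hbL.2 _ h1 (by simp)
  | refl => exact .refl _ _
  | symm K K' h ih =>
    have hm := fun T => RelEquiv.mem_iff (T := T) hLa.down h
    exact (ih ((RelEquiv.isCx_iff h).2 hK) ((hm A (Or.inr hA)).2 hAK)
      (fun h => haK1 ((hm {a} (Or.inl rfl)).1 h))).symm
  | trans K K' K'' h h' ih1 ih2 =>
    have hm := fun T => RelEquiv.mem_iff (T := T) hLa.down h
    exact (ih1 hK hAK haK1).trans (ih2 ((RelEquiv.isCx_iff h).1 hK) ((hm A (Or.inr hA)).1 hAK)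
      (fun h => haK1 ((hm {a} (Or.inl rfl)).2 h)))

end

/-! ### Links, joins and the parity boundary -/

section

variable {α : Type*} [DecidableEq α]
variable {F G K K' L Q Q' : Set (Finset α)} {A B C T X s t : Finset α} {a b c v x : α} {d e : ℕ}

/-- All faces of the simplex `s`. -/
def fullSimplex (s : Finset α) : Set (Finset α) := {T | T ⊆ s}
/-- All proper faces of the simplex `s`. -/
def properFaces (s : Finset α) : Set (Finset α) := {T | T ⊂ s}
/-- The link of the simplex `X` in `K`. -/
def lk (X : Finset α) (K : Set (Finset α)) : Set (Finset α) := {T | Disjoint X T ∧ X ∪ T ∈ K}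
/-- The join of the full simplex `A` with `K`, for `A` disjoint from the vertices of `K`. -/
def simplexJoin (A : Finset α) (K : Set (Finset α)) : Set (Finset α) := {T | T \ A ∈ K}
/-- The join of the boundary of the simplex `A` with `K`, for `A` disjoint from the vertices of
`K`. -/
def bdJoin (A : Finset α) (K : Set (Finset α)) : Set (Finset α) := {T | ¬ A ⊆ T ∧ T \ A ∈ K}

/-- The parity of the number of simplexes of `K` that contain `X`. Modulo 2 this is the reduced
Euler characteristic of the link of `X`. -/
noncomputable def deg (X : Finset α) (K : Set (Finset α)) : ZMod 2 := ({B ∈ K | X ⊆ B}.ncard : ℕ)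

/-- The parity boundary of `K`: the simplexes whose link has an even number of simplexes (the empty
one included), as a ball has, in contrast to a sphere. -/
def bd (K : Set (Finset α)) : Set (Finset α) := {T ∈ K | deg T K = 0}

theorem mem_fullSimplex : T ∈ fullSimplex s ↔ T ⊆ s := Iff.rfl
theorem mem_properFaces : T ∈ properFaces s ↔ T ⊂ s := Iff.rfl
theorem mem_lk : T ∈ lk X K ↔ Disjoint X T ∧ X ∪ T ∈ K := Iff.rfl
theorem mem_simplexJoin : T ∈ simplexJoin A K ↔ T \ A ∈ K := Iff.rfl
theorem mem_bdJoin : T ∈ bdJoin A K ↔ ¬ A ⊆ T ∧ T \ A ∈ K := Iff.rfl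
theorem mem_bd : T ∈ bd K ↔ T ∈ K ∧ deg T K = 0 := Iff.rfl

theorem isCx_fullSimplex (s : Finset α) : IsCx (fullSimplex s) :=
  ⟨by simp [mem_fullSimplex], fun _ _ h hU => hU.trans h,
    (s.powerset.finite_toSet).subset fun T hT => by simpa using mem_fullSimplex.1 hT⟩

theorem isCx_properFaces (hs : s.Nonempty) : IsCx (properFaces s) :=
  ⟨by simpa [mem_properFaces] using hs, fun _ _ h hU => lt_of_le_of_lt hU h,
    (isCx_fullSimplex s).fin.subset fun _ hT => hT.1⟩

theorem IsCx.lk (hK : IsCx K) (hX : X ∈ K) : IsCx (lk X K) := by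
  refine ⟨by simpa [mem_lk] using hX, fun T U h hU => ⟨h.1.mono_right hU, hK.down h.2 (by gcongr)⟩,
    hK.fin.subset fun T hT => hK.down hT.2 Finset.subset_union_right⟩

theorem lk_subset (hK : IsCx K) : Stellar.lk X K ⊆ K :=
  fun _ hT => hK.down hT.2 Finset.subset_union_right

theorem IsCx.simplexJoin (hK : IsCx K) (A : Finset α) : IsCx (simplexJoin A K) := by
  refine ⟨by simpa [mem_simplexJoin] using hK.empty_mem,
    fun T U h hU => hK.down h (Finset.sdiff_subset_sdiff hU subset_rfl), ?_⟩
  refine ((isCx_fullSimplex A).fin.image2 (· ∪ ·) hK.fin).subset fun T hT => ?_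
  refine ⟨T ∩ A, Finset.inter_subset_right, T \ A, hT, ?_⟩
  ext x; simp; tauto

theorem IsCx.bdJoin (hK : IsCx K) (hA : A.Nonempty) : IsCx (bdJoin A K) := by
  refine ⟨⟨?_, by simpa using hK.empty_mem⟩, fun T U h hU => ⟨fun h' => h.1 (h'.trans hU),
    hK.down h.2 (Finset.sdiff_subset_sdiff hU subset_rfl)⟩,
    (hK.simplexJoin A).fin.subset fun T hT => hT.2⟩
  simpa [Finset.subset_empty] using hA.ne_empty

/-- A finite family invariant under adding and removing the point `x` has an even number of
members. -/
theorem deg_eq_zero_aux {U : Set (Finset α)} (hU : U.Finite) (x : α)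
    (h : ∀ S, x ∉ S → (S ∈ U ↔ insert x S ∈ U)) : (U.ncard : ZMod 2) = 0 := by
  have h1 : {S ∈ U | x ∉ S}.ncard = {S ∈ U | x ∈ S}.ncard := by
    refine Set.ncard_congr (fun S _ => insert x S) ?_ ?_ ?_
    · exact fun S hS => ⟨(h S hS.2).1 hS.1, by simp⟩
    · rintro S T ⟨-, hS⟩ ⟨-, hT⟩ hST
      rw [← Finset.erase_insert hS, hST, Finset.erase_insert hT]
    · rintro S ⟨hS, hx⟩
      refine ⟨S.erase x, ⟨?_, by simp⟩, Finset.insert_erase hx⟩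
      rw [h _ (by simp), Finset.insert_erase hx]; exact hS
  have h2 : U = {S ∈ U | x ∉ S} ∪ {S ∈ U | x ∈ S} := by
    ext S; simp only [Set.mem_union, Set.mem_ofPred_eq]; tauto
  rw [h2, Set.ncard_union_eq (by rw [Set.disjoint_left]; exact fun S h h' => h.2 h'.2)
    (hU.subset fun S h => h.1) (hU.subset fun S h => h.1), h1, Nat.cast_add]
  exact CharTwo.add_self_eq_zero _

theorem ncard_split {U : Set (Finset α)} (hU : U.Finite) (p : Finset α → Prop) :
    (U.ncard : ZMod 2) = ({S ∈ U | ¬ p S}.ncard : ℕ) + ({S ∈ U | p S}.ncard : ℕ) := by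
  have h2 : U = {S ∈ U | ¬ p S} ∪ {S ∈ U | p S} := by
    ext S; simp only [Set.mem_union, Set.mem_ofPred_eq]; tauto
  conv_lhs => rw [h2]
  rw [Set.ncard_union_eq (by rw [Set.disjoint_left]; exact fun S h h' => h.2 h'.2)
    (hU.subset fun S h => h.1) (hU.subset fun S h => h.1), Nat.cast_add]

/-- Adding or removing a vertex of `A` outside `X` is an involution on the sets `S ⊇ X` with
`S ∪ A ∈ K`, so their number is even. -/
theorem deg_sd_aux (hK : IsCx K) (hX : ¬ A ⊆ X) :
    (({S | X ⊆ S ∧ ¬ A ⊆ S ∧ S ∪ A ∈ K}.ncard : ℕ) : ZMod 2) = deg (X ∪ A) K := by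
  obtain ⟨x, hxA, hxX⟩ := Finset.not_subset.1 hX
  have hfin : {S | X ⊆ S ∧ S ∪ A ∈ K}.Finite :=
    hK.fin.subset fun S hS => hK.down hS.2 Finset.subset_union_left
  have h0 : (({S | X ⊆ S ∧ S ∪ A ∈ K}.ncard : ℕ) : ZMod 2) = 0 := by
    refine deg_eq_zero_aux hfin x fun S hS => ?_
    rw [Set.mem_ofPred_eq, Set.mem_ofPred_eq, Finset.subset_insert_iff_of_notMem hxX,
      Finset.insert_union, Finset.insert_eq_of_mem (Finset.mem_union_right _ hxA)]
  rw [ncard_split hfin (fun S => A ⊆ S)] at h0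
  have h1 : {S | S ∈ {S | X ⊆ S ∧ S ∪ A ∈ K} ∧ ¬ A ⊆ S} = {S | X ⊆ S ∧ ¬ A ⊆ S ∧ S ∪ A ∈ K} := by
    ext S; simp only [Set.mem_ofPred_eq]; tauto
  have h2 : {S | S ∈ {S | X ⊆ S ∧ S ∪ A ∈ K} ∧ A ⊆ S} = {B ∈ K | X ∪ A ⊆ B} := by
    ext S
    simp only [Set.mem_ofPred_eq, Finset.union_subset_iff]
    constructor
    · rintro ⟨⟨h1, h2⟩, h3⟩
      rw [Finset.union_eq_left.2 h3] at h2
      exact ⟨h2, h1, h3⟩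
    · rintro ⟨h1, h2, h3⟩
      refine ⟨⟨h2, ?_⟩, h3⟩
      rwa [Finset.union_eq_left.2 h3]
  rw [h1, h2] at h0
  rw [deg]
  exact CharTwo.add_eq_zero.1 h0

/-- Modulo 2, as many simplexes of the subdivision contain `insert a X` as simplexes of `K` contain
`X ∪ A`. -/
theorem deg_insert_sd (hK : IsCx K) (hA : A ∈ K) (ha : Fresh a K) (haX : a ∉ X) (hX : ¬ A ⊆ X) :
    deg (insert a X) (sd A a K) = deg (X ∪ A) K := by
  rw [← deg_sd_aux hK hX, deg]
  congr 1
  symm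
  have haA := ha A hA
  refine Set.ncard_congr (fun S _ => insert a S) ?_ ?_ ?_
  · rintro S ⟨h1, h2, h3⟩
    have haS : a ∉ S := fun h => ha _ h3 (Finset.mem_union_left _ h)
    refine ⟨⟨?_, Or.inl ⟨by simp, ?_⟩⟩, Finset.insert_subset_insert _ h1⟩
    · rwa [Finset.subset_insert_iff_of_notMem haA]
    · rwa [Finset.erase_insert haS]
  · rintro S T ⟨-, -, hS⟩ ⟨-, -, hT⟩ hST
    have haS : a ∉ S := fun h => ha _ hS (Finset.mem_union_left _ h)
    have haT : a ∉ T := fun h => ha _ hT (Finset.mem_union_left _ h)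
    rw [← Finset.erase_insert haS, hST, Finset.erase_insert haT]
  · rintro S ⟨⟨h1, h2⟩, h3⟩
    have haS : a ∈ S := h3 (by simp)
    refine ⟨S.erase a, ⟨?_, ?_, (h2.resolve_right fun h => h.1 haS).2⟩, Finset.insert_erase haS⟩
    · rw [Finset.subset_erase]
      exact ⟨(Finset.subset_insert _ _).trans h3, haX⟩
    · exact fun h => h1 (h.trans (Finset.erase_subset _ _))

theorem deg_sd (hK : IsCx K) (hAn : A.Nonempty) (hA : A ∈ K) (ha : Fresh a K) (haX : a ∉ X)
    (hX : ¬ A ⊆ X) : deg X (sd A a K) = deg X K := by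
  have h1 : ({B ∈ K | X ⊆ B}).Finite := hK.fin.subset fun S h => h.1
  have h2 : ({B ∈ sd A a K | X ⊆ B}).Finite := (hK.sd hAn a).fin.subset fun S h => h.1
  rw [deg, deg, ncard_split h1 (fun S => A ⊆ S), ncard_split h2 (fun S => a ∈ S)]
  congr 1
  · congr 2
    ext S
    simp only [Set.mem_ofPred_eq, mem_sd]
    have : S ∈ K → a ∉ S := fun h => ha S h
    tauto
  · have e1 : {S | S ∈ {B | B ∈ sd A a K ∧ X ⊆ B} ∧ a ∈ S} = {B ∈ sd A a K | insert a X ⊆ B} := by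
      ext S
      simp only [Set.mem_ofPred_eq, Finset.insert_subset_iff]
      tauto
    have e2 : {S | S ∈ {B | B ∈ K ∧ X ⊆ B} ∧ A ⊆ S} = {B ∈ K | X ∪ A ⊆ B} := by
      ext S
      simp only [Set.mem_ofPred_eq, Finset.union_subset_iff]
      tauto
    rw [e1, e2]
    exact deg_insert_sd hK hA ha haX hX

/-- The boundary of a subdivision is the subdivision of the boundary. If `A` is not in the
boundary, the right side is just `bd K` (`sd_of_notMem`). -/
theorem bd_sd (hK : IsCx K) (hAn : A.Nonempty) (hA : A ∈ K) (ha : Fresh a K) :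
    bd (sd A a K) = sd A a (bd K) := by
  refine ext_insert a (fun S hS => ?_) fun S hS => ?_
  · simp only [mem_bd, mem_sd, hS, false_and, not_false_eq_true, true_and, false_or]
    by_cases h : A ⊆ S
    · simp [h]
    · simp only [h, not_false_eq_true, true_and, deg_sd hK hAn hA ha hS h]
  · simp only [mem_bd, mem_sd, hS, Finset.mem_insert_self, Finset.erase_insert, true_and,
      Finset.subset_insert_iff_of_notMem (ha A hA), not_true, false_and, or_false,
      not_false_eq_true]
    by_cases h : A ⊆ S
    · simp [h]
    · simp only [h, not_false_eq_true, true_and, deg_insert_sd hK hA ha hS h]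

theorem deg_lk (hd : Disjoint X T) : deg T (lk X K) = deg (X ∪ T) K := by
  rw [deg, deg]
  congr 1
  refine Set.ncard_congr (fun S _ => X ∪ S) ?_ ?_ ?_
  · rintro S ⟨h1, h2⟩
    exact ⟨h1.2, Finset.union_subset_union_right h2⟩
  · rintro S S' ⟨⟨h1, -⟩, -⟩ ⟨⟨h2, -⟩, -⟩ h
    rw [← Finset.union_sdiff_cancel_left h1, h, Finset.union_sdiff_cancel_left h2]
  · rintro S ⟨h1, h2⟩
    have h3 : X ⊆ S := Finset.subset_union_left.trans h2
    refine ⟨S \ X, ⟨⟨Finset.disjoint_sdiff, ?_⟩, ?_⟩, Finset.union_sdiff_of_subset h3⟩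
    · rwa [Finset.union_sdiff_of_subset h3]
    · rw [Finset.subset_sdiff]
      exact ⟨Finset.subset_union_right.trans h2, hd.symm⟩

theorem bd_lk : bd (lk X K) = lk X (bd K) := by
  ext T
  simp only [mem_bd, mem_lk]
  constructor
  · rintro ⟨⟨h1, h2⟩, h3⟩
    exact ⟨h1, h2, by rwa [← deg_lk h1]⟩
  · rintro ⟨h1, h2, h3⟩
    exact ⟨⟨h1, h2⟩, by rwa [deg_lk h1]⟩

/-- Inclusion and exclusion for the parities. -/
theorem deg_union (hK : K.Finite) (hL : L.Finite) (X : Finset α) :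
    deg X (K ∪ L) + deg X (K ∩ L) = deg X K + deg X L := by
  have h1 : ({B ∈ K | X ⊆ B}).Finite := hK.subset fun S h => h.1
  have h2 : ({B ∈ L | X ⊆ B}).Finite := hL.subset fun S h => h.1
  have e1 : {B ∈ K ∪ L | X ⊆ B} = {B ∈ K | X ⊆ B} ∪ {B ∈ L | X ⊆ B} := by
    ext S; simp only [Set.mem_ofPred_eq, Set.mem_union]; tauto
  have e2 : {B ∈ K ∩ L | X ⊆ B} = {B ∈ K | X ⊆ B} ∩ {B ∈ L | X ⊆ B} := by
    ext S; simp only [Set.mem_ofPred_eq, Set.mem_inter_iff]; tauto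
  rw [deg, deg, deg, deg, e1, e2, ← Nat.cast_add, ← Nat.cast_add,
    Set.ncard_union_add_ncard_inter _ _ h1 h2]

theorem deg_eq_zero_of_notMem (hK : ∀ ⦃T U : Finset α⦄, T ∈ K → U ⊆ T → U ∈ K) (hX : X ∉ K) :
    deg X K = 0 := by
  have : {B ∈ K | X ⊆ B} = ∅ := by
    ext S
    simp only [Set.mem_ofPred_eq, Set.mem_empty_iff_false, iff_false, not_and]
    exact fun h h' => hX (hK h h')
  rw [deg, this, Set.ncard_empty, Nat.cast_zero]

theorem bd_fullSimplex (s : Finset α) : bd (fullSimplex s) = properFaces s := by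
  ext T
  rw [mem_bd, mem_fullSimplex, mem_properFaces, Finset.ssubset_iff_subset_ne]
  refine and_congr_right fun hT => ?_
  constructor
  · rintro h rfl
    have : {B ∈ fullSimplex T | T ⊆ B} = {T} := by
      ext S; simp only [Set.mem_ofPred_eq, mem_fullSimplex, Set.mem_singleton_iff]
      exact ⟨fun h => h.1.antisymm h.2, by rintro rfl; simp⟩
    rw [deg, this, Set.ncard_singleton] at h
    exact absurd h (by decide)
  · intro h
    obtain ⟨x, hx, hxT⟩ := Finset.exists_of_ssubset (Finset.ssubset_iff_subset_ne.2 ⟨hT, h⟩)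
    refine deg_eq_zero_aux ((isCx_fullSimplex s).fin.subset fun S h => h.1) x fun S hS => ?_
    simp [mem_fullSimplex, Finset.insert_subset_iff, hx, Finset.subset_insert_iff_of_notMem hxT]

theorem bd_properFaces (s : Finset α) : bd (properFaces s) = ∅ := by
  ext T
  simp only [Set.mem_empty_iff_false, iff_false]
  rintro ⟨h1, h2⟩
  have h3 : T ∈ bd (fullSimplex s) := by rw [bd_fullSimplex]; exact h1
  have h4 : {B ∈ fullSimplex s | T ⊆ B} = insert s {B ∈ properFaces s | T ⊆ B} := by
    ext S
    simp only [Set.mem_ofPred_eq, mem_fullSimplex, Set.mem_insert_iff, mem_properFaces,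
      Finset.ssubset_iff_subset_ne]
    constructor
    · rintro ⟨h, h'⟩
      by_cases hS : S = s
      · exact Or.inl hS
      · exact Or.inr ⟨⟨h, hS⟩, h'⟩
    · rintro (rfl | h)
      · exact ⟨subset_rfl, h1.1⟩
      · exact ⟨h.1.1, h.2⟩
  have h5 := h3.2
  rw [deg, h4, Set.ncard_insert_of_notMem (fun h => (mem_properFaces.1 h.1).ne rfl)
    ((isCx_fullSimplex s).fin.subset fun S h => h.1.1), Nat.cast_add, Nat.cast_one] at h5
  rw [deg] at h2
  rw [h2] at h5
  exact absurd h5 (by decide)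

theorem sd_of_notMem (hL : ∀ ⦃T U : Finset α⦄, T ∈ L → U ⊆ T → U ∈ L) (hA : A ∉ L)
    (ha : Fresh a L) : sd A a L = L := by
  have := sd_union (K := ∅) hL hA ha
  have e : sd A a (∅ : Set (Finset α)) = ∅ := by ext; simp [mem_sd]
  simpa [e] using this

theorem bd_subset : bd K ⊆ K := fun _ h => h.1

theorem insert_erase_mem_sd (hA : A ∈ K) (ha : Fresh a K) (hL : L ⊆ K) (hT : T ∈ L) (hAT : A ⊆ T)
    (hx : x ∈ A) : insert a (T.erase x) ∈ sd A a L := by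
  refine ⟨?_, Or.inl ⟨by simp, ?_⟩⟩
  · rw [Finset.subset_insert_iff_of_notMem (ha A hA)]
    exact fun h => absurd (h hx) (by simp)
  · rw [Finset.erase_insert (by simp [ha T (hL hT)])]
    have : T.erase x ∪ A = T := by
      apply subset_antisymm (Finset.union_subset (Finset.erase_subset _ _) hAT)
      intro y hy
      by_cases h : y = x
      · subst h; simp [hx]
      · simp [h, hy]
    rwa [this]

theorem isCx_bd_sd_iff (hK : IsCx K) (hAn : A.Nonempty) (hA : A ∈ K) (ha : Fresh a K) :
    IsCx (bd K) ↔ IsCx (bd (sd A a K)) := by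
  rw [bd_sd hK hAn hA ha]
  refine ⟨fun h => h.sd hAn a, fun h => ?_⟩
  have hfin := hK.fin.subset (bd_subset (K := K))
  have key : ∀ T ∈ bd K, ¬ A ⊆ T → T ∈ sd A a (bd K) := fun T hT hAT =>
    ⟨hAT, Or.inr ⟨ha T hT.1, hT⟩⟩
  have key2 : ∀ T ∈ bd K, A ⊆ T → ∀ x ∈ A, insert a (T.erase x) ∈ sd A a (bd K) :=
    fun T hT hAT x hx => insert_erase_mem_sd hA ha bd_subset hT hAT hx
  have out : ∀ U ∈ sd A a (bd K), a ∉ U → U ∈ bd K := fun U hU haU =>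
    (hU.2.resolve_left fun h => haU h.1).2
  refine ⟨out _ h.empty_mem (by simp), fun T U hT hU => ?_, hfin⟩
  have haU : a ∉ U := fun h => ha T hT.1 (hU h)
  by_cases hAT : A ⊆ T
  · by_cases hAU : A ⊆ U
    · obtain ⟨x, hx⟩ := hAn
      have h1 := h.down (key2 T hT hAT x hx)
        (Finset.insert_subset_insert a (Finset.erase_subset_erase x hU))
      have h2 := (h1.2.resolve_right fun h => h.1 (by simp)).2
      rw [Finset.erase_insert (by simp [haU])] at h2
      have : U.erase x ∪ A = U := by
        apply subset_antisymm (Finset.union_subset (Finset.erase_subset _ _) hAU)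
        intro y hy
        by_cases h : y = x
        · subst h; simp [hx]
        · simp [h, hy]
      rwa [this] at h2
    · obtain ⟨x, hx, hxU⟩ := Finset.not_subset.1 hAU
      refine out _ (h.down (key2 T hT hAT x hx) ?_) haU
      exact (Finset.subset_erase.2 ⟨hU, hxU⟩).trans (Finset.subset_insert _ _)
  · exact out _ (h.down (key T hT hAT) hU) haU

theorem bd_sd_eq_empty_iff (hK : IsCx K) (hAn : A.Nonempty) (hA : A ∈ K) (ha : Fresh a K) :
    bd K = ∅ ↔ bd (sd A a K) = ∅ := by
  rw [bd_sd hK hAn hA ha]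
  constructor
  · intro h; rw [h]; ext; simp [mem_sd]
  · intro h
    by_contra h'
    obtain ⟨T, hT⟩ := Set.nonempty_iff_ne_empty.2 h'
    have haT := ha T hT.1
    by_cases hAT : A ⊆ T
    · obtain ⟨x, hx⟩ := hAn
      have := insert_erase_mem_sd hA ha bd_subset hT hAT hx
      rw [h] at this
      exact this
    · have : T ∈ sd A a (bd K) := ⟨hAT, Or.inr ⟨haT, hT⟩⟩
      rw [h] at this
      exact this

theorem RelEquiv.isCx_bd_iff (h : RelEquiv F K K') : IsCx (bd K) ↔ IsCx (bd K') :=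
  h.invariant (P := fun K => IsCx (Stellar.bd K)) fun _ _ _ hK hA hAn _ ha _ =>
    isCx_bd_sd_iff hK hAn hA ha

theorem RelEquiv.bd_eq_empty_iff (h : RelEquiv F K K') : bd K = ∅ ↔ bd K' = ∅ :=
  h.invariant (P := fun K => Stellar.bd K = ∅) fun _ _ _ hK hA hAn _ ha _ =>
    bd_sd_eq_empty_iff hK hAn hA ha

theorem RelEquiv.mem_bd_iff (hF : ∀ ⦃T U : Finset α⦄, T ∈ F → U ⊆ T → U ∈ F)
    (h : RelEquiv F K K') (hT : T ∈ F) : T ∈ bd K ↔ T ∈ bd K' := by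
  refine h.invariant (P := fun K => T ∈ bd K) fun K A a hK hA hAn hAF haK haF => ?_
  have h1 : a ∉ T := haF T hT
  have h2 : ¬ A ⊆ T := fun h => hAF (hF hT h)
  simp [bd_sd hK hAn hA haK, mem_sd, h1, h2]

/-- Equivalent complexes have equivalent boundaries. -/
theorem RelEquiv.bd (h : RelEquiv F K K') (hb : IsCx (bd K)) :
    RelEquiv ∅ (Stellar.bd K) (Stellar.bd K') := by
  have hb' := h.isCx_bd_iff.1 hb
  induction h with
  | rel K K' h =>
    obtain ⟨hK, A, hA, hAn, hAF, a, haK, haF, rfl⟩ := h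
    rw [bd_sd hK hAn hA haK]
    have hab : Fresh a (Stellar.bd K) := haK.mono bd_subset
    by_cases h : A ∈ Stellar.bd K
    · exact .step hb h hAn (by simp) hab (fun _ h => absurd h (by simp))
    · rw [sd_of_notMem hb.down h hab]; exact .refl _ _
  | refl => exact .refl _ _
  | symm _ _ _ ih => exact (ih hb' hb).symm
  | trans K K1 K2 h1 h2 ih1 ih2 =>
    have := (RelEquiv.isCx_bd_iff h1).1 hb
    exact (ih1 hb this).trans (ih2 this hb')

/-- Moves off a complex `L` do not change whether the boundary is equal to `L`. -/
theorem RelEquiv.bd_eq (hL : IsCx L)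
    (hLF : L ⊆ F) (h : RelEquiv F K K') : Stellar.bd K = L ↔ Stellar.bd K' = L := by
  refine h.invariant (P := fun K => Stellar.bd K = L) fun K A a hK hA hAn hAF haK haF => ?_
  rw [bd_sd hK hAn hA haK]
  have haL : Fresh a L := haF.mono hLF
  constructor
  · rintro rfl
    exact sd_of_notMem hL.down (fun h => hAF (hLF h)) haL
  · intro h
    ext T
    constructor
    · intro hT
      by_cases hAT : A ⊆ T
      · exfalso
        obtain ⟨x, hx⟩ := hAn
        have := insert_erase_mem_sd hA haK bd_subset hT hAT hx
        rw [h] at this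
        exact haL _ this (by simp)
      · rw [← h]
        exact ⟨hAT, Or.inr ⟨haK T hT.1, hT⟩⟩
    · intro hT
      have haT := haL T hT
      rw [← h] at hT
      exact (hT.2.resolve_left fun h => haT h.1).2

end

/-! ### Subdivision of links and joins -/

section

variable {α : Type*} [DecidableEq α]
variable {F G K K' L Q Q' : Set (Finset α)} {A B C T X Y s t : Finset α} {a b c v x : α} {d e : ℕ}

/-- The link in a subdivision of an old simplex `X` is subdivided at `A \ X`, provided that this is
a simplex of the link. -/
theorem lk_sd (haX : a ∉ X) : lk X (sd A a K) = sd (A \ X) a (lk X K) := by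
  refine ext_insert a (fun S hS => ?_) fun S hS => ?_
  · have h1 : A ⊆ X ∪ S ↔ A \ X ⊆ S := sdiff_le_iff.symm
    simp only [mem_lk, mem_sd, Finset.mem_union, haX, hS, or_false, false_and, not_false_eq_true,
      true_and, false_or, h1]
    tauto
  · have h1 : A ⊆ X ∪ insert a S ↔ A \ X ⊆ insert a S := sdiff_le_iff.symm
    have h2 : (X ∪ insert a S).erase a ∪ A = X ∪ (S ∪ A \ X) := by
      rw [Finset.union_insert, Finset.erase_insert (by simp [haX, hS])]
      ext x; simp; tauto
    have h3 : Disjoint X (A \ X) := Finset.disjoint_sdiff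
    simp only [mem_lk, mem_sd, h1, h2, Finset.mem_union, Finset.mem_insert, haX, true_or, or_true,
      Finset.erase_insert hS, Finset.disjoint_insert_right, not_false_eq_true, true_and, not_true,
      false_and, or_false, Finset.disjoint_union_right, h3, and_true]
    tauto

/-- The link of the new vertex. -/
theorem lk_singleton_sd (hA : A ∈ K) (ha : Fresh a K) :
    lk {a} (sd A a K) = bdJoin A (lk A K) := by
  have haA := ha A hA
  refine ext_insert a (fun S hS => ?_) fun S hS => ?_
  · have h1 : A ∪ S \ A = S ∪ A := by ext x; simp; tauto
    have h2 : ({a} ∪ S : Finset α) = insert a S := rfl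
    simp only [mem_lk, mem_sd, mem_bdJoin, h1, h2, Finset.disjoint_singleton_left, hS,
      Finset.erase_insert hS, Finset.mem_insert_self, not_false_eq_true, true_and, not_true,
      false_and, or_false, Finset.disjoint_sdiff, Finset.subset_insert_iff_of_notMem haA]
  · simp only [mem_lk, mem_bdJoin, Finset.disjoint_singleton_left, Finset.mem_insert_self,
      not_true, false_and, false_iff, not_and]
    exact fun _ _ h => ha _ h (by simp [haA])

theorem lk_lk (hXY : Disjoint X Y) : lk Y (lk X K) = lk (X ∪ Y) K := by
  ext T
  simp only [mem_lk, Finset.disjoint_union_left, Finset.disjoint_union_right, hXY, true_and,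
    Finset.union_assoc]
  tauto

theorem lk_empty : lk ∅ K = K := by ext T; simp [mem_lk]

theorem Fresh.lk (ha : Fresh a K) : Fresh a (lk X K) := fun _ hT haT =>
  ha _ hT.2 (Finset.mem_union_right _ haT)

/-- The link of a simplex that survives the subdivision changes by at most one move. -/
theorem relEquiv_lk_sd (hK : IsCx K) (hX : X ∈ K) (hAX : ¬ A ⊆ X) (ha : Fresh a K) :
    RelEquiv ∅ (lk X K) (lk X (sd A a K)) := by
  rw [lk_sd (ha X hX)]
  by_cases h : A \ X ∈ lk X K
  · refine .step (hK.lk hX) h ?_ (by simp) ha.lk (fun _ h => absurd h (by simp))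
    rwa [Finset.sdiff_nonempty]
  · rw [sd_of_notMem (hK.lk hX).down h ha.lk]
    exact .refl _ _

theorem sd_simplexJoin (hAB : Disjoint A B) (hb : b ∉ A) :
    sd B b (simplexJoin A Q) = simplexJoin A (sd B b Q) := by
  have h1 : ∀ T : Finset α, B ⊆ T \ A ↔ B ⊆ T := fun T => by
    rw [Finset.subset_sdiff]; exact and_iff_left hAB.symm
  ext T
  have h2 : (T \ A).erase b ∪ B = (T.erase b ∪ B) \ A := by
    rw [Finset.union_sdiff_distrib, Finset.sdiff_eq_self_of_disjoint hAB.symm,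
      Finset.erase_sdiff_comm]
  simp only [mem_sd, mem_simplexJoin, h1, h2, Finset.mem_sdiff, hb, not_false_eq_true, and_true]

theorem sd_bdJoin (hAB : Disjoint A B) (hb : b ∉ A) :
    sd B b (bdJoin A Q) = bdJoin A (sd B b Q) := by
  have h1 : ∀ T : Finset α, B ⊆ T \ A ↔ B ⊆ T := fun T => by
    rw [Finset.subset_sdiff]; exact and_iff_left hAB.symm
  ext T
  have h2 : (T \ A).erase b ∪ B = (T.erase b ∪ B) \ A := by
    rw [Finset.union_sdiff_distrib, Finset.sdiff_eq_self_of_disjoint hAB.symm,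
      Finset.erase_sdiff_comm]
  have h3 : A ⊆ T.erase b ∪ B ↔ A ⊆ T := by
    constructor
    · intro h
      exact (hAB.left_le_of_le_sup_right h).trans (Finset.erase_subset _ _)
    · intro h
      exact (Finset.subset_erase.2 ⟨h, hb⟩).trans Finset.subset_union_left
  simp only [mem_sd, mem_bdJoin, h1, h2, h3, Finset.mem_sdiff, hb, not_false_eq_true, and_true]
  tauto

theorem Fresh.simplexJoin (ha : Fresh a K) (haA : a ∉ A) : Fresh a (simplexJoin A K) :=
  fun T hT haT => ha _ hT (by simp [haT, haA])

/-- No vertex of the simplex `A` is a vertex of `K`. -/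
def Away (A : Finset α) (K : Set (Finset α)) : Prop := ∀ x ∈ A, Fresh x K

theorem Away.disjoint (h : Away A K) (hT : T ∈ K) : Disjoint A T :=
  Finset.disjoint_left.2 fun x hx => h x hx T hT

theorem Away.mono (h : Away A K) (hL : L ⊆ K) : Away A L := fun x hx => (h x hx).mono hL

theorem RelEquiv.away (hF : IsCx F) (hAF : A ∈ F) (hK : IsCx K) (h : RelEquiv F K K')
    (hA : Away A K) : Away A K' := fun x hx => by
  have := hA x hx
  rw [fresh_iff hK, h.mem_iff hF.down (hF.down hAF (by simpa using hx))] at this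
  rwa [fresh_iff (h.isCx_iff.1 hK)]

theorem RelEquiv.simplexJoin (hF : IsCx F) (hAF : A ∈ F) (hK : IsCx Q) (h : RelEquiv F Q Q')
    (hA : Away A Q) : RelEquiv F (simplexJoin A Q) (simplexJoin A Q') := by
  induction h with
  | rel K K' h =>
    obtain ⟨hK, B, hB, hBn, hBF, b, hbK, hbF, rfl⟩ := h
    have hAB : Disjoint A B := hA.disjoint hB
    have hbA := hbF A hAF
    rw [← sd_simplexJoin hAB hbA]
    refine .step (hK.simplexJoin A) ?_ hBn hBF (hbK.simplexJoin hbA) hbF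
    rwa [mem_simplexJoin, Finset.sdiff_eq_self_of_disjoint hAB.symm]
  | refl => exact .refl _ _
  | symm K K' h ih =>
    exact (ih ((RelEquiv.isCx_iff h).2 hK) (RelEquiv.away hF hAF hK (RelEquiv.symm h) hA)).symm
  | trans K K1 K2 h1 h2 ih1 ih2 =>
    exact (ih1 hK hA).trans (ih2 ((RelEquiv.isCx_iff h1).1 hK) (RelEquiv.away hF hAF hK h1 hA))

theorem RelEquiv.bdJoin (hF : IsCx F) (hAF : A ∈ F) (hAn : A.Nonempty) (hK : IsCx Q)
    (h : RelEquiv F Q Q') (hA : Away A Q) : RelEquiv F (bdJoin A Q) (bdJoin A Q') := by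
  induction h with
  | rel K K' h =>
    obtain ⟨hK, B, hB, hBn, hBF, b, hbK, hbF, rfl⟩ := h
    have hAB : Disjoint A B := hA.disjoint hB
    have hbA := hbF A hAF
    rw [← sd_bdJoin hAB hbA]
    refine .step (hK.bdJoin hAn) ⟨?_, ?_⟩ hBn hBF ((hbK.simplexJoin hbA).mono fun T hT => hT.2) hbF
    · intro h
      obtain ⟨x, hx⟩ := hAn
      exact Finset.disjoint_left.1 hAB hx (h hx)
    · rwa [Finset.sdiff_eq_self_of_disjoint hAB.symm]
  | refl => exact .refl _ _
  | symm K K' h ih =>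
    exact (ih ((RelEquiv.isCx_iff h).2 hK) (RelEquiv.away hF hAF hK (RelEquiv.symm h) hA)).symm
  | trans K K1 K2 h1 h2 ih1 ih2 =>
    exact (ih1 hK hA).trans (ih2 ((RelEquiv.isCx_iff h1).1 hK) (RelEquiv.away hF hAF hK h1 hA))

theorem RelEquiv.of_empty (h : RelEquiv ∅ K K') : RelEquiv {∅} K K' := by
  refine Relation.EqvGen.mono ?_ _ _ h
  rintro K K' ⟨hK, A, hA, hAn, hAF, a, haK, haF, rfl⟩
  exact ⟨hK, A, hA, hAn, hAn.ne_empty, a, haK, by rintro T rfl; simp, rfl⟩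

/-- The intermediate complexes of an equivalence can be kept away from a simplex `A` that meets
neither end. -/
theorem RelEquiv.avoid [Infinite α] (h : RelEquiv ∅ K K') (hK : IsCx K) (hA : Away A K)
    (hA' : Away A K') : RelEquiv (fullSimplex A) K K' := by
  have key : ∀ K : Set (Finset α), Away A K → ∀ T ∈ fullSimplex A, T ∈ K → T ∈ ({∅} : Set _) := by
    intro K hA T hT hTK
    have := hA.disjoint hTK
    rw [mem_fullSimplex] at hT
    exact Finset.disjoint_self_iff_empty T |>.1 (this.mono_left hT)
  refine RelEquiv.extend (L := {∅}) (isCx_fullSimplex A) hK (key K' hA') (key K hA) ?_ ?_ h.of_empty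
  · exact ⟨rfl, by rintro T U rfl hU; exact Finset.subset_empty.1 hU, Set.finite_singleton _⟩
  · rintro T rfl; simp [mem_fullSimplex]

/-! ### Renaming vertices -/

theorem image_fullSimplex (f : α → α) (s : Finset α) :
    (Finset.image f) '' fullSimplex s = fullSimplex (s.image f) := by
  ext T
  simp only [Set.mem_image, mem_fullSimplex]
  constructor
  · rintro ⟨S, hS, rfl⟩; exact Finset.image_subset_image hS
  · intro h
    rw [Finset.subset_image_iff] at h
    obtain ⟨S, hS, rfl⟩ := h
    exact ⟨S, hS, rfl⟩

theorem image_properFaces {f : α → α} (hf : Set.InjOn f s) :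
    (Finset.image f) '' properFaces s = properFaces (s.image f) := by
  ext T
  simp only [Set.mem_image, mem_properFaces]
  constructor
  · rintro ⟨S, hS, rfl⟩
    refine ⟨Finset.image_subset_image hS.1, fun h => hS.2 fun x hx => ?_⟩
    obtain ⟨y, hy, hxy⟩ := Finset.mem_image.1 (h (Finset.mem_image_of_mem f hx))
    rwa [← hf (hS.1 hy) hx hxy]
  · intro h
    obtain ⟨S, hS, rfl⟩ := Finset.subset_image_iff.1 h.1
    exact ⟨S, Finset.ssubset_iff_subset_ne.2 ⟨hS, by rintro rfl; exact h.2 subset_rfl⟩, rfl⟩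

/-- Subdivision at a vertex is a renaming. -/
theorem sd_singleton_eq_image (hb : Fresh b K) (hv : {v} ∈ K) :
    sd {v} b K = (Finset.image fun x => if x = v then b else x) '' K := by
  have hvb : v ≠ b := fun h => hb _ hv (by simp [h])
  have key : ∀ S : Finset α, v ∉ S → S.image (fun x => if x = v then b else x) = S := by
    intro S hS
    conv_rhs => rw [← Finset.image_id (s := S)]
    refine Finset.image_congr fun x hx => ?_
    have : x ≠ v := by rintro rfl; exact hS hx
    simp [this]
  have key2 : ∀ S : Finset α, v ∉ S →
      (insert v S).image (fun x => if x = v then b else x) = insert b S := by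
    intro S hS
    rw [Finset.image_insert, key S hS]; simp
  ext T
  rw [mem_sd, Finset.singleton_subset_iff]
  constructor
  · rintro ⟨hvT, ⟨hbT, h⟩ | ⟨hbT, h⟩⟩
    · refine ⟨_, h, ?_⟩
      rw [Finset.union_comm, ← Finset.insert_eq, key2 _ (by simp [hvT]), Finset.insert_erase hbT]
    · exact ⟨T, h, key T hvT⟩
  · rintro ⟨S, hS, rfl⟩
    have hbS := hb S hS
    rcases insert_cases v S with ⟨S, hvS, rfl⟩ | hvS
    · rw [Finset.mem_insert, not_or] at hbS
      rw [key2 S hvS]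
      refine ⟨by simp [hvb, hvS], Or.inl ⟨by simp, ?_⟩⟩
      rwa [Finset.erase_insert hbS.2, Finset.union_comm, ← Finset.insert_eq]
    · rw [key S hvS]
      exact ⟨hvS, Or.inr ⟨hbS, hS⟩⟩

theorem IsCx.image (hK : IsCx K) (f : α → α) : IsCx ((Finset.image f) '' K) := by
  refine ⟨⟨∅, hK.empty_mem, by simp⟩, ?_, hK.fin.image _⟩
  rintro _ U ⟨T, hT, rfl⟩ hU
  obtain ⟨S, hS, rfl⟩ := Finset.subset_image_iff.1 hU
  exact ⟨S, hK.down hT hS, rfl⟩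

/-- Renaming the vertices in `V` to new points is an equivalence. -/
theorem relEquiv_image_of_fresh (hK : IsCx K) (f : α → α) (V : Finset α) (hV : ∀ v ∈ V, {v} ∈ K)
    (hf : ∀ v ∈ V, Fresh (f v) K) (hinj : Set.InjOn f V) :
    RelEquiv ∅ K ((Finset.image fun x => if x ∈ V then f x else x) '' K) := by
  induction V using Finset.induction_on with
  | empty => simp [Finset.image_id', RelEquiv.refl]
  | insert v V hvV ih =>
    have h1 := ih (fun w hw => hV w (by simp [hw])) (fun w hw => hf w (by simp [hw]))
      (hinj.mono (by simp))
    refine h1.trans ?_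
    set K₁ := (Finset.image fun x => if x ∈ V then f x else x) '' K with hK₁
    have hcx : IsCx K₁ := hK.image _
    have hv1 : {v} ∈ K₁ := ⟨{v}, hV v (by simp), by simp [hvV]⟩
    have hfv : Fresh (f v) K₁ := by
      rintro _ ⟨S, hS, rfl⟩ h
      obtain ⟨y, hy, hyv⟩ := Finset.mem_image.1 h
      split_ifs at hyv with h2
      · exact hvV (hinj (by simp [h2]) (by simp) hyv ▸ h2)
      · exact hf v (by simp) S hS (hyv ▸ hy)
    have h2 := sd_singleton_eq_image hfv hv1
    have h3 : (Finset.image fun x => if x = v then f v else x) '' K₁ =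
        (Finset.image fun x => if x ∈ insert v V then f x else x) '' K := by
      rw [hK₁, Set.image_image]
      refine Set.image_congr fun S hS => ?_
      rw [Finset.image_image]
      refine Finset.image_congr fun x hx => ?_
      by_cases hxv : x = v
      · subst hxv; simp [hvV]
      · by_cases hxV : x ∈ V
        · have : f x ≠ v := fun h => hf x (by simp [hxV]) {v} (hV v (by simp)) (by simp [h])
          simp [hxV, this]
        · simp [hxV, hxv]
    rw [← h3, ← h2]
    exact .step hcx hv1 (by simp) (by simp) hfv (fun _ h => absurd h (by simp))

theorem exists_injOn_avoiding [Infinite α] (V W : Finset α) :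
    ∃ g : α → α, Set.InjOn g V ∧ ∀ x ∈ V, g x ∉ W := by
  have : Infinite {x // x ∉ W} := by
    have := (Finset.finite_toSet W).infinite_compl
    exact this.to_subtype
  let φ := Infinite.natEmbedding {x // x ∉ W}
  refine ⟨fun x => if h : x ∈ V then (φ (V.equivFin ⟨x, h⟩)).1 else x, ?_, ?_⟩
  · intro x hx y hy h
    have hx' : x ∈ V := hx
    have hy' : y ∈ V := hy
    simp only [hx', hy', dif_pos] at h
    have := V.equivFin.injective (Fin.ext (φ.injective (Subtype.ext h)))
    simpa using this
  · intro x hx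
    simp only [hx, dif_pos]
    exact (φ (V.equivFin ⟨x, hx⟩)).2

theorem exists_verts (hK : IsCx K) : ∃ V : Finset α, ∀ v, v ∈ V ↔ {v} ∈ K := by
  have : {v | {v} ∈ K}.Finite := by
    refine Set.Finite.of_finite_image (f := fun v => ({v} : Finset α)) (hK.fin.subset ?_) ?_
    · rintro _ ⟨v, hv, rfl⟩; exact hv
    · exact fun v _ w _ h => Finset.singleton_injective h
  exact ⟨this.toFinset, fun v => by simp⟩

/-- A map that is injective on the vertices yields an equivalent complex. Since the new names may
be among the old vertices, both sides are renamed to a third set of points. -/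
theorem relEquiv_image [Infinite α] (hK : IsCx K) {f : α → α} (hf : Set.InjOn f {v | {v} ∈ K}) :
    RelEquiv ∅ K ((Finset.image f) '' K) := by
  obtain ⟨V, hV⟩ := exists_verts hK
  have hsub : ∀ S ∈ K, ∀ x ∈ S, x ∈ V := fun S hS x hx =>
    (hV x).2 (hK.down hS (by simpa using hx))
  -- `g` supplies new names that are neither old vertices nor values of `f`
  obtain ⟨g, hg, hgV⟩ := exists_injOn_avoiding V (V ∪ V.image f)
  have hK2 := hK.image f
  have hfV : Set.InjOn f V := fun x hx y hy h => hf ((hV x).1 hx) ((hV y).1 hy) h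
  have h1 := relEquiv_image_of_fresh hK g V (fun v hv => (hV v).1 hv) (fun v hv S hS h =>
    hgV v hv (Finset.mem_union_left _ (hsub S hS _ h))) hg
  obtain ⟨k, hk⟩ : ∃ k : α → α, ∀ x ∈ V, k (f x) = g x := by
    classical
    refine ⟨fun y => if h : ∃ x ∈ V, f x = y then g h.choose else y, fun x hx => ?_⟩
    have h : ∃ x' ∈ V, f x' = f x := ⟨x, hx, rfl⟩
    simp only [h, dif_pos]
    exact congrArg g (hfV h.choose_spec.1 hx h.choose_spec.2)
  have h2 := relEquiv_image_of_fresh hK2 k (V.image f) ?_ ?_ ?_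
  · refine h1.trans (.symm ?_)
    convert h2 using 1
    rw [Set.image_image]
    refine Set.image_congr fun S hS => ?_
    rw [Finset.image_image]
    refine Finset.image_congr fun x hx => ?_
    have hxV := hsub S hS x hx
    have : f x ∈ V.image f := Finset.mem_image_of_mem f hxV
    rw [Function.comp_apply, if_pos hxV, if_pos this, hk x hxV]
  · intro v hv
    obtain ⟨x, hx, rfl⟩ := Finset.mem_image.1 hv
    exact ⟨{x}, (hV x).1 hx, by simp⟩
  · rintro v hv _ ⟨S, hS, rfl⟩ h
    obtain ⟨x, hx, rfl⟩ := Finset.mem_image.1 hv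
    rw [hk x hx] at h
    obtain ⟨y, hy, hyx⟩ := Finset.mem_image.1 h
    exact hgV x hx (Finset.mem_union_right _ (hyx ▸ Finset.mem_image_of_mem f (hsub S hS y hy)))
  · intro y hy y' hy' h
    obtain ⟨x, hx, rfl⟩ := Finset.mem_image.1 hy
    obtain ⟨x', hx', rfl⟩ := Finset.mem_image.1 hy'
    rw [hk x hx, hk x' hx'] at h
    rw [hg hx hx' h]

theorem exists_image_disjoint [Infinite α] (s W : Finset α) :
    ∃ t : Finset α, t.card = s.card ∧ Disjoint W t ∧
      RelEquiv ∅ (fullSimplex s) (fullSimplex t) ∧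
      (s.Nonempty → RelEquiv ∅ (properFaces s) (properFaces t)) := by
  obtain ⟨g, hg, hgW⟩ := exists_injOn_avoiding s W
  refine ⟨s.image g, Finset.card_image_of_injOn hg, ?_, ?_, ?_⟩
  · rw [Finset.disjoint_right]
    intro y hy
    obtain ⟨x, hx, rfl⟩ := Finset.mem_image.1 hy
    exact hgW x hx
  · rw [← image_fullSimplex]
    refine relEquiv_image (isCx_fullSimplex s) (hg.mono fun v hv => ?_)
    simpa [mem_fullSimplex] using hv
  · intro hs
    rw [← image_properFaces hg]
    refine relEquiv_image (isCx_properFaces hs) (hg.mono fun v hv => ?_)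
    have := (mem_properFaces.1 hv).1
    simpa using this

/-! ### Balls and spheres -/

/-- `K` is a stellar ball of dimension `d - 1`, where `d` is the number of vertices of a simplex of
that dimension. The shift avoids negative dimensions; there is no `Ball 0`. -/
def Ball (d : ℕ) (K : Set (Finset α)) : Prop :=
  ∃ s : Finset α, s.card = d ∧ s.Nonempty ∧ RelEquiv ∅ K (fullSimplex s)

/-- `K` is a stellar sphere of dimension `d - 1`; in particular `Sphere 0` is the family `{∅}`, and
`Sphere d` is the kind of complex that bounds a `Ball (d + 1)`. -/
def Sphere (d : ℕ) (K : Set (Finset α)) : Prop :=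
  ∃ s : Finset α, s.card = d + 1 ∧ RelEquiv ∅ K (properFaces s)

theorem Ball.of_equiv (h : Ball d K) (h' : RelEquiv ∅ K' K) : Ball d K' := by
  obtain ⟨s, hs, hn, hK⟩ := h
  exact ⟨s, hs, hn, h'.trans hK⟩

theorem Sphere.of_equiv (h : Sphere d K) (h' : RelEquiv ∅ K' K) : Sphere d K' := by
  obtain ⟨s, hs, hK⟩ := h
  exact ⟨s, hs, h'.trans hK⟩

theorem Ball.isCx (h : Ball d K) : IsCx K := by
  obtain ⟨s, hs, hn, hK⟩ := h
  exact hK.isCx_iff.2 (isCx_fullSimplex s)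

theorem Sphere.isCx (h : Sphere d K) : IsCx K := by
  obtain ⟨s, hs, hK⟩ := h
  exact hK.isCx_iff.2 (isCx_properFaces (Finset.card_pos.1 (by omega)))

theorem Ball.isCx_bd (h : Ball d K) : IsCx (bd K) := by
  obtain ⟨s, hs, hn, hK⟩ := h
  rw [hK.isCx_bd_iff, bd_fullSimplex]
  exact isCx_properFaces hn

theorem Ball.sphere_bd (h : Ball (d + 1) K) : Sphere d (bd K) := by
  have h1 := h.isCx_bd
  obtain ⟨s, hs, hn, hK⟩ := h
  have := hK.bd h1
  rw [bd_fullSimplex] at this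
  exact ⟨s, hs, this⟩

theorem Ball.pos (h : Ball d K) : ∃ e, d = e + 1 := by
  obtain ⟨s, hs, hn, hK⟩ := h
  have := Finset.card_pos.2 hn
  exact ⟨d - 1, by omega⟩

theorem Sphere.bd_eq_empty (h : Sphere d K) : bd K = ∅ := by
  obtain ⟨s, hs, hK⟩ := h
  rw [hK.bd_eq_empty_iff, bd_properFaces]

theorem Ball.exists_away [Infinite α] (h : Ball d K) (W : Finset α) :
    ∃ s : Finset α, s.card = d ∧ s.Nonempty ∧ Disjoint W s ∧ RelEquiv ∅ K (fullSimplex s) := by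
  obtain ⟨s, hs, hn, hK⟩ := h
  obtain ⟨t, h1, h2, h3, -⟩ := exists_image_disjoint s W
  exact ⟨t, h1.trans hs, by rwa [← Finset.card_pos, h1, Finset.card_pos], h2, hK.trans h3⟩

theorem Sphere.exists_away [Infinite α] (h : Sphere d K) (W : Finset α) :
    ∃ s : Finset α, s.card = d + 1 ∧ s.Nonempty ∧ Disjoint W s ∧ RelEquiv ∅ K (properFaces s) := by
  obtain ⟨s, hs, hK⟩ := h
  have hn : s.Nonempty := Finset.card_pos.1 (by omega)
  obtain ⟨t, h1, h2, -, h3⟩ := exists_image_disjoint s W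
  exact ⟨t, h1.trans hs, by rwa [← Finset.card_pos, h1, Finset.card_pos], h2, hK.trans (h3 hn)⟩

theorem away_fullSimplex (h : Disjoint A s) : Away A (fullSimplex s) := fun _ hx _ hT hxT =>
  Finset.disjoint_left.1 h hx (hT hxT)

theorem away_properFaces (h : Disjoint A s) : Away A (properFaces s) :=
  (away_fullSimplex h).mono fun _ hT => hT.1

theorem fresh_empty (a : α) : Fresh a (∅ : Set (Finset α)) := fun _ h => absurd h (by simp)

/-- For a ball `Q`, the join `∂A ⋆ Q` is a ball: if `Q` is a simplex and `x` a vertex of it, the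
join is the subdivision of the simplex `A ∪ (Q \ x)` at `A` with new vertex `x`. -/
theorem Ball.bdJoin [Infinite α] (h : Ball d Q) (hAn : A.Nonempty) (hA : Away A Q)
    (hd : e + 1 = d + A.card) : Ball e (bdJoin A Q) := by
  obtain ⟨s, hs, hn, hd', hQ⟩ := h.exists_away A
  have h1 := hQ.avoid h.isCx hA (away_fullSimplex hd')
  have h2 := (h1.bdJoin (isCx_fullSimplex A) (mem_fullSimplex.2 subset_rfl) hAn h.isCx hA).mono
    (Set.empty_subset _)
  refine Ball.of_equiv ?_ h2
  obtain ⟨x, hx⟩ := hn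
  have hxA : x ∉ A := fun h => Finset.disjoint_left.1 hd' h hx
  have h3 : Stellar.bdJoin A (fullSimplex s) = sd A x (fullSimplex (A ∪ s.erase x)) := by
    ext T
    simp only [mem_bdJoin, mem_sd, mem_fullSimplex]
    refine and_congr_right fun _ => ?_
    have e1 : T \ A ⊆ s ↔ T ⊆ A ∪ s := sdiff_le_iff
    rw [e1]
    by_cases hxT : x ∈ T
    · simp only [hxT, true_and, not_true, false_and, or_false]
      constructor
      · intro h y hy
        have := @h y
        simp only [Finset.mem_union, Finset.mem_erase] at hy this ⊢
        tauto
      · intro h y hy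
        by_cases hyx : y = x
        · subst hyx; simp [hx]
        · have := @h y
          simp only [Finset.mem_union, Finset.mem_erase] at hy this ⊢
          tauto
    · simp only [hxT, false_and, false_or, not_false_eq_true, true_and]
      constructor
      · intro h y hy
        have := @h y
        have h0 : y ≠ x := by rintro rfl; exact hxT hy
        simp only [Finset.mem_union, Finset.mem_erase] at hy this ⊢
        tauto
      · exact fun h => h.trans (by gcongr; exact Finset.erase_subset _ _)
  have h4 : Disjoint A (s.erase x) := hd'.mono_right (Finset.erase_subset _ _)
  refine ⟨A ∪ s.erase x, ?_, hAn.mono Finset.subset_union_left, ?_⟩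
  · rw [Finset.card_union_of_disjoint h4, Finset.card_erase_of_mem hx]
    have := Finset.card_pos.2 ⟨x, hx⟩
    omega
  · rw [h3]
    exact .symm (.step (isCx_fullSimplex _) Finset.subset_union_left hAn (by simp)
      (fun T hT hxT => by simpa [hxA] using hT hxT) (fresh_empty x))

/-- For a sphere `Q`, the join `∂A ⋆ Q` is a sphere, by the same subdivision as for balls. -/
theorem Sphere.bdJoin [Infinite α] (h : Sphere d Q) (hAn : A.Nonempty) (hA : Away A Q)
    (hd : e + 1 = d + A.card) : Sphere e (bdJoin A Q) := by
  obtain ⟨s, hs, hn, hd', hQ⟩ := h.exists_away A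
  have h1 := hQ.avoid h.isCx hA (away_properFaces hd')
  have h2 := (h1.bdJoin (isCx_fullSimplex A) (mem_fullSimplex.2 subset_rfl) hAn h.isCx hA).mono
    (Set.empty_subset _)
  refine Sphere.of_equiv ?_ h2
  obtain ⟨x, hx⟩ := hn
  have hxA : x ∉ A := fun h => Finset.disjoint_left.1 hd' h hx
  by_cases hs' : s.erase x = ∅
  · have hsx : s = {x} := by rw [← Finset.insert_erase hx, hs']; rfl
    refine ⟨A, ?_, ?_⟩
    · rw [hsx, Finset.card_singleton] at hs; omega
    · have : Stellar.bdJoin A (properFaces s) = properFaces A := by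
        ext T
        simp only [mem_bdJoin, mem_properFaces, hsx, Finset.ssubset_singleton_iff,
          Finset.sdiff_eq_empty_iff_subset]
        rw [and_comm]; rfl
      rw [this]
      exact .refl _ _
  have h3 : Stellar.bdJoin A (properFaces s) = sd A x (properFaces (A ∪ s.erase x)) := by
    ext T
    simp only [mem_bdJoin, mem_sd, mem_properFaces]
    refine and_congr_right fun hAT => ?_
    have e1 : T \ A ⊂ s ↔ T ⊆ A ∪ s ∧ ¬ s ⊆ T := by
      rw [show (T \ A ⊂ s) = (T \ A ⊆ s ∧ ¬ s ⊆ T \ A) from rfl, Finset.subset_sdiff,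
        show (T \ A ⊆ s ↔ T ⊆ A ∪ s) from sdiff_le_iff, and_iff_left hd'.symm]
    rw [e1]
    by_cases hxT : x ∈ T
    · simp only [hxT, true_and, not_true, false_and, or_false]
      rw [Finset.ssubset_def]
      refine and_congr ?_ (not_congr ?_)
      · constructor
        · intro h y hy
          have := @h y
          simp only [Finset.mem_union, Finset.mem_erase] at hy this ⊢
          tauto
        · intro h y hy
          by_cases hyx : y = x
          · subst hyx; simp [hx]
          · have := @h y
            simp only [Finset.mem_union, Finset.mem_erase] at hy this ⊢
            tauto
      · constructor
        · intro h y hy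
          have := @h y
          simp only [Finset.mem_union, Finset.mem_erase] at hy this ⊢
          tauto
        · intro h y hy
          by_cases hyx : y = x
          · subst hyx; exact hxT
          · have := @h y
            have hyA : y ∉ A := fun h => Finset.disjoint_left.1 hd' h hy
            simp only [Finset.mem_union, Finset.mem_erase] at hy this ⊢
            tauto
    · simp only [hxT, false_and, false_or, not_false_eq_true, true_and]
      rw [Finset.ssubset_def]
      have h5 : ¬ s ⊆ T := fun h => hxT (h hx)
      have h6 : ¬ A ∪ s.erase x ⊆ T := fun h => hAT (Finset.subset_union_left.trans h)
      rw [and_iff_left h5, and_iff_left h6]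
      constructor
      · intro h y hy
        have := @h y
        have h0 : y ≠ x := by rintro rfl; exact hxT hy
        simp only [Finset.mem_union, Finset.mem_erase] at hy this ⊢
        tauto
      · exact fun h => h.trans (by gcongr; exact Finset.erase_subset _ _)
  have h4 : Disjoint A (s.erase x) := hd'.mono_right (Finset.erase_subset _ _)
  refine ⟨A ∪ s.erase x, ?_, ?_⟩
  · rw [Finset.card_union_of_disjoint h4, Finset.card_erase_of_mem hx]
    have := Finset.card_pos.2 ⟨x, hx⟩
    omega
  · rw [h3]
    refine .symm (.step (isCx_properFaces (hAn.mono Finset.subset_union_left)) ?_ hAn (by simp)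
      (fun T hT hxT => by simpa [hxA] using (mem_properFaces.1 hT).1 hxT) (fresh_empty x))
    rw [mem_properFaces, Finset.ssubset_iff_subset_ne]
    refine ⟨Finset.subset_union_left, fun h => hs' ?_⟩
    rw [← Finset.disjoint_self_iff_empty]
    exact h4.mono_left (by conv_rhs => rw [h]
                           exact Finset.subset_union_right)

/-- For a sphere `Q`, the join `A ⋆ Q` is a ball: for `Q = ∂s` and a vertex `y` of `A`, it is the
subdivision of the simplex `(A \ y) ∪ s` at `s` with new vertex `y`. -/
theorem Sphere.simplexJoin [Infinite α] (h : Sphere d Q) (hAn : A.Nonempty) (hA : Away A Q) :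
    Ball (d + A.card) (simplexJoin A Q) := by
  obtain ⟨s, hs, hn, hd', hQ⟩ := h.exists_away A
  have h1 := hQ.avoid h.isCx hA (away_properFaces hd')
  have h2 := (h1.simplexJoin (isCx_fullSimplex A) (mem_fullSimplex.2 subset_rfl) h.isCx hA).mono
    (Set.empty_subset _)
  refine Ball.of_equiv ?_ h2
  obtain ⟨y, hy⟩ := hAn
  have hys : y ∉ s := Finset.disjoint_left.1 hd' hy
  have h3 : Stellar.simplexJoin A (properFaces s) = sd s y (fullSimplex (A.erase y ∪ s)) := by
    ext T
    simp only [mem_simplexJoin, mem_sd, mem_properFaces, mem_fullSimplex]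
    have e1 : T \ A ⊂ s ↔ ¬ s ⊆ T ∧ T ⊆ A ∪ s := by
      rw [show (T \ A ⊂ s) = (T \ A ⊆ s ∧ ¬ s ⊆ T \ A) from rfl, Finset.subset_sdiff,
        show (T \ A ⊆ s ↔ T ⊆ A ∪ s) from sdiff_le_iff, and_iff_left hd'.symm, and_comm]
    rw [e1]
    refine and_congr_right fun _ => ?_
    by_cases hxT : y ∈ T
    · simp only [hxT, true_and, not_true, false_and, or_false]
      constructor
      · intro h z hz
        have := @h z
        simp only [Finset.mem_union, Finset.mem_erase] at hz this ⊢
        tauto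
      · intro h z hz
        by_cases hyx : z = y
        · subst hyx; simp [hy]
        · have := @h z
          simp only [Finset.mem_union, Finset.mem_erase] at hz this ⊢
          tauto
    · simp only [hxT, false_and, false_or, not_false_eq_true, true_and]
      constructor
      · intro h z hz
        have := @h z
        have h0 : z ≠ y := by rintro rfl; exact hxT hz
        simp only [Finset.mem_union, Finset.mem_erase] at hz this ⊢
        tauto
      · exact fun h => h.trans (by gcongr; exact Finset.erase_subset _ _)
  have h4 : Disjoint (A.erase y) s := hd'.mono_left (Finset.erase_subset _ _)
  refine ⟨A.erase y ∪ s, ?_, hn.mono Finset.subset_union_right, ?_⟩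
  · rw [Finset.card_union_of_disjoint h4, Finset.card_erase_of_mem hy]
    have := Finset.card_pos.2 ⟨y, hy⟩
    omega
  · rw [h3]
    exact .symm (.step (isCx_fullSimplex _) Finset.subset_union_right hn (by simp)
      (fun T hT hxT => by simpa [hys] using hT hxT) (fresh_empty y))

end

/-! ### Links of simplexes in balls and spheres -/

section

variable {α : Type*} [DecidableEq α]
variable {F G J J' K K' L M Q Q' : Set (Finset α)} {A B C T X Y s t : Finset α}
  {a b c v w x : α} {d e : ℕ}

/-- `K` is a stellar ball or sphere of dimension `d - 1`. -/
def BallOrSphere (d : ℕ) (K : Set (Finset α)) : Prop := Ball d K ∨ Sphere d K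

theorem BallOrSphere.of_equiv (h : BallOrSphere d K) (h' : RelEquiv ∅ K' K) :
    BallOrSphere d K' := h.imp (·.of_equiv h') (·.of_equiv h')

/-- `K` is a stellar manifold of dimension `d - 1`. -/
def Mfd (d : ℕ) (K : Set (Finset α)) : Prop :=
  IsCx K ∧ ∀ v, {v} ∈ K → ∃ e, d = e + 1 ∧ BallOrSphere e (lk {v} K)

/-- The links of simplexes in balls and spheres of dimension `e - 1` are balls or spheres of the
expected dimension. -/
def LinkProperty (α : Type*) [DecidableEq α] (e : ℕ) : Prop :=
  ∀ (K : Set (Finset α)) (X : Finset α), BallOrSphere e K → X ∈ K →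
    ∃ e', e = e' + X.card ∧ BallOrSphere e' (lk X K)

theorem Mfd.lk_of_linkProperty (H : ∀ e, d = e + 1 → LinkProperty α e) (hK : Mfd d K) (hX : X ∈ K)
    (hXn : X.Nonempty) : ∃ e, d = e + X.card ∧ BallOrSphere e (lk X K) := by
  obtain ⟨v, hv⟩ := hXn
  have hvX : ({v} ∪ X.erase v : Finset α) = X := by rw [← Finset.insert_eq, Finset.insert_erase hv]
  obtain ⟨e, he, h1⟩ := hK.2 v (hK.1.down hX (by simpa using hv))
  have hd : Disjoint {v} (X.erase v) := by simp
  obtain ⟨e', he', h2⟩ := H e he _ (X.erase v) h1 ⟨hd, by rwa [hvX]⟩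
  refine ⟨e', ?_, ?_⟩
  · rw [Finset.card_erase_of_mem hv] at he'
    have := Finset.card_pos.2 ⟨v, hv⟩
    omega
  · rwa [lk_lk hd, hvX] at h2

/-- Being a manifold passes through a move in both directions, given the property of links in lower
dimension. -/
theorem Mfd.sd_iff_of_linkProperty [Infinite α] (H : ∀ e, d = e + 1 → LinkProperty α e)
    (hK : IsCx K) (hA : A ∈ K) (hAn : A.Nonempty) (ha : Fresh a K) :
    Mfd d K ↔ Mfd d (sd A a K) := by
  have haA := ha A hA
  have key : ∀ v, {v} ∈ K → ¬ A ⊆ {v} → {v} ∈ sd A a K := fun v hv h =>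
    ⟨h, Or.inr ⟨ha _ hv, hv⟩⟩
  have key2 : ¬ A ⊆ {a} := fun h => by
    rw [hAn.subset_singleton_iff] at h; simp [h] at haA
  constructor
  · intro h
    refine ⟨hK.sd hAn a, fun v hv => ?_⟩
    by_cases hva : v = a
    · subst hva
      rw [lk_singleton_sd hA ha]
      obtain ⟨e, he, h1⟩ := h.lk_of_linkProperty H hA hAn
      have hpos := Finset.card_pos.2 hAn
      have haw : Away A (lk A K) := fun x hx T hT hxT => Finset.disjoint_left.1 hT.1 hx hxT
      refine ⟨d - 1, by omega, ?_⟩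
      exact h1.imp (fun h => h.bdJoin hAn haw (by omega)) (fun h => h.bdJoin hAn haw (by omega))
    · have hvK : {v} ∈ K := (hv.2.resolve_left fun h => hva (Finset.mem_singleton.1 h.1).symm).2
      obtain ⟨e, he, h1⟩ := h.2 v hvK
      exact ⟨e, he, h1.of_equiv (relEquiv_lk_sd hK hvK hv.1 ha).symm⟩
  · intro h
    refine ⟨hK, fun v hv => ?_⟩
    by_cases hAv : A ⊆ {v}
    · rw [hAn.subset_singleton_iff] at hAv
      subst hAv
      obtain ⟨e, he, h1⟩ := h.2 a ⟨key2, Or.inl ⟨by simp, by simpa using hv⟩⟩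
      rw [lk_singleton_sd hA ha] at h1
      have : bdJoin {v} (lk {v} K) = lk {v} K := by
        ext T
        rw [mem_bdJoin, Finset.singleton_subset_iff]
        constructor
        · rintro ⟨h1, h2⟩
          rwa [Finset.sdiff_singleton_eq_erase, Finset.erase_eq_of_notMem h1] at h2
        · intro h
          have hvT : v ∉ T := by simpa using h.1
          refine ⟨hvT, ?_⟩
          rwa [Finset.sdiff_singleton_eq_erase, Finset.erase_eq_of_notMem hvT]
      rw [this] at h1
      exact ⟨e, he, h1⟩
    · obtain ⟨e, he, h1⟩ := h.2 v (key v hv hAv)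
      exact ⟨e, he, h1.of_equiv (relEquiv_lk_sd hK hv hAv ha)⟩

theorem lk_fullSimplex (hv : v ∈ s) : lk {v} (fullSimplex s) = fullSimplex (s.erase v) := by
  ext T
  simp only [mem_lk, mem_fullSimplex, Finset.disjoint_singleton_left, Finset.subset_erase,
    Finset.union_subset_iff, Finset.singleton_subset_iff, hv, true_and]
  tauto

theorem lk_properFaces (hv : v ∈ s) : lk {v} (properFaces s) = properFaces (s.erase v) := by
  ext T
  have h0 : s.erase v ⊆ T ↔ s ⊆ {v} ∪ T := by
    rw [Finset.erase_eq]; exact sdiff_le_iff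
  simp only [mem_lk, mem_properFaces, Finset.ssubset_def, Finset.disjoint_singleton_left,
    Finset.subset_erase, Finset.union_subset_iff, Finset.singleton_subset_iff, hv, true_and, h0]
  tauto

/-- Links in balls and spheres are balls or spheres. In dimension `d`, this follows from its
validity in lower dimensions, which makes the manifold property invariant under moves. -/
theorem linkProperty [Infinite α] (d : ℕ) : LinkProperty α d := by
  induction d using Nat.strong_induction_on with
  | _ d ih =>
  have H : ∀ e, d = e + 1 → LinkProperty α e := fun e he => ih e (by omega)
  intro K X hK hX
  have hM : Mfd d K := by
    have hinv : ∀ K', RelEquiv ∅ K K' → Mfd d K' → Mfd d K := fun K' h h' =>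
      (h.invariant (P := Mfd d) fun K A a hK hA hAn _ ha _ =>
        Mfd.sd_iff_of_linkProperty H hK hA hAn ha).2 h'
    rcases hK with ⟨s, hs, hn, h⟩ | ⟨s, hs, h⟩
    · refine hinv _ h ⟨isCx_fullSimplex s, fun v hv => ?_⟩
      have hvs : v ∈ s := by simpa [mem_fullSimplex] using hv
      have hc := Finset.card_erase_add_one hvs
      rw [lk_fullSimplex hvs]
      refine ⟨(s.erase v).card, by omega, ?_⟩
      rcases (s.erase v).eq_empty_or_nonempty with h0 | h0
      · refine Or.inr ⟨{v}, by simp [h0], ?_⟩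
        have : fullSimplex (s.erase v) = properFaces {v} := by
          ext T; simp [h0, mem_fullSimplex, mem_properFaces]
        rw [this]
        exact .refl _ _
      · exact Or.inl ⟨s.erase v, rfl, h0, .refl _ _⟩
    · refine hinv _ h ⟨isCx_properFaces (Finset.card_pos.1 (by omega)), fun v hv => ?_⟩
      have hvs : v ∈ s := by simpa using (mem_properFaces.1 hv).1
      have hc := Finset.card_erase_add_one hvs
      have hc2 := Finset.card_lt_card (mem_properFaces.1 hv)
      rw [Finset.card_singleton] at hc2
      rw [lk_properFaces hvs]
      exact ⟨d - 1, by omega, Or.inr ⟨s.erase v, by omega, .refl _ _⟩⟩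
  rcases X.eq_empty_or_nonempty with rfl | hXn
  · exact ⟨d, by simp, by rwa [lk_empty]⟩
  · exact hM.lk_of_linkProperty H hX hXn

theorem Mfd.lk [Infinite α] (hK : Mfd d K) (hX : X ∈ K) (hXn : X.Nonempty) :
    ∃ e, d = e + X.card ∧ BallOrSphere e (lk X K) :=
  hK.lk_of_linkProperty (fun e _ => linkProperty e) hX hXn

theorem Mfd.of_equiv [Infinite α] (hK : Mfd d K) (h : RelEquiv F K' K) : Mfd d K' :=
  (h.invariant (P := Mfd d) fun _ _ _ hK hA hAn _ ha _ =>
    Mfd.sd_iff_of_linkProperty (fun e _ => linkProperty e) hK hA hAn ha).2 hK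

theorem BallOrSphere.ball_of_mem_bd (h : BallOrSphere d (Stellar.lk X K)) (hX : X ∈ bd K) :
    Ball d (Stellar.lk X K) := by
  refine h.resolve_right fun h => ?_
  have h1 := h.bd_eq_empty
  rw [bd_lk] at h1
  have : ∅ ∈ Stellar.lk X (bd K) := by simpa [mem_lk] using hX
  rw [h1] at this
  exact this

theorem BallOrSphere.sphere_of_notMem_bd (h : BallOrSphere d (Stellar.lk X K))
    (hX : X ∉ bd K) : Sphere d (Stellar.lk X K) := by
  refine h.resolve_left fun h => ?_
  have h1 := h.isCx_bd.empty_mem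
  rw [bd_lk] at h1
  exact hX (by simpa [mem_lk] using h1)

/-! ### Cones and stars -/

/-- The part of the boundary of the join `A ⋆ Q` by which a star `A ⋆ Q` is attached to the rest of
a complex: `∂A ⋆ Q` together with `A ⋆ ∂Q`. -/
def joinBd (A : Finset α) (Q : Set (Finset α)) : Set (Finset α) :=
  {T | T \ A ∈ Q ∧ (A ⊆ T → T \ A ∈ bd Q)}

/-- The cone over `L` with apex `w`. -/
abbrev cone (w : α) (L : Set (Finset α)) : Set (Finset α) := simplexJoin {w} L

/-- The simplexes of the star of `A` in `J` which do not contain `A` or belong to `L`. In the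
applications `L` is the boundary of `J` and this is the frontier of the star, together with its
part in the boundary. -/
def starBd (A : Finset α) (J L : Set (Finset α)) : Set (Finset α) :=
  {T | A ∪ T ∈ J ∧ (A ⊆ T → T ∈ L)}

theorem mem_joinBd : T ∈ joinBd A Q ↔ T \ A ∈ Q ∧ (A ⊆ T → T \ A ∈ bd Q) := Iff.rfl

theorem mem_starBd : T ∈ starBd A J L ↔ A ∪ T ∈ J ∧ (A ⊆ T → T ∈ L) := Iff.rfl

theorem mem_cone : T ∈ cone w L ↔ T.erase w ∈ L := by
  rw [mem_simplexJoin, Finset.sdiff_singleton_eq_erase]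

theorem mem_cone_of_notMem (h : w ∉ T) : T ∈ cone w L ↔ T ∈ L := by
  rw [mem_cone, Finset.erase_eq_of_notMem h]

theorem subset_cone (hL : Fresh w L) : L ⊆ cone w L := fun _ hT =>
  (mem_cone_of_notMem (hL _ hT)).2 hT

theorem Fresh.cone (hb : Fresh b L) (hbw : b ≠ w) : Fresh b (cone w L) :=
  Fresh.simplexJoin hb (by simpa using hbw)

/-- The apex of a cone can be changed. -/
theorem relEquiv_cone_cone (hL : IsCx L) (hw : Fresh w L) (hv : Fresh v L) :
    RelEquiv L (cone w L) (cone v L) := by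
  by_cases hwv : w = v
  · subst hwv; exact .refl _ _
  have : cone v L = sd {w} v (cone w L) := by
    have hvw : v ≠ w := Ne.symm hwv
    have h3 : ∀ S, insert w S ∉ L := fun S h => hw _ h (by simp)
    have h4 : ∀ S, insert v S ∉ L := fun S h => hv _ h (by simp)
    apply ext_insert₂ w v <;> intro S h1 h2
    all_goals simp [mem_cone, mem_sd, Finset.erase_insert_of_ne, *]
  rw [this]
  refine .step (hL.simplexJoin _) ?_ (by simp) ?_ (hv.cone (Ne.symm hwv)) hv
  · simpa [mem_cone] using hL.empty_mem
  · exact fun h => hw _ h (by simp)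

/-- If the star of `A` is equivalent, relative to `starBd A J L`, to the cone over `starBd A J L`,
then the star can be replaced by this cone inside `J`. -/
theorem star_replace [Infinite α] (hJ : IsCx J) (hAn : A.Nonempty)
    (hL : IsCx (starBd A J L)) (hF : IsCx F) (hFJ : ∀ T ∈ F, A ⊆ T → T ∈ J → T ∈ L)
    (hw : Fresh w J) (hwF : Fresh w F)
    (h : RelEquiv (starBd A J L) {T | A ∪ T ∈ J} (cone w (starBd A J L))) :
    RelEquiv F J (cone w (starBd A J L) ∪ {T ∈ J | ¬ A ⊆ T}) := by
  set S := starBd A J L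
  set D := {T ∈ J | ¬ A ⊆ T} with hD
  have hwS : Fresh w S := fun T hT hwT => hw _ hT.1 (Finset.mem_union_right _ hwT)
  have hDcx : IsCx D := by
    refine ⟨⟨hJ.empty_mem, fun h => hAn.ne_empty (Finset.subset_empty.1 h)⟩,
      fun T U hT hU => ⟨hJ.down hT.1 hU, fun h => hT.2 (h.trans hU)⟩, hJ.fin.subset fun T h => h.1⟩
  have hcx : IsCx {T | A ∪ T ∈ J} := h.isCx_iff.2 (hL.simplexJoin _)
  have hwF' : Fresh w ((S ∪ D) ∪ F) :=
    fresh_union.2 ⟨fresh_union.2 ⟨hwS, hw.mono fun T h => h.1⟩, hwF⟩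
  have h1 : RelEquiv ((S ∪ D) ∪ F) {T | A ∪ T ∈ J} (cone w S) := by
    refine h.extend ((hL.union hDcx).union hF) hcx ?_ ?_ hL ?_
    · intro T hT hT'
      rwa [mem_cone_of_notMem (hwF' T hT)] at hT'
    · rintro T ((hT | hT) | hT) hT'
      · exact hT
      · exact ⟨hT', fun h => absurd h hT.2⟩
      · exact ⟨hT', fun h => hFJ T hT h (hJ.down hT' Finset.subset_union_right)⟩
    · exact fun T hT => Or.inl (Or.inl hT)
  have h2 := (h1.union hDcx fun T hT => Or.inl (Or.inr hT)).mono
    (Set.subset_union_right (s := S ∪ D) (t := F))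
  convert h2 using 1
  ext T
  simp only [hD, Set.mem_union, Set.mem_ofPred_eq]
  constructor
  · intro hT
    by_cases h : A ⊆ T
    · exact Or.inl (by rwa [Finset.union_eq_right.2 h])
    · exact Or.inr ⟨hT, h⟩
  · rintro (h | h)
    · exact hJ.down h Finset.subset_union_right
    · exact h.1

end

/-! ### Fillings and cones -/

section

variable {α : Type*} [DecidableEq α]
variable {F G J J' K K' L M Q Q' : Set (Finset α)} {A B C T X Y s t : Finset α}
  {a b c v w x : α} {d e : ℕ}

/-- The join `b ⋆ B ⋆ lk (B, L)`: a filling between the star of `B` in `L` and its subdivision with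
new vertex `b`. The union of a subdivided complex with the filling undoes, on `L`, the effect of
the subdivision. -/
def filling (B : Finset α) (b : α) (L : Set (Finset α)) : Set (Finset α) :=
  {T | T.erase b ∪ B ∈ L}

theorem isCx_filling (hL : IsCx L) (hB : B ∈ L) : IsCx (filling B b L) := by
  refine ⟨by simpa [filling] using hB, fun T U hT hU => ?_, ?_⟩
  · exact hL.down hT (Finset.union_subset_union_left (Finset.erase_subset_erase _ hU))
  · refine (hL.fin.union (hL.fin.image (insert b))).subset fun T hT => ?_
    have h1 : T.erase b ∈ L := hL.down hT Finset.subset_union_left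
    by_cases h : b ∈ T
    · exact Or.inr ⟨_, h1, Finset.insert_erase h⟩
    · rw [Finset.erase_eq_of_notMem h] at h1; exact Or.inl h1

theorem mem_sd_of_mem_filling (hL : IsCx L) (hT : T ∈ filling B b L) (hT' : T ∈ sd B b K) :
    T ∈ sd B b L := by
  refine ⟨hT'.1, ?_⟩
  by_cases h : b ∈ T
  · exact Or.inl ⟨h, hT⟩
  · refine Or.inr ⟨h, hL.down hT ?_⟩
    rw [Finset.erase_eq_of_notMem h]
    exact Finset.subset_union_left

theorem subset_sd_union_filling (hb : Fresh b L) : L ⊆ sd B b L ∪ filling B b L := by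
  intro T hT
  have hbT := hb T hT
  by_cases h : B ⊆ T
  · refine Or.inr ?_
    rwa [filling, Set.mem_ofPred_eq, Finset.erase_eq_of_notMem hbT, Finset.union_eq_left.2 h]
  · exact Or.inl ⟨h, Or.inr ⟨hbT, hT⟩⟩

/-- Gluing in the filling turns an equivalence relative to the subdivision of `L` into one relative
to `L`. -/
theorem relEquiv_sd_union_filling [Infinite α] (hL : IsCx L) (hB : B ∈ L) (hBn : B.Nonempty)
    (hb : Fresh b L) (hK : IsCx (sd B b K)) (h : RelEquiv (sd B b L) (sd B b K) (sd B b K')) :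
    RelEquiv L (sd B b K ∪ filling B b L) (sd B b K' ∪ filling B b L) := by
  have hZ := isCx_filling (b := b) hL hB
  have hL1 := hL.sd hBn b
  have h1 : RelEquiv (sd B b L ∪ filling B b L) (sd B b K) (sd B b K') :=
    h.extend (hL1.union hZ) hK
      (fun T hT hT' => hT.elim id fun hT => mem_sd_of_mem_filling hL hT hT')
      (fun T hT hT' => hT.elim id fun hT => mem_sd_of_mem_filling hL hT hT') hL1
      Set.subset_union_left
  exact (h1.union hZ Set.subset_union_right).mono (subset_sd_union_filling hb)

/-- If the star of `B` in `J` is a cone, with apex `w`, over the star of `B` in `L`, then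
subdividing `J` at `B` and gluing in the filling has the same effect as the single subdivision
`(w ⋆ B, b)`, which is a move off `L`. -/
theorem filling_of_cone (hJ : IsCx J) (hB : B ∈ L) (hbL : Fresh b L) (hbJ : Fresh b J)
    (hw : Fresh w L) (hwb : w ≠ b) (h : ∀ T, B ⊆ T → (T ∈ J ↔ T.erase w ∈ L)) :
    RelEquiv L J (sd B b J ∪ filling B b L) := by
  have hwB := hw B hB
  have hbB := hbL B hB
  have e : sd (insert w B) b J = sd B b J ∪ filling B b L := by
    refine ext_insert₂ w b ?_ ?_ ?_ ?_ <;> intro S h1 h2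
    · simp only [mem_sd, filling, Set.mem_union, Set.mem_ofPred_eq, h2, false_and, false_or,
        not_false_eq_true, true_and, Finset.insert_subset_iff, h1, not_false_eq_true,
        Finset.erase_eq_of_notMem]
      have k1 := h S
      have k2 := h (S ∪ B) Finset.subset_union_right
      rw [Finset.erase_eq_of_notMem h1] at k1
      rw [Finset.erase_eq_of_notMem (by simp [h1, hwB])] at k2
      have k3 : S ∪ B ∈ J → S ∈ J := fun h => hJ.down h Finset.subset_union_left
      by_cases hBS : B ⊆ S
      · have := k1 hBS
        rw [Finset.union_eq_left.2 hBS]; tauto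
      · tauto
    · have h3 : b ∉ insert w S := by simp [h2, hwb.symm]
      simp only [mem_sd, filling, Set.mem_union, Set.mem_ofPred_eq, h3, false_and, false_or,
        not_false_eq_true, true_and, Finset.insert_subset_iff, Finset.mem_insert_self,
        Finset.erase_eq_of_notMem]
      have k4 : insert w S ∪ B ∉ L := fun h => hw _ h (by simp)
      rw [Finset.subset_insert_iff_of_notMem hwB]
      tauto
    · have h3 : w ∉ insert b S := by simp [h1, hwb]
      have k1 := h (S ∪ B) Finset.subset_union_right
      rw [Finset.erase_eq_of_notMem (by simp [h1, hwB])] at k1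
      have k2 := h (S ∪ insert w B) (by intro x hx; simp [hx])
      have e2 : (S ∪ insert w B).erase w = S ∪ B := by
        rw [Finset.union_insert, Finset.erase_insert (by simp [h1, hwB])]
      rw [e2] at k2
      simp only [mem_sd, filling, Set.mem_union, Set.mem_ofPred_eq, Finset.mem_insert_self,
        true_and, Finset.insert_subset_iff, h3, false_and, not_false_eq_true,
        Finset.erase_insert h2, not_true, or_false, Finset.subset_insert_iff_of_notMem hbB]
      tauto
    · have h3 : b ∈ insert w (insert b S) := by simp
      have e1 : (insert w (insert b S)).erase b = insert w S := by
        rw [Finset.insert_comm, Finset.erase_insert (by simp [h2, hwb.symm])]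
      have k4 : insert w S ∪ B ∉ L := fun h => hw _ h (by simp)
      have k1 := h (insert w S ∪ B) Finset.subset_union_right
      have e2 : insert w S ∪ insert w B = insert w S ∪ B := by
        ext x; simp
      have e3 : (insert w S ∪ B).erase w = S ∪ B := by
        rw [Finset.insert_union, Finset.erase_insert (by simp [h1, hwB])]
      rw [e3] at k1
      simp only [mem_sd, filling, Set.mem_union, Set.mem_ofPred_eq, h3, true_and, e1, e2, k4,
        not_true, false_and, or_false, Finset.insert_subset_iff, Finset.mem_insert_self,
        Finset.subset_insert_iff_of_notMem hwB]
  rw [← e]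
  refine .step hJ ?_ (by simp) (fun h => hw _ h (by simp)) hbJ hbL
  rw [h _ (Finset.subset_insert _ _), Finset.erase_insert hwB]
  exact hB

/-- The previous statement for complexes `J` in which the star of `B` becomes a cone after some
moves relative to `L`. -/
theorem filling_of_relEquiv_cone [Infinite α] (hJ : IsCx J) (hL : IsCx L) (hB : B ∈ L)
    (hLJ : L ⊆ J) (hBn : B.Nonempty) (hbJ : Fresh b J) (hJ' : IsCx J') (hbJ' : Fresh b J')
    (hw : Fresh w L) (hwb : w ≠ b) (h : ∀ T, B ⊆ T → (T ∈ J' ↔ T.erase w ∈ L))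
    (hJJ' : RelEquiv L J J') :
    RelEquiv L J (sd B b J ∪ filling B b L) := by
  have hbL := hbJ.mono hLJ
  have h1 := hJJ'.sd hL hJ hB hBn (hLJ hB) hbL hbJ hbJ'
  have h2 := relEquiv_sd_union_filling hL hB hBn hbL (hJ.sd hBn b) h1
  exact (hJJ'.trans (filling_of_cone hJ' hB hbL hbJ' hw hwb h)).trans h2.symm

/-- The join `A ⋆ Q` can be transformed, relative to `joinBd A Q`, into a cone over `joinBd A Q`.
For `A = ∅` this says that `Q` is equivalent relative to its boundary to the cone over its
boundary. -/
def Conical (A : Finset α) (Q : Set (Finset α)) : Prop :=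
  ∃ w, w ∉ A ∧ Fresh w Q ∧ RelEquiv (joinBd A Q) (simplexJoin A Q) (cone w (joinBd A Q))

theorem isCx_joinBd (hQ : IsCx Q) (h : IsCx (bd Q) ∨ (bd Q = ∅ ∧ A.Nonempty)) :
    IsCx (joinBd A Q) := by
  refine ⟨⟨by simpa using hQ.empty_mem, fun h' => ?_⟩, fun T U hT hU => ⟨hQ.down hT.1
    (Finset.sdiff_subset_sdiff hU subset_rfl), fun h' => ?_⟩,
    (hQ.simplexJoin A).fin.subset fun T hT => hT.1⟩
  · rcases h with h | h
    · simpa using h.empty_mem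
    · exact absurd (Finset.subset_empty.1 h') h.2.ne_empty
  · have h1 := hT.2 (h'.trans hU)
    rcases h with h | h
    · exact h.down h1 (Finset.sdiff_subset_sdiff hU subset_rfl)
    · rw [h.1] at h1; exact absurd h1 (by simp)

theorem Fresh.joinBd (h : Fresh w Q) (hw : w ∉ A) : Fresh w (joinBd A Q) :=
  (h.simplexJoin hw).mono fun _ hT => hT.1

/-- The apex of the cone in `Conical` can be prescribed. -/
theorem Conical.forall (h : Conical A Q) (hcx : IsCx (joinBd A Q)) (hv : v ∉ A)
    (hvQ : Fresh v Q) : RelEquiv (joinBd A Q) (simplexJoin A Q) (cone v (joinBd A Q)) := by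
  obtain ⟨w, hw, hwQ, h1⟩ := h
  exact h1.trans (relEquiv_cone_cone hcx (hwQ.joinBd hw) (hvQ.joinBd hv))

/-- If `Q` has no boundary, then `joinBd A Q = ∂A ⋆ Q`, and the cone over it is the subdivision of
`A ⋆ Q` at `A`. -/
theorem conical_of_bd_eq_empty [Infinite α] (hQ : IsCx Q) (h : bd Q = ∅) (hAn : A.Nonempty) :
    Conical A Q := by
  obtain ⟨w, hwA, hwQ⟩ := exists_fresh hQ.fin A
  refine ⟨w, hwA, hwQ, ?_⟩
  have e : cone w (joinBd A Q) = sd A w (simplexJoin A Q) := by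
    refine ext_insert w ?_ ?_ <;> intro S hS
    · simp only [mem_cone_of_notMem hS, mem_joinBd, mem_sd, hS, h, mem_simplexJoin,
        false_and, false_or, not_false_eq_true, true_and]
      simp only [Set.mem_empty_iff_false, imp_false, and_comm]
    · have e2 : (S ∪ A) \ A = S \ A := by ext x; simp; tauto
      rw [mem_cone, Finset.erase_insert hS]
      simp only [Finset.erase_insert hS, mem_joinBd, mem_sd, h, mem_simplexJoin, e2,
        Finset.mem_insert_self, true_and, not_true, false_and, or_false,
        Finset.subset_insert_iff_of_notMem hwA]
      simp only [Set.mem_empty_iff_false, imp_false, and_comm]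
  rw [e]
  refine .step (hQ.simplexJoin A) (by simpa [mem_simplexJoin] using hQ.empty_mem) hAn ?_
    (hwQ.simplexJoin hwA) (hwQ.joinBd hwA)
  intro h'
  have := h'.2 subset_rfl
  rw [h] at this
  exact this

/-- For a simplex `Q`, the complex `joinBd A Q` is the boundary of the simplex `A ⋆ Q`, and the
cone over it is the subdivision of this simplex. -/
theorem conical_fullSimplex [Infinite α] (hs : s.Nonempty) (hAs : Disjoint A s) :
    Conical A (fullSimplex s) := by
  obtain ⟨w, hwA⟩ := Infinite.exists_notMem_finset (A ∪ s)
  rw [Finset.mem_union, not_or] at hwA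
  have hQ := isCx_fullSimplex s
  have hwQ : Fresh w (fullSimplex s) := fun T hT hwT => hwA.2 (hT hwT)
  refine ⟨w, hwA.1, hwQ, ?_⟩
  have hsT : ∀ T : Finset α, s ⊆ T \ A ↔ s ⊆ T := fun T => by
    rw [Finset.subset_sdiff]; exact and_iff_left hAs.symm
  have hm : ∀ T, T ∈ joinBd A (fullSimplex s) ↔ T \ A ⊆ s ∧ ¬ A ∪ s ⊆ T := by
    intro T
    rw [mem_joinBd, bd_fullSimplex, mem_fullSimplex, mem_properFaces, Finset.ssubset_def, hsT,
      Finset.union_subset_iff]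
    tauto
  have e : cone w (joinBd A (fullSimplex s)) = sd (A ∪ s) w (simplexJoin A (fullSimplex s)) := by
    refine ext_insert w ?_ ?_ <;> intro S hS
    · simp only [mem_cone_of_notMem hS, hm, mem_sd, hS, mem_simplexJoin, mem_fullSimplex,
        false_and, false_or, not_false_eq_true, true_and, and_comm]
    · have e2 : (S ∪ (A ∪ s)) \ A ⊆ s ↔ S \ A ⊆ s := by
        rw [← Finset.union_assoc, Finset.union_sdiff_distrib, Finset.union_subset_iff]
        constructor
        · rintro ⟨h, -⟩
          exact (Finset.sdiff_subset_sdiff Finset.subset_union_left subset_rfl).trans h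
        · intro h
          refine ⟨?_, Finset.sdiff_subset⟩
          rwa [Finset.union_sdiff_right]
      rw [mem_cone, Finset.erase_insert hS]
      simp only [Finset.erase_insert hS, hm, mem_sd, mem_simplexJoin, mem_fullSimplex, e2,
        Finset.mem_insert_self, true_and, not_true, false_and, or_false,
        Finset.subset_insert_iff_of_notMem (a := w) (s := A ∪ s) (by simp [hwA]), and_comm]
  rw [e]
  refine .step (hQ.simplexJoin A) ?_ (hs.mono Finset.subset_union_right) ?_
    (hwQ.simplexJoin hwA.1) (hwQ.joinBd hwA.1)
  · rw [mem_simplexJoin, mem_fullSimplex, Finset.union_sdiff_left]; exact Finset.sdiff_subset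
  · rw [hm]; exact fun h => h.2 subset_rfl

theorem sd_joinBd (hK : IsCx K) (hB : B ∈ K) (hBn : B.Nonempty) (hbK : Fresh b K)
    (hAB : Disjoint A B) (hb : b ∉ A) :
    sd B b (joinBd A K) = joinBd A (sd B b K) := by
  have h1 : ∀ T : Finset α, B ⊆ T \ A ↔ B ⊆ T := fun T => by
    rw [Finset.subset_sdiff]; exact and_iff_left hAB.symm
  ext T
  have h2 : (T \ A).erase b ∪ B = (T.erase b ∪ B) \ A := by
    rw [Finset.union_sdiff_distrib, Finset.sdiff_eq_self_of_disjoint hAB.symm,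
      Finset.erase_sdiff_comm]
  have h3 : A ⊆ T.erase b ∪ B ↔ A ⊆ T := by
    constructor
    · intro h
      exact (hAB.left_le_of_le_sup_right h).trans (Finset.erase_subset _ _)
    · intro h
      exact (Finset.subset_erase.2 ⟨h, hb⟩).trans Finset.subset_union_left
  simp only [mem_joinBd, bd_sd hK hBn hB hbK]
  simp only [mem_sd, mem_joinBd, h1, h2, h3, Finset.mem_sdiff, hb, not_false_eq_true, and_true]
  tauto

end

/-! ### A ball is a cone over its boundary, up to equivalence relative to the boundary -/

section

variable {α : Type*} [DecidableEq α]
variable {F G J J' K K' L M Q Q' : Set (Finset α)} {A B C T X Y s t : Finset α}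
  {a b c v w x : α} {d e : ℕ}

theorem setOf_union_mem_simplexJoin (hAB : Disjoint A B) :
    {T | B ∪ T ∈ simplexJoin A K} = simplexJoin (A ∪ B) (lk B K) := by
  ext T
  have h1 : (B ∪ T) \ A = B ∪ T \ (A ∪ B) := by
    ext x
    have : x ∈ A → x ∉ B := fun h => Finset.disjoint_left.1 hAB h
    simp; tauto
  have h2 : Disjoint B (T \ (A ∪ B)) :=
    (Finset.disjoint_sdiff (s := A ∪ B)).mono_left Finset.subset_union_right
  simp only [Set.mem_ofPred_eq, mem_simplexJoin, mem_lk, h1, h2, true_and]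

theorem starBd_simplexJoin (hAB : Disjoint A B) :
    starBd B (simplexJoin A K) (joinBd A K) = joinBd (A ∪ B) (lk B K) := by
  ext T
  have h0 := Set.ext_iff.1 (setOf_union_mem_simplexJoin (K := K) hAB) T
  rw [Set.mem_ofPred_eq] at h0
  rw [mem_starBd, h0, mem_joinBd, mem_joinBd, bd_lk, mem_simplexJoin]
  refine and_congr_right fun hT => ?_
  have h2 : Disjoint B (T \ (A ∪ B)) :=
    (Finset.disjoint_sdiff (s := A ∪ B)).mono_left Finset.subset_union_right
  rw [Finset.union_subset_iff, mem_lk]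
  constructor
  · rintro h ⟨hA, hB⟩
    have h1 : B ∪ T \ (A ∪ B) = T \ A := by
      ext x
      have : x ∈ A → x ∉ B := fun h => Finset.disjoint_left.1 hAB h
      have := @hB x
      simp; tauto
    rw [h1]
    exact ⟨h2, (h hB).2 hA⟩
  · intro h hB
    have h1 : B ∪ T \ (A ∪ B) = T \ A := by
      ext x
      have : x ∈ A → x ∉ B := fun h => Finset.disjoint_left.1 hAB h
      have := @hB x
      simp; tauto
    rw [h1] at h
    rw [mem_lk, h1] at hT
    exact ⟨hT.2, fun hA => (h ⟨hA, hB⟩).2⟩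

/-- The property `Conical A` passes through a move in both directions, if it holds for the link of
the subdivided simplex `B`. From `K` to its subdivision one subdivides along; for the converse, the
filling replaces the subdivision of `joinBd A K`. -/
theorem conical_sd_iff [Infinite α] (hK : IsCx K) (hbd : IsCx (bd K)) (hB : B ∈ K)
    (hBn : B.Nonempty) (hb : Fresh b K) (hA : Away A K) (hbA : b ∉ A)
    (hlk : Conical (A ∪ B) (lk B K)) : Conical A K ↔ Conical A (sd B b K) := by
  have hAB : Disjoint A B := hA.disjoint hB
  have hK1 := hK.sd hBn b
  have hL : IsCx (joinBd A K) := isCx_joinBd hK (Or.inl hbd)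
  have eL := sd_joinBd hK hB hBn hb hAB hbA
  have hL1 : IsCx (joinBd A (sd B b K)) := by rw [← eL]; exact hL.sd hBn b
  have eJ := sd_simplexJoin (Q := K) hAB hbA
  have hJ := hK.simplexJoin A
  have hBJ : B ∈ simplexJoin A K := by
    rw [mem_simplexJoin, Finset.sdiff_eq_self_of_disjoint hAB.symm]; exact hB
  have hbJ := hb.simplexJoin hbA
  have hbL : Fresh b (joinBd A K) := hb.joinBd hbA
  obtain ⟨w, hw, hwK⟩ := exists_fresh hK.fin (insert b (A ∪ B))
  simp only [Finset.mem_insert, Finset.mem_union, not_or] at hw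
  obtain ⟨hwb, hwA, hwB⟩ := hw
  have hwL : Fresh w (joinBd A K) := hwK.joinBd hwA
  have hwK1 : Fresh w (sd B b K) := hwK.sd hwb
  have iff1 : Conical A K ↔ RelEquiv (joinBd A K) (simplexJoin A K) (cone w (joinBd A K)) :=
    ⟨fun h => h.forall hL hwA hwK, fun h => ⟨w, hwA, hwK, h⟩⟩
  have iff2 : Conical A (sd B b K) ↔ RelEquiv (joinBd A (sd B b K)) (simplexJoin A (sd B b K))
      (cone w (joinBd A (sd B b K))) :=
    ⟨fun h => h.forall hL1 hwA hwK1, fun h => ⟨w, hwA, hwK1, h⟩⟩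
  rw [iff1, iff2, ← eL, ← eJ]
  by_cases hBL : B ∈ joinBd A K
  · have eC : sd B b (cone w (joinBd A K)) = cone w (sd B b (joinBd A K)) :=
      sd_simplexJoin (by simpa using hwB) (by simpa using (Ne.symm hwb))
    rw [← eC]
    have hbC : Fresh b (cone w (joinBd A K)) := hbL.cone (Ne.symm hwb)
    constructor
    · intro h
      exact h.sd hL hJ hBL hBn hBJ hbL hbJ hbC
    · intro h
      have h1 := relEquiv_sd_union_filling hL hBL hBn hbL (hJ.sd hBn b) h
      have hLJ : joinBd A K ⊆ simplexJoin A K := fun T hT => hT.1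
      have hC : RelEquiv (joinBd A K) (cone w (joinBd A K))
          (sd B b (cone w (joinBd A K)) ∪ filling B b (joinBd A K)) :=
        filling_of_cone (hL.simplexJoin _) hBL hbL hbC hwL hwb fun T _ => mem_cone
      obtain ⟨w', hw', hwK'⟩ := exists_fresh hK.fin (insert b (A ∪ B))
      simp only [Finset.mem_insert, Finset.mem_union, not_or] at hw'
      obtain ⟨hwb', hwA', hwB'⟩ := hw'
      have hwL' : Fresh w' (joinBd A K) := hwK'.joinBd hwA'
      have hSt : IsCx (joinBd (A ∪ B) (lk B K)) := by
        refine isCx_joinBd (hK.lk hB) ?_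
        rw [bd_lk]
        by_cases hBb : B ∈ bd K
        · exact Or.inl (hbd.lk hBb)
        · refine Or.inr ⟨?_, hBn.mono Finset.subset_union_right⟩
          rw [Set.eq_empty_iff_forall_notMem]
          exact fun T hT => hBb (hbd.down hT.2 Finset.subset_union_left)
      -- the hypothesis on the link turns the star of `B` into a cone, as the filling requires
      have h3 : RelEquiv (joinBd A K) (simplexJoin A K)
          (cone w' (starBd B (simplexJoin A K) (joinBd A K)) ∪
            {T ∈ simplexJoin A K | ¬ B ⊆ T}) := by
        refine star_replace hJ hBn ?_ hL (fun T hT _ _ => hT) (hwK'.simplexJoin hwA') hwL' ?_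
        · rwa [starBd_simplexJoin hAB]
        · rw [starBd_simplexJoin hAB, setOf_union_mem_simplexJoin hAB]
          exact hlk.forall hSt (by simp [hwA', hwB']) (hwK'.mono (lk_subset hK))
      have hbSt : Fresh b (starBd B (simplexJoin A K) (joinBd A K)) := fun T hT hbT =>
        hbJ _ hT.1 (Finset.mem_union_right _ hbT)
      have h4 := filling_of_relEquiv_cone hJ hL hBL hLJ hBn hbJ (h3.isCx_iff.1 hJ)
        (fresh_union.2 ⟨hbSt.cone (Ne.symm hwb'), hbJ.mono fun T hT => hT.1⟩) hwL' hwb' (by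
          intro T hBT
          have hBT' : B ⊆ T.erase w' := Finset.subset_erase.2 ⟨hBT, hwB'⟩
          have : T.erase w' ∈ joinBd A K → T.erase w' ∈ simplexJoin A K := fun h => hLJ h
          simp only [Set.mem_union, mem_cone, mem_starBd, Finset.union_eq_right.2 hBT',
            Set.mem_ofPred_eq, hBT, hBT', not_true, and_false, or_false, true_imp_iff]
          tauto) h3
      exact h4.trans (h1.trans hC.symm)
  · rw [sd_of_notMem hL.down hBL hbL]
    have h1 : RelEquiv (joinBd A K) (simplexJoin A K) (sd B b (simplexJoin A K)) :=
      .step hJ hBJ hBn hBL hbJ hbL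
    exact ⟨fun h => h1.symm.trans h, fun h => h1.trans h⟩

/-- For a ball `Q` the join `A ⋆ Q` can be transformed into a cone, by induction on the dimension
of `Q` and along a chain of moves from a simplex to `Q`. -/
theorem Ball.conical [Infinite α] (h : Ball d Q) (hA : Away A Q) : Conical A Q := by
  induction d using Nat.strong_induction_on generalizing A Q with
  | _ d ih =>
  obtain ⟨s, hs, hsn, hsA, h1⟩ := h.exists_away A
  have hss := away_fullSimplex hsA
  have h2 := h1.avoid h.isCx hA hss
  have hF := isCx_fullSimplex A
  have hAF : A ∈ fullSimplex A := mem_fullSimplex.2 subset_rfl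
  refine (h2.invariant (P := fun K => Ball d K → Away A K → Conical A K) ?_).2
    (fun _ _ => conical_fullSimplex hsn hsA) h hA
  intro K B b hK hB hBn hBF hb hbF
  have hst : RelEquiv (fullSimplex A) K (sd B b K) := .step hK hB hBn hBF hb hbF
  have hst0 : RelEquiv ∅ K (sd B b K) := hst.mono (Set.empty_subset _)
  have hbA : b ∉ A := hbF A hAF
  have key : Ball d K → Away A K → (Conical A K ↔ Conical A (sd B b K)) := by
    intro hKb hKA
    refine conical_sd_iff hK hKb.isCx_bd hB hBn hb hKA hbA ?_
    obtain ⟨e, he, h3⟩ := linkProperty d K B (Or.inl hKb) hB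
    have hpos := Finset.card_pos.2 hBn
    have haw : Away (A ∪ B) (lk B K) := by
      intro x hx
      rcases Finset.mem_union.1 hx with hx | hx
      · exact (hKA x hx).mono (lk_subset hK)
      · exact fun T hT hxT => Finset.disjoint_left.1 hT.1 hx hxT
    rcases h3 with h3 | h3
    · exact ih e (by omega) h3 haw
    · exact conical_of_bd_eq_empty h3.isCx h3.bd_eq_empty (hBn.mono Finset.subset_union_right)
  constructor
  · intro hc hKb hKA
    have hKb' := hKb.of_equiv hst0
    have hKA' := hst.symm.away hF hAF (hK.sd hBn b) hKA
    exact (key hKb' hKA').1 (hc hKb' hKA')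
  · intro hc hKb hKA
    exact (key hKb hKA).2 (hc (hKb.of_equiv hst0.symm) (hst.away hF hAF hK hKA))

theorem simplexJoin_empty : simplexJoin ∅ Q = Q := by ext T; simp [mem_simplexJoin]

theorem joinBd_empty : joinBd ∅ Q = bd Q := by
  ext T; simp only [mem_joinBd, Finset.sdiff_empty, Finset.empty_subset, true_imp_iff]
  exact and_iff_right_of_imp fun h => bd_subset h

/-- A ball can be transformed, relative to its boundary, into a cone over its boundary. -/
theorem Ball.relEquiv_cone_bd [Infinite α] (h : Ball d Q) (hw : Fresh w Q) :
    RelEquiv (bd Q) Q (cone w (bd Q)) := by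
  have h1 := (h.conical (A := ∅) fun x hx => by simp at hx).forall
    (isCx_joinBd h.isCx (Or.inl h.isCx_bd)) (by simp) hw
  rwa [simplexJoin_empty, joinBd_empty] at h1

end

/-! ### Spheres of the same dimension are not nested -/

section

variable {α : Type*} [DecidableEq α]
variable {F G J J' K K' L M Q Q' R S : Set (Finset α)} {A B C T X Y s t : Finset α}
  {a b c v w x : α} {d e : ℕ}

theorem Sphere.exists_lk [Infinite α] (h : Sphere d S) (hX : X ∈ S) :
    ∃ e, d = e + X.card ∧ Sphere e (lk X S) := by
  obtain ⟨e, he, h1⟩ := linkProperty d S X (Or.inr h) hX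
  refine ⟨e, he, h1.sphere_of_notMem_bd ?_⟩
  rw [h.bd_eq_empty]; exact Set.notMem_empty _

theorem Sphere.eq_of_zero [Infinite α] (h : Sphere 0 S) : S = {∅} := by
  ext T
  rw [Set.mem_singleton_iff]
  constructor
  · intro hT
    obtain ⟨e, he, -⟩ := h.exists_lk hT
    exact Finset.card_eq_zero.1 (by omega)
  · rintro rfl
    exact h.isCx.empty_mem

theorem Sphere.ne_singleton_empty (h : Sphere (d + 1) S) : S ≠ {∅} := by
  obtain ⟨s, hs, h1⟩ := h
  rw [Ne, h1.invariant (P := fun K => K = {∅}) ?_]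
  · intro h
    obtain ⟨v, hv⟩ := Finset.card_pos.1 (show 0 < s.card by omega)
    have : {v} ∈ properFaces s := by
      refine mem_properFaces.2 ⟨by simpa using hv, fun h => ?_⟩
      have := Finset.card_le_card h
      rw [Finset.card_singleton] at this
      omega
    rw [h] at this
    simp at this
  · intro K A a hK hA hAn _ ha _
    constructor
    · rintro rfl
      exact absurd hA hAn.ne_empty
    · intro h
      have h2 : {a} ∈ sd A a K := by
        refine ⟨fun h => ?_, Or.inl ⟨by simp, by simpa using hA⟩⟩
        rw [hAn.subset_singleton_iff] at h
        exact ha A hA (by simp [h])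
      rw [h] at h2
      simp at h2

/-- A 0-sphere consists of two points and the empty simplex. -/
theorem Sphere.ncard_of_one [Infinite α] (h : Sphere 1 S) : S.ncard = 3 := by
  obtain ⟨s, hs, h1⟩ := id h
  refine (h1.invariant (P := fun K => Sphere 1 K → K.ncard = 3) ?_).2 (fun _ => ?_) h
  · intro K A a hK hA hAn _ ha _
    have h2 : RelEquiv ∅ K (sd A a K) := .step hK hA hAn (by simp) ha (fun T hT => by simp at hT)
    have key : Sphere 1 K → (sd A a K).ncard = K.ncard := by
      intro hS
      obtain ⟨e, he, -⟩ := hS.exists_lk hA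
      have := Finset.card_pos.2 hAn
      obtain ⟨v, rfl⟩ := Finset.card_eq_one.1 (show A.card = 1 by omega)
      have hva : v ≠ a := fun h => ha _ hA (by simp [h])
      rw [sd_singleton_eq_image ha hA]
      refine Set.InjOn.ncard_image (Set.LeftInvOn.injOn
        (f₁' := Finset.image fun x => if x = a then v else x) fun T hT => ?_)
      rw [Finset.image_image]
      conv_rhs => rw [← Finset.image_id (s := T)]
      refine Finset.image_congr fun x hx => ?_
      have hxa : x ≠ a := fun h => ha _ hT (h ▸ hx)
      by_cases hxv : x = v <;> simp [hxv, hxa]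
    constructor
    · intro h3 h4
      have h5 := h4.of_equiv h2
      rw [key h5, h3 h5]
    · intro h3 h4
      rw [← key h4, h3 (h4.of_equiv h2.symm)]
  · have : properFaces s = (s.ssubsets : Set (Finset α)) := by
      ext T
      rw [mem_properFaces, Finset.mem_coe, Finset.mem_ssubsets]
    rw [this, Set.ncard_coe_finset, Finset.ssubsets, Finset.card_erase_of_mem (by simp),
      Finset.card_powerset, hs]
    norm_num

/-- The edges of `K` connect all its vertices: a predicate that propagates along edges holds for
all vertices or for none. Degenerate edges `{u, u}` are allowed, which does no harm. -/
def Connected (K : Set (Finset α)) : Prop :=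
  ∀ f : α → Prop, (∀ u v, {u, v} ∈ K → f u → f v) → ∀ u v, {u} ∈ K → {v} ∈ K → f u → f v

theorem connected_sd_iff (hK : IsCx K) (hA : A ∈ K) (hAn : A.Nonempty) (ha : Fresh a K) :
    Connected K ↔ Connected (sd A a K) := by
  have haA := ha A hA
  -- `ρ` sends the vertices of `K` to vertices of the subdivision; it moves a vertex only if that
  -- vertex is `A`
  obtain ⟨ρ, hρ⟩ : ∃ ρ : α → α, ∀ u, (A = {u} ∧ ρ u = a) ∨ (A ≠ {u} ∧ ρ u = u) :=
    ⟨fun u => if A = {u} then a else u, fun u => by by_cases h : A = {u} <;> simp [h]⟩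
  have hva : ∀ v, {v} ∈ K → v ≠ a := fun v hv h => ha _ hv (by simp [h])
  have hρm : ∀ u, {u} ∈ K → {ρ u} ∈ sd A a K := by
    intro u hu
    rcases hρ u with ⟨h1, h2⟩ | ⟨h1, h2⟩ <;> rw [h2]
    · refine ⟨fun h => ?_, Or.inl ⟨by simp, by simpa using hA⟩⟩
      rw [hAn.subset_singleton_iff] at h; simp [h] at haA
    · exact ⟨fun h => h1 (hAn.subset_singleton_iff.1 h), Or.inr ⟨ha _ hu, hu⟩⟩
  have hpair : ∀ x, insert x A ∈ K → A ≠ {x} → ({a, x} : Finset α) ∈ sd A a K := by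
    intro x hx hAx
    refine ⟨fun h => hAx ?_, Or.inl ⟨by simp, ?_⟩⟩
    · rw [Finset.subset_insert_iff_of_notMem haA, hAn.subset_singleton_iff] at h
      exact h
    · rw [Finset.erase_insert (by simp; rintro rfl; exact ha _ hx (by simp))]
      exact hx
  have hdown : ∀ {u v : α}, ({u, v} : Finset α) ∈ K → {u} ∈ K ∧ {v} ∈ K := fun h =>
    ⟨hK.down h (by simp), hK.down h (by simp)⟩
  constructor
  · intro h f hf
    have hf' : ∀ u v, {u, v} ∈ sd A a K → f v → f u := fun u v h =>
      hf v u (by rwa [Finset.pair_comm])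
    have hg : ∀ u v, {u, v} ∈ K → f (ρ u) → f (ρ v) := by
      intro u v huv
      by_cases huv' : u = v
      · rw [huv']; exact id
      by_cases hAe : A ⊆ {u, v}
      · rcases hρ u with ⟨h1, h2⟩ | ⟨h1, h2⟩ <;> rcases hρ v with ⟨h3, h4⟩ | ⟨h3, h4⟩ <;>
          rw [h2, h4]
        · exact id
        · apply hf
          refine hpair v ?_ h3
          rwa [h1, Finset.pair_comm]
        · apply hf'
          refine hpair u ?_ h1
          rwa [h3]
        · have hvA : v ∈ A := by
            by_contra hv
            rw [Finset.pair_comm, Finset.subset_insert_iff_of_notMem hv,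
              hAn.subset_singleton_iff] at hAe
            exact h1 hAe
          have huA : u ∈ A := by
            by_contra hv
            rw [Finset.subset_insert_iff_of_notMem hv, hAn.subset_singleton_iff] at hAe
            exact h3 hAe
          exact fun h => hf _ _ (hpair v (by rwa [Finset.insert_eq_of_mem hvA]) h3)
            (hf' _ _ (hpair u (by rwa [Finset.insert_eq_of_mem huA]) h1) h)
      · have hu := (hρ u).resolve_left fun h => hAe (by rw [h.1]; simp)
        have hv := (hρ v).resolve_left fun h => hAe (by rw [h.1]; simp)
        rw [hu.2, hv.2]
        exact hf _ _ ⟨hAe, Or.inr ⟨ha _ huv, huv⟩⟩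
    have hv : ∀ v, {v} ∈ sd A a K → ∃ u, {u} ∈ K ∧ (f v ↔ f (ρ u)) := by
      intro v hv
      by_cases hav : v = a
      · subst hav
        obtain ⟨x, hx⟩ := hAn
        refine ⟨x, hK.down hA (by simpa using hx), ?_⟩
        rcases hρ x with ⟨h1, h2⟩ | ⟨h1, h2⟩ <;> rw [h2]
        have h3 := hpair x (by rwa [Finset.insert_eq_of_mem hx]) h1
        exact ⟨hf _ _ h3, hf' _ _ h3⟩
      · have hvK := (hv.2.resolve_left fun h => hav (Finset.mem_singleton.1 h.1).symm).2
        have hv' := (hρ v).resolve_left fun h => hv.1 (by rw [h.1])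
        exact ⟨v, hvK, by rw [hv'.2]⟩
    intro u v hu hv'
    obtain ⟨u', hu', hu''⟩ := hv u hu
    obtain ⟨v', hv'', hv'''⟩ := hv v hv'
    rw [hu'', hv''']
    exact h (fun u => f (ρ u)) hg u' v' hu' hv''
  · intro h f hf u v hu hv
    obtain ⟨x, hx⟩ := hAn
    have hg : ∀ u, {u} ∈ K → (Function.update f a (f x) (ρ u) ↔ f u) := by
      intro u hu
      rcases hρ u with ⟨h1, h2⟩ | ⟨h1, h2⟩ <;> rw [h2]
      · rw [h1, Finset.mem_singleton] at hx
        simp [hx]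
      · simp [Function.update_of_ne (hva u hu)]
    rw [← hg u hu, ← hg v hv]
    refine h _ ?_ _ _ (hρm u hu) (hρm v hv)
    have hxe : ∀ v, v ≠ a → {a, v} ∈ sd A a K → ({x, v} : Finset α) ∈ K := by
      intro v hv h
      refine hK.down (h.2.resolve_right fun h => h.1 (by simp)).2 ?_
      rw [Finset.erase_insert (by simpa using hv.symm)]
      simp [Finset.insert_subset_iff, hx]
    intro u v huv
    by_cases hua : u = a <;> by_cases hva : v = a
    · rw [hua, hva]; exact id
    · subst hua
      rw [Function.update_self, Function.update_of_ne hva]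
      exact hf _ _ (hxe v hva huv)
    · subst hva
      rw [Function.update_self, Function.update_of_ne hua]
      have := hxe u hua (by rwa [Finset.pair_comm])
      exact hf _ _ (by rwa [Finset.pair_comm])
    · rw [Function.update_of_ne hua, Function.update_of_ne hva]
      exact hf _ _ (huv.2.resolve_left fun h => by simp [Ne.symm hua, Ne.symm hva] at h).2

theorem Sphere.connected [Infinite α] (h : Sphere d S) (hd : 2 ≤ d) : Connected S := by
  obtain ⟨s, hs, h1⟩ := h
  refine (h1.invariant fun K A a hK hA hAn _ ha _ => connected_sd_iff hK hA hAn ha).2 ?_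
  intro f hf u v hu hv
  refine hf u v ?_
  rw [mem_properFaces] at *
  have h2 : ({u, v} : Finset α) ⊆ s := by
    have := hu.1; have := hv.1
    simp_all [Finset.insert_subset_iff]
  refine ⟨h2, fun h3 => ?_⟩
  have := Finset.card_le_card h3
  have := Finset.card_le_two (a := u) (b := v)
  omega

/-- A sphere in a sphere of the same dimension is all of it. By induction the links of the vertices
of `R` in `R` and in `S` agree, so the vertices of `R` are closed under adjacency in `S`. -/
theorem Sphere.eq_of_subset [Infinite α] (hR : Sphere d R) (hS : Sphere d S) (hRS : R ⊆ S) :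
    R = S := by
  induction d generalizing R S with
  | zero => rw [hR.eq_of_zero, hS.eq_of_zero]
  | succ d ih =>
  rcases Nat.eq_zero_or_pos d with rfl | hd
  · refine Set.eq_of_subset_of_ncard_le hRS ?_ hS.isCx.fin
    rw [hR.ncard_of_one, hS.ncard_of_one]
  have hlk : ∀ v, {v} ∈ R → lk {v} R = lk {v} S := by
    intro v hv
    obtain ⟨e, he, h1⟩ := hR.exists_lk hv
    obtain ⟨e', he', h2⟩ := hS.exists_lk (hRS hv)
    rw [Finset.card_singleton] at he he'
    obtain rfl : e = d := by omega
    obtain rfl : e' = e := by omega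
    exact ih h1 h2 fun T hT => ⟨hT.1, hRS hT.2⟩
  have hstar : ∀ v T, {v} ∈ R → T ∈ S → v ∈ T → T ∈ R := by
    intro v T hv hT hvT
    have h1 : T.erase v ∈ lk {v} S :=
      ⟨by simp, by rwa [← Finset.insert_eq, Finset.insert_erase hvT]⟩
    rw [← hlk v hv] at h1
    have := h1.2
    rwa [← Finset.insert_eq, Finset.insert_erase hvT] at this
  -- the vertices of `R` are closed under adjacency in the connected complex `S`
  obtain ⟨v₀, hv₀⟩ : ∃ v, {v} ∈ R := by
    by_contra! hne
    have h0 : R = {∅} := by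
      ext T
      rw [Set.mem_singleton_iff]
      constructor
      · intro hT
        by_contra hTn
        obtain ⟨v, hv⟩ := Finset.nonempty_iff_ne_empty.2 hTn
        exact hne v (hR.isCx.down hT (by simpa using hv))
      · rintro rfl; exact hR.isCx.empty_mem
    exact hR.ne_singleton_empty h0
  refine hRS.antisymm fun T hT => ?_
  rcases T.eq_empty_or_nonempty with rfl | ⟨v, hv⟩
  · exact hR.isCx.empty_mem
  · refine hstar v T ?_ hT hv
    refine hS.connected (by omega) (fun v => {v} ∈ R) ?_ v₀ v (hRS hv₀)
      (hS.isCx.down hT (by simpa using hv)) hv₀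
    intro u v huv hu
    exact hR.isCx.down (hstar u _ hu huv (by simp)) (by simp)

end

/-! ### Attaching a cone to a ball in the boundary -/

section

variable {α : Type*} [DecidableEq α]
variable {F G J J' K K' L M Q Q' R S : Set (Finset α)} {A B C T X Y s t : Finset α}
  {a b c u v w x : α} {d e : ℕ}

/-- Subdivision as an operation on families commutes with unions, without any condition on `A`. -/
theorem sd_union_sd (A : Finset α) (a : α) (K L : Set (Finset α)) :
    sd A a (K ∪ L) = sd A a K ∪ sd A a L := by
  ext T; simp only [mem_sd, Set.mem_union]; tauto

/-- The apex of an attached cone can be changed. -/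
theorem relEquiv_union_cone_cone [Infinite α] (hM : IsCx M) (hK : IsCx K) (hKM : K ⊆ M)
    (hv : Fresh v M) (hw : Fresh w M) : RelEquiv M (M ∪ cone v K) (M ∪ cone w K) := by
  have h1 := relEquiv_cone_cone hK (hv.mono hKM) (hw.mono hKM)
  have h2 := h1.extend hM (hK.simplexJoin _)
    (fun T hT h => (mem_cone_of_notMem (hw T hT)).1 h)
    (fun T hT h => (mem_cone_of_notMem (hv T hT)).1 h) hK hKM
  have h3 := h2.union hM subset_rfl
  rwa [Set.union_comm, Set.union_comm _ M] at h3

/-- A ball `K` of codimension one in the boundary of a manifold `M` is open in the boundary at the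
simplexes that are not in the boundary of `K`. -/
theorem lk_eq_lk_bd [Infinite α] (hM : Mfd (d + 1) M) (hK : Ball d K)
    (hKM : ∀ T ∈ K, T.Nonempty → T ∈ bd M) (hX : X ∈ K) (hXK : X ∉ bd K) (hXn : X.Nonempty) :
    lk X K = lk X (bd M) := by
  obtain ⟨e, he, h1⟩ := linkProperty d K X (Or.inl hK) hX
  have h1 := h1.sphere_of_notMem_bd hXK
  have hXM := hKM X hX hXn
  obtain ⟨e', he', h2⟩ := hM.lk (bd_subset hXM) hXn
  have h2 := h2.ball_of_mem_bd hXM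
  obtain rfl : e' = e + 1 := by omega
  have h3 := h2.sphere_bd
  rw [bd_lk] at h3
  exact h1.eq_of_subset h3 fun T hT => ⟨hT.1, hKM _ hT.2 (hXn.mono Finset.subset_union_left)⟩

/-- The star of `X` is the join of `X` with its link, and this is compatible with boundaries. -/
theorem starBd_bd : starBd X M (bd M) = joinBd X (lk X M) := by
  have h := starBd_simplexJoin (A := ∅) (B := X) (K := M) (Finset.disjoint_empty_left _)
  rwa [simplexJoin_empty, joinBd_empty, Finset.empty_union] at h

theorem subset_of_nonempty_mem_bd (hM : IsCx M) (hKM : ∀ T ∈ K, T.Nonempty → T ∈ bd M) :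
    K ⊆ M := by
  intro T hT
  rcases T.eq_empty_or_nonempty with rfl | h
  · exact hM.empty_mem
  · exact bd_subset (hKM T hT h)

/-- Let `u` be a vertex of a ball `K` in the boundary of `M` that does not lie in the boundary of
`K`. Then the star of `u` in `M` can be replaced, relative to `v ⋆ K`, by `u ⋆ w ⋆ lk (u, K)`. -/
theorem exists_cone_star [Infinite α] (hM : Mfd (d + 1) M) (hK : Ball d K)
    (hKM : ∀ T ∈ K, T.Nonempty → T ∈ bd M) (hu : {u} ∈ K) (huK : {u} ∉ bd K)
    (hv : Fresh v M) (W : Finset α) :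
    ∃ w M', w ∉ W ∧ w ≠ v ∧ Fresh w M ∧ RelEquiv (cone v K) M M' ∧
      (∀ S, u ∉ S → (insert u S ∈ M' ↔ S.erase w ∈ lk {u} K)) ∧
      (∀ T, u ∉ T → w ∉ T → T ∈ M' → T ∈ M) ∧ ∀ x, x ≠ w → Fresh x M → Fresh x M' := by
  have hun : ({u} : Finset α).Nonempty := by simp
  have huM := hKM _ hu hun
  obtain ⟨e, he, h1⟩ := hM.lk (bd_subset huM) hun
  have h1 := h1.ball_of_mem_bd huM
  have hlk := lk_eq_lk_bd hM hK hKM hu huK hun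
  have hKM' := subset_of_nonempty_mem_bd hM.1 hKM
  obtain ⟨w, hwW, hwM⟩ := exists_fresh hM.1.fin (insert u (insert v W))
  simp only [Finset.mem_insert, not_or] at hwW
  obtain ⟨hwu, hwv, hwW⟩ := hwW
  have hwu' : w ∉ ({u} : Finset α) := by simpa using hwu
  have hcx : IsCx (joinBd {u} (lk {u} M)) := isCx_joinBd h1.isCx (Or.inl h1.isCx_bd)
  have hcon : Conical {u} (lk {u} M) := h1.conical fun x hx T hT hxT =>
    Finset.disjoint_left.1 hT.1 hx hxT
  have hvu : v ≠ u := fun h => hv _ (bd_subset huM) (by simp [h])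
  have hj : ∀ T, T ∈ joinBd {u} (lk {u} M) → T ∈ M := fun T hT => by
    rw [← starBd_bd] at hT
    exact hM.1.down hT.1 Finset.subset_union_right
  refine ⟨w, cone w (joinBd {u} (lk {u} M)) ∪ {T ∈ M | ¬ {u} ⊆ T}, hwW, hwv, hwM, ?_, ?_, ?_, ?_⟩
  · rw [← starBd_bd] at *
    refine star_replace hM.1 hun hcx (hK.isCx.simplexJoin _) ?_ hwM ((hwM.mono hKM').cone hwv)
      ?_
    · intro T hT huT hTM
      rw [mem_cone_of_notMem (hv T hTM)] at hT
      exact hKM T hT (hun.mono huT)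
    · rw [starBd_bd] at *
      have := setOf_union_mem_simplexJoin (A := ∅) (B := {u}) (K := M)
        (Finset.disjoint_empty_left _)
      rw [simplexJoin_empty, Finset.empty_union] at this
      rw [this]
      exact hcon.forall hcx hwu' (hwM.mono (lk_subset hM.1))
  · intro S hS
    have e1 : (insert u S).erase w = insert u (S.erase w) := Finset.erase_insert_of_ne (Ne.symm hwu)
    have e2 : u ∉ S.erase w := fun h => hS (Finset.mem_of_mem_erase h)
    have e3 : insert u (S.erase w) \ {u} = S.erase w := by
      rw [Finset.sdiff_singleton_eq_erase, Finset.erase_insert e2]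
    rw [Set.mem_union, mem_cone, e1, mem_joinBd, e3, bd_lk, ← hlk]
    simp only [Finset.singleton_subset_iff, Finset.mem_insert_self, true_imp_iff,
      Set.mem_ofPred_eq, not_true, and_false, or_false]
    refine and_iff_right_of_imp fun h => ?_
    exact ⟨h.1, hKM' h.2⟩
  · rintro T huT hwT (h | h)
    · rw [mem_cone_of_notMem hwT] at h
      exact hj T h
    · exact h.1
  · intro x hxw hx
    exact fresh_union.2 ⟨Fresh.cone (fun T hT => hx T (hj T hT)) hxw, hx.mono fun T hT => hT.1⟩

/-- A cone over `K` can be attached to any manifold that contains the nonempty simplexes of `K` in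
its boundary, without changing the stellar equivalence class. -/
def Attachable (d : ℕ) (K : Set (Finset α)) : Prop :=
  ∀ M v, Mfd (d + 1) M → (∀ T ∈ K, T.Nonempty → T ∈ bd M) → Fresh v M →
    RelEquiv ∅ (M ∪ cone v K) M

/-- The apex may be chosen in dependence on the manifold. -/
theorem attachable_of_exists [Infinite α] (hK : IsCx K)
    (h : ∀ M, Mfd (d + 1) M → (∀ T ∈ K, T.Nonempty → T ∈ bd M) → ∃ v, Fresh v M ∧
      RelEquiv ∅ (M ∪ cone v K) M) : Attachable d K := by
  intro M v hM hKM hv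
  obtain ⟨w, hw, h1⟩ := h M hM hKM
  exact ((relEquiv_union_cone_cone hM.1 hK (subset_of_nonempty_mem_bd hM.1 hKM) hv hw).mono
    (Set.empty_subset _)).trans h1

theorem lk_cone (hv : Fresh v K) : lk {v} (cone v K) = K := by
  ext T
  rw [mem_lk, Finset.disjoint_singleton_left, ← Finset.insert_eq, mem_cone]
  constructor
  · rintro ⟨h1, h2⟩; rwa [Finset.erase_insert h1] at h2
  · exact fun h => ⟨hv T h, by rwa [Finset.erase_insert (hv T h)]⟩

/-- If the base `K = u ⋆ L` is a cone, one may assume that the star of `u` in `M` is `u ⋆ w ⋆ L`.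
Then attaching `v ⋆ u ⋆ L` amounts to renaming `u` as `v` and subdividing the edge `w ⋆ v` with the
new vertex `u`. -/
theorem attachable_cone [Infinite α] (hL : IsCx L) (hu : Fresh u L) (hK : Ball d (cone u L))
    (hbd : bd (cone u L) = L) : Attachable d (cone u L) := by
  refine attachable_of_exists hK.isCx fun M hM hKM => ?_
  have hKM' := subset_of_nonempty_mem_bd hM.1 hKM
  obtain ⟨v, hvu, hv⟩ := exists_fresh hM.1.fin {u}
  rw [Finset.mem_singleton] at hvu
  refine ⟨v, hv, ?_⟩
  obtain ⟨w, N, -, hwv, hwM, hMN, hN, -, hfr⟩ := exists_cone_star (u := u) hM hK hKM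
    (mem_cone.2 (by simpa using hL.empty_mem)) (by rw [hbd]; exact fun h => hu _ h (by simp)) hv ∅
  rw [lk_cone hu] at hN
  have hNcx := hMN.isCx_iff.1 hM.1
  have hvN := hfr v hwv.symm hv
  have hwL : Fresh w L := (hwM.mono hKM').mono (subset_cone hu)
  have huM : {u} ∈ M := hKM' (mem_cone.2 (by simpa using hL.empty_mem))
  have hwu : w ≠ u := fun h => hwM _ huM (by simp [h])
  have huN : {u} ∈ N := by
    have := (hN ∅ (by simp)).2 (by simpa using hL.empty_mem)
    simpa using this
  have huw : insert u {w} ∈ N := (hN {w} (by simpa using hwu.symm)).2 (by simpa using hL.empty_mem)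
  have hLN : ∀ S ∈ L, S ∈ N := fun S hS => by
    refine hNcx.down ((hN S (hu S hS)).2 ?_) (Finset.subset_insert _ _)
    rwa [Finset.erase_eq_of_notMem (hwL S hS)]
  have e : N ∪ cone v (cone u L) = sd {w, v} u (sd {u} v N) := by
    have hvN' : ∀ S, insert v S ∉ N := fun S h => hvN _ h (by simp)
    have huv := Ne.symm hvu
    have hwL' : ∀ S, S ∈ L ↔ w ∉ S ∧ S.erase w ∈ L := fun S => by
      constructor
      · exact fun h => ⟨hwL S h, hL.down h (Finset.erase_subset _ _)⟩
      · rintro ⟨h1, h2⟩; rwa [Finset.erase_eq_of_notMem h1] at h2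
    refine ext_insert₂ u v ?_ ?_ ?_ ?_ <;> intro S h1 h2
    · have := hLN S
      simp [mem_sd, mem_cone, h1, h2, Finset.insert_subset_iff]
      tauto
    · have e1 : (S ∪ {w, v}).erase v = insert w S := by
        ext x; by_cases hxv : x = v <;> simp [hxv, h2, hwv.symm]
      have e3 := hN (insert w S) (by simp [h1, hwu.symm])
      have e4 := hN S h1
      have e5 := hwL' S
      have e6 : (insert w S).erase w = S.erase w := by ext x; simp
      rw [e6] at e3
      have e7 : insert v S ∪ {w} = S ∪ {w, v} := by ext x; simp; tauto
      have e8 : u ∉ S ∪ {w, v} := by simp [h1, hwu.symm, huv]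
      have e9 : v ∉ insert u S := by simp [h2, hvu]
      simp only [mem_sd, Set.mem_union, mem_cone, Finset.erase_insert h1, Finset.mem_insert_self,
        Finset.insert_subset_iff, Finset.singleton_subset_iff, e8, e9, not_true, and_false,
        not_false_eq_true, true_and, false_and, or_false, e1, Finset.erase_eq_of_notMem, e4,
        Finset.mem_union, Finset.mem_singleton, Finset.mem_insert, or_true]
      rw [Finset.union_comm, ← Finset.insert_eq, e3]
      tauto
    · have e4 := hN S h1
      have e5 := hwL' S
      have e8 : u ∉ insert v S := by simp [h1, huv]
      simp only [mem_sd, Set.mem_union, mem_cone, Finset.erase_insert h2, Finset.mem_insert_self,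
        Finset.insert_subset_iff, Finset.singleton_subset_iff, e8, hvN' S, not_true, and_false,
        not_false_eq_true, true_and, false_and, or_false, false_or, and_true,
        Finset.erase_eq_of_notMem h1, Finset.mem_insert, hwv]
      rw [Finset.union_comm, ← Finset.insert_eq, e4]
      tauto
    · have e1 : ((insert u (insert v S)).erase u ∪ {w, v}).erase v = insert w S := by
        rw [Finset.erase_insert (by simp [h1, huv])]
        ext x; by_cases hxv : x = v <;> simp [hxv, h2, hwv.symm]
      have e3 := hN (insert w S) (by simp [h1, hwu.symm])
      have e5 := hwL' S
      have e6 : (insert w S).erase w = S.erase w := by ext x; simp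
      rw [e6] at e3
      have e8 : insert u (insert v S) ∉ N := fun h => hvN _ h (by simp)
      have e9 : u ∉ (insert u (insert v S)).erase u ∪ {w, v} := by simp [hwu.symm, huv]
      have e10 : ((insert u (insert v S)).erase v).erase u = S := by
        rw [Finset.insert_comm, Finset.erase_insert (by simp [h2, hvu]), Finset.erase_insert h1]
      simp only [mem_sd, Set.mem_union, mem_cone, e10, Finset.mem_insert_self,
        Finset.insert_subset_iff, Finset.singleton_subset_iff, e8, e9, not_true, and_false,
        not_false_eq_true, true_and, false_and, or_false, false_or, e1,
        Finset.mem_union, Finset.mem_singleton, Finset.mem_insert, or_true, hwu, hwv]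
      rw [Finset.union_comm, ← Finset.insert_eq, e3]
      tauto
  have h1 : RelEquiv ∅ (M ∪ cone v (cone u L)) (N ∪ cone v (cone u L)) :=
    (hMN.union (hK.isCx.simplexJoin _) subset_rfl).mono (Set.empty_subset _)
  rw [e] at h1
  have hN1 := hNcx.sd (A := {u}) (by simp) v
  have h2 : RelEquiv ∅ N (sd {u} v N) := .step hNcx huN (by simp) (by simp) hvN (fresh_empty _)
  have h3 : RelEquiv ∅ (sd {u} v N) (sd {w, v} u (sd {u} v N)) := by
    refine .step hN1 ?_ (by simp) (by simp) ?_ (fresh_empty _)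
    · refine ⟨by simp [hwu.symm, Ne.symm hvu], Or.inl ⟨by simp, ?_⟩⟩
      have : ({w, v} : Finset α).erase v ∪ {u} = insert u {w} := by
        ext x; by_cases hxv : x = v <;> simp [hxv, hwv.symm, hvu, or_comm]
      rwa [this]
    · exact fun T hT huT => hT.1 (by simpa using huT)
  exact h1.trans ((h2.trans h3).symm.trans (hMN.mono (Set.empty_subset _)).symm)

end

section

variable {α : Type*} [DecidableEq α]
variable {F G J J' K K' L M Q Q' R S : Set (Finset α)} {A B C T X Y s t : Finset α}
  {a b c u v w x : α} {d e : ℕ}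

theorem mem_sd_of_notMem (hL : IsCx L) (hA : A ∉ L) (ha : a ∉ T) (hT : T ∈ L) (hTK : T ∈ K) :
    T ∈ sd A a K := ⟨fun h => hA (hL.down hT h), Or.inr ⟨ha, hTK⟩⟩

/-- When a cone is attached to a manifold `M` along `K`, it may be assumed that a given simplex `A`
outside `K` is not a simplex of `M`; otherwise `M` is subdivided at `A`. -/
theorem exists_avoiding [Infinite α] (hK : IsCx K) (hM : Mfd (d + 1) M)
    (hKM : ∀ T ∈ K, T.Nonempty → T ∈ bd M) (hA : A ∉ K) (W : Finset α) :
    ∃ M', Mfd (d + 1) M' ∧ (∀ T ∈ K, T.Nonempty → T ∈ bd M') ∧ A ∉ M' ∧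
      RelEquiv ∅ M M' ∧ ∀ v, v ∉ A → Fresh v M → v ∈ W → Fresh v M' ∧
        RelEquiv ∅ (M ∪ cone v K) (M' ∪ cone v K) := by
  by_cases hAM : A ∈ M
  · have hAn := hK.nonempty_of_notMem hA
    have hKM' := subset_of_nonempty_mem_bd hM.1 hKM
    obtain ⟨c, hcW, hcM⟩ := exists_fresh hM.1.fin W
    have h1 : RelEquiv ∅ M (sd A c M) := .step hM.1 hAM hAn (by simp) hcM (fresh_empty _)
    refine ⟨sd A c M, hM.of_equiv h1.symm, fun T hT hTn => ?_, fun h => h.1 subset_rfl, h1,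
      fun v hvA hv hvW => ?_⟩
    · rw [bd_sd hM.1 hAn hAM hcM]
      exact mem_sd_of_notMem hK hA (hcM T (hKM' hT)) hT (hKM T hT hTn)
    · have hvc : v ≠ c := fun h => hcW (h ▸ hvW)
      refine ⟨hv.sd hvc, ?_⟩
      have hAc : A ∉ cone v K := by
        rwa [mem_cone_of_notMem hvA]
      have hcc : Fresh c (cone v K) := (hcM.mono hKM').cone hvc.symm
      have e : sd A c (M ∪ cone v K) = sd A c M ∪ cone v K :=
        sd_union (hK.simplexJoin _).down hAc hcc
      rw [← e]
      exact .step (hM.1.union (hK.simplexJoin _)) (Or.inl hAM) hAn (by simp)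
        (fresh_union.2 ⟨hcM, hcc⟩) (fresh_empty _)
  · exact ⟨M, hM, hKM, hAM, .refl _ _, fun v _ hv _ => ⟨hv, .refl _ _⟩⟩

/-- A subdivision of `K` extends to a subdivision of the manifold with the attached cone. -/
theorem Attachable.of_sd [Infinite α] (hK : IsCx K) (hA : A ∈ K) (hAn : A.Nonempty) (ha : Fresh a K)
    (h : Attachable d (sd A a K)) : Attachable d K := by
  refine attachable_of_exists hK fun M hM hKM => ?_
  obtain ⟨v, hvaA, hv⟩ := exists_fresh hM.1.fin (insert a A)
  rw [Finset.mem_insert, not_or] at hvaA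
  obtain ⟨hva, hvA⟩ := hvaA
  have haK : {a} ∉ K := (fresh_iff hK).1 ha
  obtain ⟨M', hM', hKM', haM', h1, h2⟩ := exists_avoiding hK hM hKM haK {v}
  obtain ⟨hv', h2⟩ := h2 v (by simpa using hva) hv (by simp)
  refine ⟨v, hv, ?_⟩
  rw [← fresh_iff hM'.1] at haM'
  have hAM' := hKM' A hA hAn
  have h3 : RelEquiv ∅ M' (sd A a M') :=
    .step hM'.1 (bd_subset hAM') hAn (by simp) haM' (fresh_empty _)
  have h4 : RelEquiv ∅ (M' ∪ cone v K) (sd A a (M' ∪ cone v K)) :=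
    .step (hM'.1.union (hK.simplexJoin _)) (Or.inl (bd_subset hAM')) hAn (by simp)
      (fresh_union.2 ⟨haM', ha.cone (Ne.symm hva)⟩) (fresh_empty _)
  have e : sd A a (M' ∪ cone v K) = sd A a M' ∪ cone v (sd A a K) := by
    rw [sd_union_sd]
    congr 1
    exact sd_simplexJoin (by simpa using hvA) (by simpa using Ne.symm hva)
  rw [e] at h4
  have h5 := h (sd A a M') v (hM'.of_equiv h3.symm) (fun T hT hTn => by
    rw [bd_sd hM'.1 hAn (bd_subset hAM') haM']
    obtain ⟨hT1, hT2⟩ := hT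
    refine ⟨hT1, hT2.imp (fun h => ⟨h.1, hKM' _ h.2 (hAn.mono Finset.subset_union_right)⟩)
      fun h => ⟨h.1, hKM' _ h.2 hTn⟩⟩) (hv'.sd hva)
  exact (h2.trans h4).trans (h5.trans (h1.trans h3).symm)

/-- The weld of the subdivision of `K` extends to the manifold, once the star of the vertex `a` has
been replaced by `a ⋆ w ⋆ lk (a, K')`, where `K'` is the subdivision of `K`; for the link of `a` in
`K'` is `∂A ⋆ lk (A, K)`. -/
theorem Attachable.sd [Infinite α] (hK : Ball d K) (hA : A ∈ K) (hAn : A.Nonempty) (ha : Fresh a K)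
    (hAb : A ∉ bd K) (h : Attachable d K) : Attachable d (sd A a K) := by
  have hKcx := hK.isCx
  have hK' : Ball d (Stellar.sd A a K) := hK.of_equiv
    (RelEquiv.step (F := ∅) hKcx hA hAn (by simp) ha (fresh_empty _)).symm
  refine attachable_of_exists hK'.isCx fun M₀ hM₀ hKM₀ => ?_
  have haA := ha A hA
  obtain ⟨v, hvW, hvKM⟩ := exists_fresh (hKcx.fin.union hM₀.1.fin) (insert a A)
  rw [Finset.mem_insert, not_or] at hvW
  obtain ⟨hva, hvA⟩ := hvW
  obtain ⟨hvK, hv₀⟩ := fresh_union.1 hvKM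
  refine ⟨v, hv₀, ?_⟩
  obtain ⟨M, hM, hKM, hAM, h1, h2⟩ := exists_avoiding hK'.isCx hM₀ hKM₀
    (fun h : A ∈ Stellar.sd A a K => h.1 subset_rfl) {v}
  obtain ⟨hv, h2⟩ := h2 v hvA hv₀ (by simp)
  refine h2.trans (.trans ?_ h1.symm)
  clear h1 h2 hvKM hv₀ hKM₀ hM₀
  have hbdK : bd (Stellar.sd A a K) = bd K := by
    rw [bd_sd hKcx hAn hA ha]
    exact sd_of_notMem hK.isCx_bd.down hAb (ha.mono bd_subset)
  have haK' : {a} ∈ Stellar.sd A a K := by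
    refine ⟨fun h => ?_, Or.inl ⟨by simp, by simpa using hA⟩⟩
    rw [hAn.subset_singleton_iff] at h
    exact haA (by simp [h])
  obtain ⟨w, N, hwW, hwv, hwM, hMN, hN, hN', hfr⟩ := exists_cone_star hM hK' hKM haK'
    (by rw [hbdK]; exact fun h => ha _ h.1 (by simp)) hv (insert a A)
  rw [Finset.mem_insert, not_or] at hwW
  obtain ⟨hwa, hwA⟩ := hwW
  have hNcx := hMN.isCx_iff.1 hM.1
  have hKM' := subset_of_nonempty_mem_bd hM.1 hKM
  have hAN : A ∉ N := fun h => hAM (hN' A haA hwA h)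
  have hNA : ∀ T ∈ N, ¬ A ⊆ T := fun T hT h => hAN (hNcx.down hT h)
  have hNa : ∀ S, a ∉ S → (insert a S ∈ N ↔ ¬ A ⊆ S ∧ (S ∪ A).erase w ∈ K) := by
    intro S hS
    have e1 : A ∪ S.erase w \ A = (S ∪ A).erase w := by
      ext x; by_cases hxw : x = w <;> simp [hxw, hwA]; tauto
    rw [hN S hS, lk_singleton_sd hA ha, mem_bdJoin, mem_lk, e1, Finset.subset_erase]
    have : Disjoint A (S.erase w \ A) := Finset.disjoint_sdiff
    tauto
  -- `P` is the complex whose subdivision at `A` is `N`; its simplexes above `A` form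
  -- `A ⋆ w ⋆ lk (A, K)`
  set P : Set (Finset α) := {T ∈ N | a ∉ T} ∪ {T | A ⊆ T ∧ T.erase w ∈ K} with hP
  have haP : Fresh a P := by
    refine fresh_union.2 ⟨fun T hT => hT.2, fun T hT haT => ha _ hT.2 ?_⟩
    simp [haT, Ne.symm hwa]
  have hAP : A ∈ P := Or.inr ⟨subset_rfl, by rwa [Finset.erase_eq_of_notMem hwA]⟩
  have hPN : Stellar.sd A a P = N := by
    refine ext_insert a ?_ ?_ <;> intro S hS
    · have := hNA S
      simp only [mem_sd, hS, false_and, false_or, not_false_eq_true, true_and, hP, Set.mem_union,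
        Set.mem_ofPred_eq, and_true]
      tauto
    · have h3 : S ∪ A ∉ N := fun h => hNA _ h Finset.subset_union_right
      simp only [mem_sd, Finset.mem_insert_self, true_and, not_true, false_and, or_false,
        Finset.erase_insert hS, Finset.subset_insert_iff_of_notMem haA, hNa S hS, hP, Set.mem_union,
        Set.mem_ofPred_eq, h3, false_or, Finset.subset_union_right]
  have hPcx : IsCx P := by
    refine ⟨Or.inl ⟨hNcx.empty_mem, by simp⟩, fun T U hT hUT => ?_, ?_⟩
    · rcases hT with hT | hT
      · exact Or.inl ⟨hNcx.down hT.1 hUT, fun h => hT.2 (hUT h)⟩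
      · by_cases hAU : A ⊆ U
        · exact Or.inr ⟨hAU, hKcx.down hT.2 (Finset.erase_subset_erase _ hUT)⟩
        · have haU : a ∉ U := fun h => haP T (Or.inr hT) (hUT h)
          refine Or.inl ⟨hNcx.down ((hNa U haU).2 ⟨hAU, hKcx.down hT.2 ?_⟩)
            (Finset.subset_insert _ _), haU⟩
          exact Finset.erase_subset_erase _ (Finset.union_subset hUT hT.1)
    · refine (hNcx.fin.union (hKcx.fin.union (hKcx.fin.image (insert w)))).subset fun T hT => ?_
      rcases hT with hT | hT
      · exact Or.inl hT.1
      · by_cases h : w ∈ T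
        · exact Or.inr (Or.inr ⟨_, hT.2, Finset.insert_erase h⟩)
        · have := hT.2
          rw [Finset.erase_eq_of_notMem h] at this
          exact Or.inr (Or.inl this)
  have hPst : RelEquiv ∅ P N := by
    rw [← hPN]
    exact .step hPcx hAP hAn (by simp) haP (fresh_empty _)
  have hPM : Mfd (d + 1) P := (hM.of_equiv hMN.symm).of_equiv hPst
  have hbdN : bd N = Stellar.sd A a (bd P) := by rw [← hPN, bd_sd hPcx hAn hAP haP]
  have hK'N : ∀ T ∈ Stellar.sd A a K, T.Nonempty → T ∈ bd N := fun T hT hTn => by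
    refine (hMN.mem_bd_iff (hK'.isCx.simplexJoin _).down ?_).1 (hKM T hT hTn)
    rwa [mem_cone_of_notMem (hv T (hKM' hT))]
  have hKP : ∀ T ∈ K, T.Nonempty → T ∈ bd P := by
    intro T hT hTn
    by_cases hAT : A ⊆ T
    · obtain ⟨x, hx⟩ := hAn
      have h3 := hK'N _ (insert_erase_mem_sd hA ha subset_rfl hT hAT hx) (by simp)
      rw [hbdN] at h3
      have h4 := (h3.2.resolve_right fun h => h.1 (by simp)).2
      have h5 : (insert a (T.erase x)).erase a ∪ A = T := by
        rw [Finset.erase_insert (fun h => ha T hT (Finset.mem_of_mem_erase h))]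
        ext y
        have := @hAT y
        have := @hAT x hx
        by_cases hyx : y = x <;> simp [hyx, hx]
        · exact this
        · tauto
      rwa [h5] at h4
    · have h3 := hK'N T ⟨hAT, Or.inr ⟨ha T hT, hT⟩⟩ hTn
      rw [hbdN] at h3
      exact (h3.2.resolve_left fun h => ha T hT h.1).2
  have hvP : Fresh v P := by
    refine fresh_union.2 ⟨(hfr v hwv.symm hv).mono fun T hT => hT.1, fun T hT hvT => hvK _ hT.2 ?_⟩
    simp [hvT, Ne.symm hwv]
  have h3 := h P v hPM hKP hvP
  have h4 : RelEquiv ∅ (P ∪ cone v K) (Stellar.sd A a (P ∪ cone v K)) :=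
    .step (hPcx.union (hKcx.simplexJoin _)) (Or.inl hAP) hAn (by simp)
      (fresh_union.2 ⟨haP, ha.cone (Ne.symm hva)⟩) (fresh_empty _)
  have e : Stellar.sd A a (P ∪ cone v K) = N ∪ cone v (Stellar.sd A a K) := by
    rw [sd_union_sd, hPN]
    congr 1
    exact sd_simplexJoin (by simpa using hvA) (by simpa using Ne.symm hva)
  rw [e] at h4
  have h5 : RelEquiv ∅ (M ∪ cone v (Stellar.sd A a K)) (N ∪ cone v (Stellar.sd A a K)) :=
    (hMN.union (hK'.isCx.simplexJoin _) subset_rfl).mono (Set.empty_subset _)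
  exact h5.trans (h4.symm.trans (h3.trans (hPst.trans (hMN.mono (Set.empty_subset _)).symm)))

/-- A cone over a ball of codimension one in the boundary of a manifold can be attached without
changing the stellar equivalence class: the ball is a cone over its boundary, up to moves off its
boundary. -/
theorem Ball.attachable [Infinite α] (h : Ball d K) : Attachable d K := by
  obtain ⟨u, -, hu⟩ := exists_fresh h.isCx.fin ∅
  have h1 := h.relEquiv_cone_bd hu
  have hb := h.isCx_bd
  refine (h1.invariant (P := fun K' => Ball d K' → bd K' = bd K → Attachable d K') ?_).2 ?_ h rfl
  · intro K' A a hK' hA hAn hAF ha haF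
    have h2 : RelEquiv (bd K) K' (Stellar.sd A a K') := .step hK' hA hAn hAF ha haF
    have h3 := h2.mono (Set.empty_subset _)
    constructor
    · intro h4 h5 h6
      have h7 := h5.of_equiv h3
      have h8 := (h2.bd_eq hb subset_rfl).2 h6
      exact (h4 h7 h8).sd h7 hA hAn ha (by rwa [h8])
    · intro h4 h5 h6
      exact .of_sd hK' hA hAn ha (h4 (h5.of_equiv h3.symm)
        ((h2.bd_eq hb subset_rfl).1 h6))
  · intro h2 h3
    exact attachable_cone hb (hu.mono bd_subset) h2 h3

end

/-! ### Deleting a simplex from a sphere -/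

section

variable {α : Type*} [DecidableEq α]
variable {F G J J' K K' L M Q Q' R S : Set (Finset α)} {A B C T X Y s t : Finset α}
  {a b c u v w x : α} {d e : ℕ}

theorem zmod_two_eq_one_of_ne_zero (z : ZMod 2) (h : z ≠ 0) : z = 1 := by
  revert h; revert z; decide

/-- The complex of the simplexes of `K` that do not contain `A`. -/
def del (A : Finset α) (K : Set (Finset α)) : Set (Finset α) := {T ∈ K | ¬ A ⊆ T}

theorem mem_del : T ∈ del A K ↔ T ∈ K ∧ ¬ A ⊆ T := Iff.rfl

theorem mem_del_singleton : T ∈ del {x} K ↔ T ∈ K ∧ x ∉ T := by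
  rw [mem_del, Finset.singleton_subset_iff]

theorem IsCx.del (hK : IsCx K) (hA : A.Nonempty) : IsCx (del A K) :=
  ⟨⟨hK.empty_mem, fun h => hA.ne_empty (Finset.subset_empty.1 h)⟩,
    fun _ _ hT hU => ⟨hK.down hT.1 hU, fun h => hT.2 (h.trans hU)⟩, hK.fin.subset fun _ h => h.1⟩

theorem fresh_del_singleton : Fresh x (del {x} K) := fun _ hT => (mem_del_singleton.1 hT).2

theorem deg_eq_one_of_bd_eq_empty (h : bd S = ∅) (hT : T ∈ S) : deg T S = 1 := by
  refine zmod_two_eq_one_of_ne_zero _ fun h0 => ?_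
  have : T ∈ bd S := ⟨hT, h0⟩
  rw [h] at this
  exact this

theorem deg_eq_deg_del_add (hS : S.Finite) (x : α) (T : Finset α) :
    deg T S = deg T (del {x} S) + deg (insert x T) S := by
  have h1 := deg_union (K := del {x} S) (L := {T ∈ S | x ∈ T}) (hS.subset fun _ h => h.1)
    (hS.subset fun _ h => h.1) T
  have e1 : del {x} S ∪ {T ∈ S | x ∈ T} = S := by
    ext U; simp only [Set.mem_union, mem_del_singleton, Set.mem_ofPred_eq]; tauto
  have e2 : del {x} S ∩ {T ∈ S | x ∈ T} = ∅ := by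
    ext U; simp only [Set.mem_inter_iff, mem_del_singleton, Set.mem_ofPred_eq,
      Set.mem_empty_iff_false]; tauto
  have e3 : deg T {T ∈ S | x ∈ T} = deg (insert x T) S := by
    unfold deg
    congr 2
    ext U
    simp only [Set.mem_ofPred_eq, Finset.insert_subset_iff]; tauto
  have e4 : deg T (∅ : Set (Finset α)) = 0 := by simp [deg]
  rwa [e1, e2, e3, e4, add_zero] at h1

/-- Deleting a vertex `x` of a closed complex creates the boundary `lk (x, S)`. -/
theorem mem_bd_del (hS : IsCx S) (h : bd S = ∅) (hT : T ∈ lk {x} S) : T ∈ bd (del {x} S) := by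
  have hxT : x ∉ T := by simpa using hT.1
  have hT1 : insert x T ∈ S := hT.2
  have hT2 : T ∈ S := hS.down hT1 (Finset.subset_insert _ _)
  refine ⟨mem_del_singleton.2 ⟨hT2, hxT⟩, ?_⟩
  have h1 := deg_eq_deg_del_add hS.fin x T
  rw [deg_eq_one_of_bd_eq_empty h hT1, deg_eq_one_of_bd_eq_empty h hT2] at h1
  simpa using h1.symm

/-- Deleting a nonempty simplex from a sphere of dimension `d - 1` leaves a ball. -/
def DelBall (α : Type*) [DecidableEq α] (d : ℕ) : Prop :=
  ∀ (S : Set (Finset α)) (A : Finset α), Sphere d S → A ∈ S → A.Nonempty → Ball d (del A S)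

theorem mfd_del [Infinite α] (H : ∀ e, d = e + 1 → DelBall α e) (hS : Sphere d S) :
    Mfd d (del {x} S) := by
  refine ⟨hS.isCx.del (by simp), fun y hy => ?_⟩
  obtain ⟨hy, hxy⟩ := mem_del_singleton.1 hy
  obtain ⟨e, he, h1⟩ := hS.exists_lk hy
  refine ⟨e, by simpa using he, ?_⟩
  have e1 : lk {y} (del {x} S) = del {x} (lk {y} S) := by
    ext T
    rw [Finset.mem_singleton] at hxy
    simp only [mem_lk, mem_del_singleton, Finset.mem_union, Finset.mem_singleton, hxy, false_or]
    tauto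
  rw [e1]
  by_cases hx : {x} ∈ lk {y} S
  · exact Or.inl (H e (by simpa using he) _ _ h1 hx (by simp))
  · have : del {x} (lk {y} S) = lk {y} S := by
      ext T
      rw [mem_del_singleton]
      exact and_iff_left_of_imp fun hT h => hx (h1.isCx.down hT (by simpa using h))
    rw [this]
    exact Or.inr h1

/-- A cone over a ball in the link of `x` can be attached to the complex that results by deleting
`x`. -/
theorem relEquiv_del_union_cone [Infinite α] (H : ∀ e, d = e + 1 → DelBall α e) (hS : Sphere d S)
    (hd : d = e + 1) (hK : Ball e K) (hKS : K ⊆ lk {x} S) (ha : Fresh a (del {x} S)) :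
    RelEquiv ∅ (del {x} S ∪ cone a K) (del {x} S) := by
  subst hd
  exact hK.attachable _ _ (mfd_del H hS)
    (fun T hT _ => mem_bd_del hS.isCx hS.bd_eq_empty (hKS hT)) ha

/-- Deleting `A` instead of one of its vertices `x` retains the cone `x ⋆ D`, where `D` results
from the link of `x` by deleting `A \ x`. -/
theorem ball_del_of_vertices [Infinite α] (H : ∀ e, d = e + 1 → DelBall α e) (hS : Sphere d S)
    (hv : ∀ v, {v} ∈ S → Ball d (del {v} S)) (hA : A ∈ S) (hAn : A.Nonempty) :
    Ball d (del A S) := by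
  obtain ⟨x, hx⟩ := id hAn
  have hxS := hS.isCx.down hA (Finset.singleton_subset_iff.2 hx)
  rcases (A.erase x).eq_empty_or_nonempty with h0 | hAx
  · rw [Finset.erase_eq_empty_iff] at h0
    rcases h0 with rfl | rfl
    · simp at hx
    · exact hv x hxS
  · obtain ⟨e, he, h1⟩ := hS.exists_lk hxS
    rw [Finset.card_singleton] at he
    have hAl : A.erase x ∈ lk {x} S :=
      ⟨by simp, by rwa [← Finset.insert_eq, Finset.insert_erase hx]⟩
    have h2 := H e he _ _ h1 hAl hAx
    have h3 := relEquiv_del_union_cone H hS he h2 (fun T hT => hT.1) (fresh_del_singleton (x := x))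
    have e1 : del {x} S ∪ cone x (del (A.erase x) (lk {x} S)) = del A S := by
      refine ext_insert x ?_ ?_ <;> intro T hT
      · have h4 : ¬ A ⊆ T := fun h => hT (h hx)
        rw [Set.mem_union, mem_del_singleton, mem_cone_of_notMem hT, mem_del, mem_del]
        have := fun h : T ∈ lk {x} S => lk_subset hS.isCx h
        tauto
      · have h4 : insert x T ∉ del {x} S := fun h => (mem_del_singleton.1 h).2 (by simp)
        rw [Set.mem_union, mem_cone, Finset.erase_insert hT, mem_del (A := A.erase x),
          mem_del (A := A), mem_lk, Finset.disjoint_singleton_left, ← Finset.insert_eq,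
          Finset.subset_insert_iff]
        tauto
    rw [← e1]
    exact (hv x hxS).of_equiv h3

theorem del_singleton_sd_self (ha : Fresh a S) : del {a} (sd A a S) = del A S := by
  ext T
  rw [mem_del_singleton, mem_sd, mem_del]
  constructor
  · tauto
  · exact fun h => ⟨⟨h.2, Or.inr ⟨ha T h.1, h.1⟩⟩, ha T h.1⟩

theorem del_singleton_sd_of_notMem (hv : v ∉ A) (hva : v ≠ a) :
    del {v} (sd A a S) = sd A a (del {v} S) := by
  ext T
  simp only [mem_del_singleton, mem_sd, Finset.mem_union, Finset.mem_erase, hv, or_false,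
    hva, ne_eq, not_false_eq_true, true_and]
  tauto

/-- If a vertex `v` of `A` is deleted from the subdivision at `A`, then in comparison with deleting
it from `S` a cone over `(A \ v) ⋆ lk (A, S)` is attached. -/
theorem del_singleton_sd_of_mem (hv : v ∈ A) (hva : v ≠ a) (ha : Fresh a S) (haA : a ∉ A)
    (hS : IsCx S) :
    del {v} (sd A a S) = del {v} S ∪ cone a (simplexJoin (A.erase v) (lk A S)) := by
  have hA : ∀ T, v ∉ T → ¬ A ⊆ T := fun T hT h => hT (h hv)
  have hE : ∀ T, T ∈ simplexJoin (A.erase v) (lk A S) ↔ v ∉ T ∧ T ∪ A ∈ S := by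
    intro T
    rw [mem_simplexJoin, mem_lk]
    have e1 : A ∪ T \ A.erase v = T ∪ A := by ext x; simp; tauto
    rw [e1]
    refine and_congr_left fun _ => ?_
    constructor
    · intro h hvT
      exact Finset.disjoint_left.1 h hv (by simp [hvT])
    · intro h
      rw [Finset.disjoint_left]
      intro x hx hx'
      rw [Finset.mem_sdiff, Finset.mem_erase] at hx'
      have : x = v := by tauto
      exact h (this ▸ hx'.1)
  refine ext_insert a ?_ ?_ <;> intro T hT
  · rw [mem_del_singleton, Set.mem_union, mem_del_singleton, mem_sd, mem_cone_of_notMem hT, hE]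
    have h1 := hA T
    constructor
    · tauto
    · rintro (h | h)
      · tauto
      · have h3 : T ∈ S := by
          exact hS.down h.2 Finset.subset_union_left
        tauto
  · have h1 : insert a T ∉ del {v} S := fun h => ha _ (mem_del_singleton.1 h).1 (by simp)
    have h2 : v ∈ insert a T ↔ v ∈ T := by simp [hva]
    rw [mem_del_singleton, Set.mem_union, mem_sd, mem_cone, hE, Finset.erase_insert hT, h2,
      Finset.subset_insert_iff_of_notMem haA]
    have h1 := hA T
    simp only [Finset.mem_insert_self, not_true, false_and, or_false, true_and]
    tauto

/-- The induction step: the claim for vertices is invariant under moves, given the claim in the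
preceding dimension. -/
theorem DelBall.succ [Infinite α] (H : ∀ e, d = e + 1 → DelBall α e) : DelBall α d := by
  suffices H' : ∀ S : Set (Finset α), Sphere d S → ∀ v, {v} ∈ S → Ball d (del {v} S) from
    fun S A hS hA hAn => ball_del_of_vertices H hS (H' S hS) hA hAn
  intro S hS
  obtain ⟨s, hs, h⟩ := id hS
  refine (h.invariant (P := fun S => Sphere d S → ∀ v, {v} ∈ S → Ball d (del {v} S)) ?_).2 ?_ hS
  · clear hS h hs s S
    intro S A a hS hA hAn _ ha _
    have hst : RelEquiv ∅ S (sd A a S) := .step hS hA hAn (by simp) ha (fresh_empty _)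
    have haA := ha A hA
    -- For `v ∉ A` deletion of `v` commutes with the subdivision; for `v ∈ A` the two deletions
    -- differ by a cone over a ball in the link of `v`.
    have key1 : ∀ v, v ∉ A → v ≠ a → (Ball d (del {v} S) ↔ Ball d (del {v} (sd A a S))) := by
      intro v hv hva
      rw [del_singleton_sd_of_notMem hv hva]
      have : RelEquiv ∅ (del {v} S) (sd A a (del {v} S)) :=
        .step (hS.del (by simp)) (mem_del_singleton.2 ⟨hA, hv⟩) hAn (by simp)
          (ha.mono fun T hT => hT.1) (fresh_empty _)
      exact ⟨fun h => h.of_equiv this.symm, fun h => h.of_equiv this⟩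
    have key2 : ∀ v, v ∈ A → A ≠ {v} → Sphere d S →
        (Ball d (del {v} S) ↔ Ball d (del {v} (sd A a S))) := by
      intro v hv hAv hSd
      have hva : v ≠ a := fun h => haA (h ▸ hv)
      rw [del_singleton_sd_of_mem hv hva ha haA hS]
      obtain ⟨e, he, h1⟩ := hSd.exists_lk hA
      have hAvn : (A.erase v).Nonempty := by
        rw [Finset.nonempty_iff_ne_empty, Ne, Finset.erase_eq_empty_iff]
        exact fun h => h.elim hAn.ne_empty hAv
      have h2 : Ball (e + (A.erase v).card) (simplexJoin (A.erase v) (lk A S)) :=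
        h1.simplexJoin hAvn fun x hx T hT hxT =>
          Finset.disjoint_left.1 hT.1 (Finset.mem_of_mem_erase hx) hxT
      have h3 := relEquiv_del_union_cone H hSd (x := v) (a := a) (by
        rw [he, ← Finset.card_erase_add_one hv, add_assoc]) h2 (by
          intro T hT
          rw [mem_simplexJoin, mem_lk] at hT
          constructor
          · rw [Finset.disjoint_singleton_left]
            intro hvT
            exact Finset.disjoint_left.1 hT.1 hv (by simp [hvT])
          · refine hS.down hT.2 ?_
            intro x
            simp only [Finset.mem_union, Finset.mem_singleton, Finset.mem_sdiff, Finset.mem_erase]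
            rintro (rfl | h)
            · exact Or.inl hv
            · tauto) (ha.mono fun T hT => hT.1)
      exact ⟨fun h => h.of_equiv h3, fun h => h.of_equiv h3.symm⟩
    constructor
    · intro h hS' v hv
      have hSd := hS'.of_equiv hst
      have h := h hSd
      by_cases hva : v = a
      · subst hva
        rw [del_singleton_sd_self ha]
        exact ball_del_of_vertices H hSd h hA hAn
      · have hvS := (hv.2.resolve_left fun h => hva (Finset.mem_singleton.1 h.1).symm).2
        have hAv : A ≠ {v} := fun h => hv.1 (by rw [h])
        by_cases hvA : v ∈ A
        · exact (key2 v hvA hAv hSd).1 (h v hvS)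
        · exact (key1 v hvA hva).1 (h v hvS)
    · intro h hSd v hv
      have h := h (hSd.of_equiv hst.symm)
      have hva : v ≠ a := fun h => ha _ hv (by simp [h])
      have haS : {a} ∈ sd A a S := by
        refine ⟨fun h => ?_, Or.inl ⟨by simp, by simpa using hA⟩⟩
        rw [hAn.subset_singleton_iff] at h
        exact haA (by simp [h])
      by_cases hAv : A = {v}
      · rw [← hAv, ← del_singleton_sd_self ha]
        exact h a haS
      · have hvS : {v} ∈ sd A a S :=
          ⟨fun h => hAv (hAn.subset_singleton_iff.1 h), Or.inr ⟨ha _ hv, hv⟩⟩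
        by_cases hvA : v ∈ A
        · exact (key2 v hvA hAv hSd).2 (h v hvS)
        · exact (key1 v hvA hva).2 (h v hvS)
  · intro _ v hv
    have hvs : v ∈ s := by simpa using (mem_properFaces.1 hv).1
    have h1 := Finset.card_erase_add_one hvs
    have h2 := Finset.card_lt_card (mem_properFaces.1 hv)
    rw [Finset.card_singleton] at h2
    have e1 : del {v} (properFaces s) = fullSimplex (s.erase v) := by
      ext T
      rw [mem_del_singleton, mem_properFaces, mem_fullSimplex, Finset.subset_erase,
        Finset.ssubset_iff_subset_ne]
      constructor
      · exact fun h => ⟨h.1.1, h.2⟩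
      · exact fun h => ⟨⟨h.1, by rintro rfl; exact h.2 hvs⟩, h.2⟩
    rw [e1]
    exact ⟨s.erase v, by omega, Finset.card_pos.1 (by omega), .refl _ _⟩

theorem Sphere.ball_del [Infinite α] (hS : Sphere d S) (hA : A ∈ S) (hAn : A.Nonempty) :
    Ball d (del A S) := by
  have (d : ℕ) : DelBall α d := by
    induction d with
    | zero => exact .succ (by simp)
    | succ d ih =>
      refine .succ fun e he S A hS hA hAn => ?_
      obtain rfl : e = d := by omega
      exact ih S A hS hA hAn
  exact this d S A hS hA hAn

end

/-! ### The complement of a ball in a sphere, and the union with a ball -/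

section

variable {α : Type*} [DecidableEq α]
variable {F G J J' K K' L M Q Q' R S : Set (Finset α)} {A B C T X Y s t : Finset α}
  {a b c u v w x : α} {d e : ℕ}

/-- The closure of the complement of `K` in `S`, if `K` is a ball in the sphere `S` of the same
dimension. -/
def closedCompl (S K : Set (Finset α)) : Set (Finset α) := {T ∈ S | T ∈ K → T ∈ bd K}

theorem union_closedCompl (hKS : K ⊆ S) : K ∪ closedCompl S K = S := by
  ext T
  have := @hKS T
  simp only [closedCompl, Set.mem_union, Set.mem_ofPred_eq]; tauto

theorem inter_closedCompl (hKS : K ⊆ S) : K ∩ closedCompl S K = bd K := by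
  ext T
  have := @hKS T
  have := @bd_subset _ _ K T
  simp only [closedCompl, Set.mem_inter_iff, Set.mem_ofPred_eq]; tauto

theorem Ball.isCx_closedCompl [Infinite α] (hK : Ball d K) (hS : Sphere d S) (hKS : K ⊆ S) :
    IsCx (closedCompl S K) := by
  refine ⟨⟨hS.isCx.empty_mem, fun _ => hK.isCx_bd.empty_mem⟩, fun T U hT hUT =>
    ⟨hS.isCx.down hT.1 hUT, fun hU => ?_⟩, hS.isCx.fin.subset fun _ h => h.1⟩
  by_contra hUb
  rcases U.eq_empty_or_nonempty with rfl | hUn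
  · exact hUb hK.isCx_bd.empty_mem
  obtain ⟨e, he, h1⟩ := linkProperty d K U (Or.inl hK) hU
  have h1 := h1.sphere_of_notMem_bd hUb
  obtain ⟨e', he', h2⟩ := hS.exists_lk (hKS hU)
  obtain rfl : e' = e := by omega
  have h3 := h1.eq_of_subset h2 fun T hT => ⟨hT.1, hKS hT.2⟩
  have h4 : T \ U ∈ lk U S :=
    ⟨Finset.disjoint_sdiff, by rw [Finset.union_sdiff_of_subset hUT]; exact hT.1⟩
  rw [← h3, mem_lk, Finset.union_sdiff_of_subset hUT] at h4
  exact hUb (hK.isCx_bd.down (hT.2 h4.2) hUT)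

/-- The complement of a ball in a sphere of the same dimension is a ball: if the ball is replaced
by a cone over its boundary, the complement results by deleting the apex. -/
theorem Ball.ball_closedCompl [Infinite α] (hK : Ball d K) (hS : Sphere d S) (hKS : K ⊆ S) :
    Ball d (closedCompl S K) := by
  have hC := hK.isCx_closedCompl hS hKS
  have hb := hK.isCx_bd
  have hbC : bd K ⊆ closedCompl S K := by rw [← inter_closedCompl hKS]; exact Set.inter_subset_right
  obtain ⟨u, -, hu⟩ := exists_fresh hS.isCx.fin ∅
  have huC : Fresh u (closedCompl S K) := hu.mono fun _ h => h.1
  have h1 := (hK.relEquiv_cone_bd (hu.mono hKS)).extend hC hK.isCx (fun T hT hT' => by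
    rwa [mem_cone_of_notMem (huC T hT)] at hT') (fun T hT hT' => hT.2 hT') hb hbC
  have h2 := h1.union hC subset_rfl
  rw [union_closedCompl hKS] at h2
  have h3 := hS.of_equiv (h2.mono (Set.empty_subset _)).symm
  have h4 := h3.ball_del (A := {u}) (Or.inl (mem_cone.2 (by simpa using hb.empty_mem))) (by simp)
  convert h4 using 1
  ext T
  rw [mem_del_singleton, Set.mem_union]
  constructor
  · exact fun h => ⟨Or.inr h, huC T h⟩
  · rintro ⟨h | h, huT⟩
    · rw [mem_cone_of_notMem huT] at h
      exact hbC h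
    · exact h

theorem Ball.bd_bd (hK : Ball d K) : bd (bd K) = ∅ := by
  obtain ⟨e, rfl⟩ := hK.pos
  exact hK.sphere_bd.bd_eq_empty

/-- A ball and its complement in a sphere have the same boundary, by counting modulo 2. -/
theorem Ball.bd_closedCompl [Infinite α] (hK : Ball d K) (hS : Sphere d S) (hKS : K ⊆ S) :
    bd (closedCompl S K) = bd K := by
  have hC := hK.isCx_closedCompl hS hKS
  ext T
  have h1 := deg_union hK.isCx.fin hC.fin T
  rw [union_closedCompl hKS, inter_closedCompl hKS] at h1
  constructor
  · intro hT
    by_contra hTb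
    have hTK : T ∉ K := fun h => hTb (hT.1.2 h)
    rw [deg_eq_one_of_bd_eq_empty hS.bd_eq_empty hT.1.1, hT.2,
      deg_eq_zero_of_notMem hK.isCx.down hTK, deg_eq_zero_of_notMem hK.isCx_bd.down hTb] at h1
    simp at h1
  · intro hT
    refine ⟨⟨hKS hT.1, fun _ => hT⟩, ?_⟩
    rw [deg_eq_one_of_bd_eq_empty hS.bd_eq_empty (hKS hT.1), hT.2,
      deg_eq_one_of_bd_eq_empty hK.bd_bd hT, zero_add] at h1
    rw [← h1]; decide

theorem cone_union : cone v (K ∪ L) = cone v K ∪ cone v L := rfl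

theorem cone_comm : cone v (cone w K) = cone w (cone v K) := by
  ext T
  rw [mem_cone, mem_cone, mem_cone, mem_cone, Finset.erase_right_comm]

theorem del_cone (hv : Fresh v K) : del {v} (cone v K) = K := by
  ext T
  rw [mem_del_singleton]
  constructor
  · rintro ⟨h1, h2⟩; rwa [mem_cone_of_notMem h2] at h1
  · exact fun h => ⟨(mem_cone_of_notMem (hv T h)).2 h, hv T h⟩

theorem insert_mem_bd_cone (hv : Fresh v K) (hT : T ∈ bd K) :
    insert v T ∈ bd (cone v K) := by
  have h1 := bd_lk (X := {v}) (K := cone v K)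
  rw [lk_cone hv] at h1
  rw [h1] at hT
  exact hT.2

theorem mem_bd_cone (hK : IsCx K) (hv : Fresh v K) (hT : T ∈ cone v (bd K)) :
    T ∈ bd (cone v K) := by
  rcases insert_cases v T with ⟨U, hU, rfl⟩ | hvT
  · rw [mem_cone, Finset.erase_insert hU] at hT
    exact insert_mem_bd_cone hv hT
  · rw [mem_cone_of_notMem hvT] at hT
    refine ⟨(mem_cone_of_notMem hvT).2 hT.1, ?_⟩
    rw [deg_eq_deg_del_add (hK.simplexJoin _).fin v, del_cone hv, hT.2,
      (insert_mem_bd_cone hv hT).2, add_zero]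

/-- Alexander's theorem for families of finite sets. -/
theorem relEquiv_union [Infinite α] (hM : Mfd (d + 1) M) (hJ : Ball (d + 1) J)
    (hK : Ball d (M ∩ J)) (hKM : ∀ T ∈ M ∩ J, T.Nonempty → T ∈ bd M)
    (hKJ : ∀ T ∈ M ∩ J, T.Nonempty → T ∈ bd J) : RelEquiv ∅ (M ∪ J) M := by
  have hSs := hJ.sphere_bd
  have hS := hSs.isCx
  have hKS : M ∩ J ⊆ bd J := fun T hT => by
    rcases T.eq_empty_or_nonempty with rfl | h
    · exact hS.empty_mem
    · exact hKJ T hT h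
  have hKe : ∀ T, T ∈ M → T ∈ J → T ∈ M ∩ J := fun T h1 h2 => ⟨h1, h2⟩
  have hKMs : M ∩ J ⊆ M := Set.inter_subset_left
  generalize M ∩ J = K at *
  have hb := hK.isCx_bd
  obtain ⟨v, -, hvMJ⟩ := exists_fresh (hM.1.fin.union hJ.isCx.fin) ∅
  obtain ⟨hvM, hvJ⟩ := fresh_union.1 hvMJ
  have hvS : Fresh v (bd J) := hvJ.mono bd_subset
  have hvK := hvM.mono hKMs
  obtain ⟨w, hwv, hwMJ⟩ := exists_fresh (hM.1.fin.union hJ.isCx.fin) {v}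
  rw [Finset.mem_singleton] at hwv
  obtain ⟨hwM, hwJ⟩ := fresh_union.1 hwMJ
  have hwK := hwM.mono hKMs
  -- the ball becomes a cone over its boundary
  have h1 := (hJ.relEquiv_cone_bd hvJ).extend (hM.1.union hS) hJ.isCx
    (fun T hT hT' => by
      rwa [mem_cone_of_notMem (fresh_union.2 ⟨hvM, hvS⟩ T hT)] at hT')
    (fun T hT hT' => hT.elim (fun h => hKS (hKe T h hT')) id) hS Set.subset_union_right
  have h2 := h1.union hM.1 Set.subset_union_left
  -- the complementary ball becomes a cone
  have hCs := hK.isCx_closedCompl hSs hKS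
  have hCb := hK.ball_closedCompl hSs hKS
  have hwC : Fresh w (closedCompl (bd J) K) := (hwJ.mono bd_subset).mono fun T h => h.1
  have h3 := hCb.relEquiv_cone_bd hwC
  rw [hK.bd_closedCompl hSs hKS] at h3
  have hF : IsCx (M ∪ cone v K) := hM.1.union (hK.isCx.simplexJoin _)
  have h4 := h3.extend hF hCs
    (fun T hT hT' => by
      rwa [mem_cone_of_notMem (fresh_union.2 ⟨hwM, hwK.cone hwv⟩ T hT)] at hT')
    (fun T hT hT' => by
      refine hT'.2 (hT.elim (fun h => hKe T h (bd_subset hT'.1)) fun h => ?_)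
      rwa [mem_cone_of_notMem (hvS T hT'.1)] at h) hb
    (fun T hT => Or.inl (hKMs (bd_subset hT)))
  have h5 := RelEquiv.simplexJoin hF
    (A := {v}) (Or.inr (mem_cone.2 (by simpa using hK.isCx.empty_mem))) hCs h4
    (fun x hx => by rw [Finset.mem_singleton.1 hx]; exact hvS.mono fun T h => h.1)
  have h6 := h5.union hF subset_rfl
  -- two cones over balls in the boundary can be removed
  have h7 := hK.attachable M v hM hKM hvM
  have hM2 : Mfd (d + 1) (M ∪ cone v K) := hM.of_equiv h7
  obtain ⟨e, rfl⟩ := hK.pos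
  have hD : Ball (e + 1) (cone v (bd K)) := by
    have := hK.sphere_bd.simplexJoin (A := {v}) (by simp) (fun x hx => by
      rw [Finset.mem_singleton.1 hx]; exact hvK.mono bd_subset)
    rwa [Finset.card_singleton] at this
  have hMK : M ∩ cone v K = K := by
    ext T
    constructor
    · rintro ⟨h1, h2⟩; rwa [mem_cone_of_notMem (hvM T h1)] at h2
    · exact fun h => ⟨hKMs h, subset_cone hvK h⟩
  have h8 := hD.attachable (M ∪ cone v K) w hM2 (fun T hT hTn => by
    have h9 := mem_bd_cone hK.isCx hvK hT
    have h10 := deg_union hM.1.fin (hK.isCx.simplexJoin {v}).fin T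
    refine ⟨Or.inr h9.1, ?_⟩
    rw [hMK, h9.2, add_zero] at h10
    rcases insert_cases v T with ⟨U, hU, rfl⟩ | hvT
    · rw [deg_eq_zero_of_notMem hM.1.down fun h => hvM _ h (by simp),
        deg_eq_zero_of_notMem hK.isCx.down fun h => hvK _ h (by simp), add_zero] at h10
      exact h10
    · rw [mem_cone_of_notMem hvT] at hT
      rw [(hKM T hT.1 hTn).2, hT.2, add_zero] at h10
      exact h10) (fresh_union.2 ⟨hwM, hwK.cone hwv⟩)
  have e1 : cone v (bd J) ∪ M = cone v (closedCompl (bd J) K) ∪ (M ∪ cone v K) := by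
    conv_lhs => rw [← union_closedCompl hKS, cone_union]
    ext T; simp only [Set.mem_union]; tauto
  have e2 : cone v (cone w (bd K)) ∪ (M ∪ cone v K) = (M ∪ cone v K) ∪ cone w (cone v (bd K)) := by
    rw [cone_comm, Set.union_comm]
  rw [e1, Set.union_comm J M] at h2
  rw [e2] at h6
  exact (h2.mono (Set.empty_subset _)).trans ((h6.mono (Set.empty_subset _)).trans (h8.trans h7))

end

/-! ### Transfer to simplicial complexes -/

section

variable {α : Type*} [DecidableEq α]
variable {F G X Y : Set (Finset α)} {A B C T s t : Finset α}
  {a b c u v w x : α} {d e : ℕ} {K L M J K' : PreAbstractSimplicialComplex α}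

/-- The family of all simplexes of a complex, the empty simplex included. -/
def cx (K : PreAbstractSimplicialComplex α) : Set (Finset α) := insert ∅ K.faces

theorem mem_cx : T ∈ cx K ↔ T = ∅ ∨ T ∈ K.faces := Iff.rfl

theorem nonempty_of_mem_faces (h : T ∈ K.faces) : T.Nonempty := (K.isRelLowerSet_faces h).1

theorem mem_faces_iff : T ∈ K.faces ↔ T.Nonempty ∧ T ∈ cx K := by
  rw [mem_cx]
  constructor
  · exact fun h => ⟨nonempty_of_mem_faces h, Or.inr h⟩
  · exact fun h => h.2.resolve_left h.1.ne_empty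

theorem cx_down (h : T ∈ cx K) (hU : C ⊆ T) : C ∈ cx K := by
  rcases C.eq_empty_or_nonempty with rfl | hC
  · exact Or.inl rfl
  · rcases h with rfl | h
    · exact absurd (Finset.subset_empty.1 hU) hC.ne_empty
    · exact Or.inr ((K.isRelLowerSet_faces h).2 hU hC)

theorem isCx_cx (hK : K.faces.Finite) : IsCx (cx K) :=
  ⟨Or.inl rfl, fun _ _ h hU => cx_down h hU, hK.insert ∅⟩

theorem cx_injective : Function.Injective (cx (α := α)) := by
  intro K L h
  ext T
  show T ∈ K.faces ↔ T ∈ L.faces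
  rw [mem_faces_iff, mem_faces_iff, h]

theorem cx_simplex : cx (simplex s) = fullSimplex s := by
  ext T
  show T = ∅ ∨ (T.Nonempty ∧ T ⊆ s) ↔ T ⊆ s
  rcases T.eq_empty_or_nonempty with rfl | h
  · simp
  · simp [h, h.ne_empty]

theorem cx_simplexBoundary (hs : s.Nonempty) : cx (simplexBoundary s) = properFaces s := by
  ext T
  show T = ∅ ∨ (T.Nonempty ∧ T ⊂ s) ↔ T ⊂ s
  rcases T.eq_empty_or_nonempty with rfl | h
  · simpa using hs
  · simp [h, h.ne_empty]

theorem mem_cx_join : T ∈ cx (join K L) ↔ ∃ P ∈ cx K, ∃ Q ∈ cx L, T = P ∪ Q := by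
  constructor
  · rintro (rfl | ⟨-, P, Q, hP, hQ, h⟩)
    · exact ⟨∅, Or.inl rfl, ∅, Or.inl rfl, by simp⟩
    · exact ⟨P, hP, Q, hQ, h⟩
  · rintro ⟨P, hP, Q, hQ, h⟩
    rcases T.eq_empty_or_nonempty with h0 | h0
    · exact Or.inl h0
    · exact Or.inr ⟨h0, P, Q, hP, hQ, h⟩

theorem cx_link (hA : A ∈ K.faces) : cx (link A K) = lk A (cx K) := by
  ext T
  rw [mem_lk]
  constructor
  · rintro (rfl | ⟨-, h1, h2⟩)
    · exact ⟨by simp, by rw [Finset.union_empty]; exact Or.inr hA⟩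
    · exact ⟨h1, Or.inr h2⟩
  · rintro ⟨h1, h2⟩
    rcases T.eq_empty_or_nonempty with h0 | h0
    · exact Or.inl h0
    · exact Or.inr ⟨mem_faces_iff.2 ⟨h0, cx_down h2 Finset.subset_union_right⟩, h1,
        mem_faces_iff.2 ⟨h0.mono Finset.subset_union_right, h2⟩⟩

theorem mem_cx_star (hA : A ∈ K.faces) : T ∈ cx (star A K) ↔ T ∪ A ∈ cx K := by
  rw [star, mem_cx_join, cx_simplex, cx_link hA]
  constructor
  · rintro ⟨P, hP, Q, hQ, rfl⟩
    refine cx_down hQ.2 ?_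
    rw [mem_fullSimplex] at hP
    exact Finset.union_subset (Finset.union_subset_union_left hP) Finset.subset_union_left
  · intro h
    refine ⟨T ∩ A, Finset.inter_subset_right, T \ A, ⟨Finset.disjoint_sdiff, ?_⟩, ?_⟩
    · rwa [Finset.union_sdiff_self_eq_union, Finset.union_comm]
    · rw [Finset.union_comm, Finset.sdiff_union_inter]

theorem mem_cx_join_simplexBoundary_link (hA : A ∈ K.faces) :
    T ∈ cx (join (simplexBoundary A) (link A K)) ↔ ¬ A ⊆ T ∧ T ∪ A ∈ cx K := by
  rw [mem_cx_join, cx_simplexBoundary (nonempty_of_mem_faces hA), cx_link hA]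
  constructor
  · rintro ⟨P, hP, Q, hQ, rfl⟩
    rw [mem_properFaces] at hP
    refine ⟨fun h => hP.2 ?_, cx_down hQ.2 ?_⟩
    · intro x hx
      exact (Finset.mem_union.1 (h hx)).resolve_right fun h => Finset.disjoint_left.1 hQ.1 hx h
    · intro x hx
      have : x ∈ P → x ∈ A := fun h => hP.1 h
      simp only [Finset.mem_union] at *
      tauto
  · rintro ⟨h1, h⟩
    refine ⟨T ∩ A, ?_, T \ A, ⟨Finset.disjoint_sdiff, ?_⟩, ?_⟩
    · exact ⟨Finset.inter_subset_right, fun h => h1 (h.trans Finset.inter_subset_left)⟩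
    · rwa [Finset.union_sdiff_self_eq_union, Finset.union_comm]
    · rw [Finset.union_comm, Finset.sdiff_union_inter]

theorem fresh_cx_iff : Fresh a (cx K) ↔ a ∉ vertices K := by
  constructor
  · exact fun h h' => h _ (Or.inr h') (by simp)
  · intro h T hT haT
    exact h (mem_faces_iff.2 ⟨by simp, cx_down hT (by simpa using haT)⟩)

/-- The subdivision in terms of stars and joins is the operation `sd`. -/
theorem faces_subdivision_iff (hA : A ∈ K.faces) (ha : a ∉ vertices K) :
    K'.faces = (K.faces \ (star A K).faces) ∪
      (join (simplex {a}) (join (simplexBoundary A) (link A K))).faces ↔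
    cx K' = sd A a (cx K) := by
  have haK := fresh_cx_iff.2 ha
  have haA := haK A (Or.inr hA)
  have key : ∀ T : Finset α, T.Nonempty → (T ∈ (K.faces \ (star A K).faces) ∪
      (join (simplex {a}) (join (simplexBoundary A) (link A K))).faces ↔ T ∈ sd A a (cx K)) := by
    intro T hT
    have e1 : T ∈ (join (simplex {a}) (join (simplexBoundary A) (link A K))).faces ↔
        ¬ A ⊆ T.erase a ∧ T.erase a ∪ A ∈ cx K := by
      rw [mem_faces_iff, and_iff_right hT, mem_cx_join, ← mem_cx_join_simplexBoundary_link hA,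
        cx_simplex]
      constructor
      · rintro ⟨P, hP, Q, hQ, rfl⟩
        refine cx_down hQ fun x hx => ?_
        have := @hP x
        simp only [Finset.mem_erase, Finset.mem_union, Finset.mem_singleton] at *
        tauto
      · intro h
        refine ⟨T ∩ {a}, Finset.inter_subset_right, _, h, ?_⟩
        ext x
        simp only [Finset.mem_union, Finset.mem_inter, Finset.mem_singleton, Finset.mem_erase]
        tauto
    rw [Set.mem_union, e1, Set.mem_sdiff, mem_faces_iff, mem_faces_iff, mem_cx_star hA, mem_sd,
      and_iff_right hT, and_iff_right hT, Finset.subset_erase]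
    have h1 := haK T
    by_cases haT : a ∈ T
    · tauto
    · rw [Finset.erase_eq_of_notMem haT]
      have h2 : T ∪ A ∈ cx K → T ∈ cx K := fun h => cx_down h Finset.subset_union_left
      have h3 : A ⊆ T → T ∪ A = T := Finset.union_eq_left.2
      by_cases hAT : A ⊆ T
      · rw [h3 hAT]; tauto
      · by_cases hTA : T ∪ A ∈ cx K
        · simp [hTA, h2 hTA, hAT, haT]
        · simp [hTA, hAT, haT]
  constructor
  · intro h
    ext T
    rcases T.eq_empty_or_nonempty with rfl | hT
    · refine iff_of_true (Or.inl rfl) ⟨fun h => ?_, Or.inr ⟨by simp, Or.inl rfl⟩⟩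
      exact (nonempty_of_mem_faces hA).ne_empty (Finset.subset_empty.1 h)
    · rw [← key T hT, ← h, mem_faces_iff, and_iff_right hT]
  · intro h
    ext T
    rcases T.eq_empty_or_nonempty with rfl | hT
    · refine iff_of_false (fun h => by simpa using nonempty_of_mem_faces h) ?_
      rintro (h | h)
      · simpa using nonempty_of_mem_faces h.1
      · simpa using nonempty_of_mem_faces h
    · rw [key T hT, ← h, mem_faces_iff, and_iff_right hT]

theorem isStellarSubdivision_iff :
    IsStellarSubdivision K K' ↔ ∃ A ∈ K.faces, ∃ a, Fresh a (cx K) ∧ cx K' = sd A a (cx K) := by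
  refine exists_congr fun A => and_congr_right fun hA => exists_congr fun a => ?_
  rw [fresh_cx_iff]
  exact and_congr_right fun ha => faces_subdivision_iff hA ha

/-- A complex with a finite subdivision is finite. Stellar equivalence is defined without
finiteness, so that this is needed to see that all complexes in a chain of moves are finite. -/
theorem finite_of_finite_sd (hA : A ∈ X) (hAn : A.Nonempty) (ha : Fresh a X)
    (h : (sd A a X).Finite) : X.Finite := by
  refine (h.union (h.image fun U => U.erase a ∪ A)).subset fun T hT => ?_
  by_cases hAT : A ⊆ T
  · obtain ⟨x, hx⟩ := hAn
    refine Or.inr ⟨_, insert_erase_mem_sd hA ha subset_rfl hT hAT hx, ?_⟩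
    dsimp only
    rw [Finset.erase_insert (fun h => ha T hT (Finset.mem_of_mem_erase h))]
    ext y
    have := @hAT y
    have := @hAT x hx
    by_cases hyx : y = x
    · simp [hyx, hx, this]
    · simp [hyx]; tauto
  · exact Or.inl ⟨hAT, Or.inr ⟨ha T hT, hT⟩⟩

theorem finite_cx_iff : (cx K).Finite ↔ K.faces.Finite :=
  ⟨fun h => h.subset (Set.subset_insert _ _), fun h => h.insert ∅⟩

theorem StellarEquiv.finite_and_relEquiv [Infinite α] (h : StellarEquiv K L) :
    (K.faces.Finite ↔ L.faces.Finite) ∧ (K.faces.Finite → RelEquiv ∅ (cx K) (cx L)) := by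
  induction h with
  | refl K => exact ⟨Iff.rfl, fun _ => .refl _ _⟩
  | symm K L _ ih => exact ⟨ih.1.symm, fun h => (ih.2 (ih.1.2 h)).symm⟩
  | trans K L M _ _ ih1 ih2 =>
    exact ⟨ih1.1.trans ih2.1, fun h => (ih1.2 h).trans (ih2.2 (ih1.1.1 h))⟩
  | rel K L h =>
    rcases h with h | ⟨f, hf, hf'⟩
    · obtain ⟨A, hA, a, ha, e⟩ := isStellarSubdivision_iff.1 h
      have hAn := nonempty_of_mem_faces hA
      constructor
      · rw [← finite_cx_iff, ← finite_cx_iff (K := L), e]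
        exact ⟨fun h => ((isCx_cx (finite_cx_iff.1 h)).sd hAn a).fin,
          finite_of_finite_sd (Or.inr hA) hAn ha⟩
      · intro hK
        rw [e]
        exact .step (isCx_cx hK) (Or.inr hA) hAn (by simp) ha (fresh_empty _)
    · refine ⟨hf'.finite_iff_finite, fun hK => ?_⟩
      have e : cx L = Finset.image f '' cx K := by
        rw [cx, cx, Set.image_insert_eq, Finset.image_empty, hf'.image_eq]
      rw [e]
      refine relEquiv_image (isCx_cx hK) (hf.injOn.mono fun v hv => ?_)
      exact mem_faces_iff.2 ⟨by simp, hv⟩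

/-- The simplicial complex with a given family of simplexes. For an arbitrary family these are the
nonempty sets all of whose subsets belong to the family. -/
def ofCx (X : Set (Finset α)) : PreAbstractSimplicialComplex α where
  faces := {T | T.Nonempty ∧ ∀ U ⊆ T, U ∈ X}
  isRelLowerSet_faces := fun _ hT =>
    ⟨hT.1, fun _ hU hn => ⟨hn, fun _ hV => hT.2 _ (hV.trans hU)⟩⟩

theorem cx_ofCx (hX : IsCx X) : cx (ofCx X) = X := by
  ext T
  constructor
  · rintro (rfl | h)
    · exact hX.empty_mem
    · exact h.2 T subset_rfl
  · intro h
    rcases T.eq_empty_or_nonempty with h0 | h0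
    · exact Or.inl h0
    · exact Or.inr ⟨h0, fun U hU => hX.down h hU⟩

theorem ofCx_cx : ofCx (cx K) = K := by
  refine cx_injective ?_
  ext T
  constructor
  · rintro (rfl | h)
    · exact Or.inl rfl
    · exact h.2 T subset_rfl
  · rintro (rfl | h)
    · exact Or.inl rfl
    · exact Or.inr ⟨nonempty_of_mem_faces h, fun U hU => cx_down (Or.inr h) hU⟩

theorem RelEquiv.stellarEquiv (h : RelEquiv ∅ (cx K) (cx L)) : StellarEquiv K L := by
  suffices H : ∀ X Y : Set (Finset α), RelEquiv ∅ X Y → StellarEquiv (ofCx X) (ofCx Y) by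
    have := H _ _ h
    rwa [ofCx_cx, ofCx_cx] at this
  intro X Y h
  induction h with
  | refl X => exact .refl _
  | symm X Y _ ih => exact .symm _ _ ih
  | trans X Y Z _ _ ih1 ih2 => exact .trans _ _ _ ih1 ih2
  | rel X Y h =>
    obtain ⟨hX, A, hA, hAn, -, a, ha, -, rfl⟩ := h
    refine .rel _ _ (Or.inl (isStellarSubdivision_iff.2 ⟨A, ?_, a, ?_, ?_⟩))
    · rw [mem_faces_iff, cx_ofCx hX]; exact ⟨hAn, hA⟩
    · rwa [cx_ofCx hX]
    · rw [cx_ofCx hX, cx_ofCx (hX.sd hAn a)]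

theorem IsStellarBall.ball [Infinite α] {n : ℤ} (h : IsStellarBall n K) :
    K.faces.Finite ∧ ∃ d : ℕ, (d : ℤ) = n + 1 ∧ Ball d (cx K) := by
  obtain ⟨s, hs, hn, h⟩ := h
  have h1 : (simplex s).faces.Finite := by
    rw [← finite_cx_iff, cx_simplex]; exact (isCx_fullSimplex s).fin
  have hK := h.finite_and_relEquiv.1.2 h1
  have h2 := h.finite_and_relEquiv.2 hK
  rw [cx_simplex] at h2
  exact ⟨hK, s.card, hn, s, rfl, hs, h2⟩

theorem IsStellarSphere.sphere [Infinite α] {n : ℤ} (h : IsStellarSphere n K) :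
    ∃ d : ℕ, (d : ℤ) = n + 1 ∧ Sphere d (cx K) := by
  obtain ⟨s, hs, hn, h⟩ := h
  have h1 : (simplexBoundary s).faces.Finite := by
    rw [← finite_cx_iff, cx_simplexBoundary hs]; exact (isCx_properFaces hs).fin
  have h2 := h.finite_and_relEquiv.2 (h.finite_and_relEquiv.1.2 h1)
  rw [cx_simplexBoundary hs] at h2
  have := Finset.card_pos.2 hs
  exact ⟨s.card - 1, by omega, s, by omega, h2⟩

theorem Ball.isStellarBall (h : Ball d (cx K)) : IsStellarBall ((d : ℤ) - 1) K := by
  obtain ⟨s, hs, hn, h⟩ := h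
  refine ⟨s, hn, by omega, RelEquiv.stellarEquiv ?_⟩
  rwa [cx_simplex]

/-- The boundary defined by links consists of the nonempty simplexes of the parity boundary. -/
theorem mem_boundaryFaces_iff [Infinite α]
    (hl : ∀ T ∈ cx K, T.Nonempty → ∃ e, BallOrSphere e (lk T (cx K))) :
    T ∈ boundaryFaces K ↔ T.Nonempty ∧ T ∈ bd (cx K) := by
  constructor
  · rintro ⟨hT, k, h⟩
    obtain ⟨-, e, -, h⟩ := h.ball
    rw [cx_link hT] at h
    have h1 := h.isCx_bd.empty_mem
    rw [bd_lk] at h1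
    exact ⟨nonempty_of_mem_faces hT, by simpa [mem_lk] using h1⟩
  · rintro ⟨hTn, hT⟩
    have hTK : T ∈ K.faces := mem_faces_iff.2 ⟨hTn, bd_subset hT⟩
    obtain ⟨e, h1⟩ := hl T (bd_subset hT) hTn
    have h2 := h1.ball_of_mem_bd hT
    rw [← cx_link hTK] at h2
    exact ⟨hTK, _, h2.isStellarBall⟩

theorem IsStellarManifold.mfd [Infinite α] {n : ℕ} (h : IsStellarManifold n K) :
    Mfd (n + 1) (cx K) := by
  refine ⟨isCx_cx h.1, fun v hv => ⟨n, rfl, ?_⟩⟩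
  have hv' : {v} ∈ K.faces := mem_faces_iff.2 ⟨by simp, hv⟩
  rw [← cx_link hv']
  rcases h.2 v hv' with h | h
  · obtain ⟨-, e, he, h'⟩ := h.ball
    obtain rfl : e = n := by omega
    exact Or.inl h'
  · obtain ⟨e, he, h'⟩ := h.sphere
    obtain rfl : e = n := by omega
    exact Or.inr h'

end

end Stellar

theorem theorem3p9 {α : Type*} [DecidableEq α] [Infinite α] (n : ℕ)
    (M J : PreAbstractSimplicialComplex α)
    (hM : Stellar.IsStellarManifold n M)
    (hJ : Stellar.IsStellarBall n J)
    (hMJ : (M ⊓ J).faces = Stellar.boundaryFaces M ∩ Stellar.boundaryFaces J)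
    (hK : Stellar.IsStellarBall ((n : ℤ) - 1) (M ⊓ J)) :
    Stellar.StellarEquiv (M ⊔ J) M := by
  have hM' := hM.mfd
  obtain ⟨-, d, hd, hJ'⟩ := hJ.ball
  obtain rfl : d = n + 1 := by omega
  obtain ⟨-, d, hd, hK'⟩ := hK.ball
  obtain rfl : d = n := by omega
  have e1 : Stellar.cx (M ⊓ J) = Stellar.cx M ∩ Stellar.cx J := Set.insert_inter_distrib _ _ _
  have e2 : Stellar.cx (M ⊔ J) = Stellar.cx M ∪ Stellar.cx J := Set.insert_union_distrib _ _ _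
  have hb : ∀ T ∈ Stellar.cx M ∩ Stellar.cx J, T.Nonempty →
      T ∈ Stellar.bd (Stellar.cx M) ∧ T ∈ Stellar.bd (Stellar.cx J) := by
    intro T hT hTn
    rw [← e1] at hT
    have h1 := Stellar.mem_faces_iff.2 ⟨hTn, hT⟩
    rw [hMJ] at h1
    refine ⟨((Stellar.mem_boundaryFaces_iff fun T hT hTn => ?_).1 h1.1).2,
      ((Stellar.mem_boundaryFaces_iff fun T hT _ => ?_).1 h1.2).2⟩
    · obtain ⟨e, -, h⟩ := hM'.lk hT hTn
      exact ⟨e, h⟩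
    · obtain ⟨e, -, h⟩ := Stellar.linkProperty _ _ T (Or.inl hJ') hT
      exact ⟨e, h⟩
  rw [e1] at hK'
  refine Stellar.RelEquiv.stellarEquiv ?_
  rw [e2]
  exact Stellar.relEquiv_union hM' hJ' hK' (fun T hT h => (hb T hT h).1) fun T hT h => (hb T hT h).2
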